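/- **Setting.** Let $n\ge 2$ agents communicate over a connected undirected graph with symmetric weight matrix $W$ ($w_{ij}>0$ on edges, $w_{ij}=0$ otherwise). Let $L=\mathrm{diag}(\sum_j w_{ij})-W$ be its Laplacian, $\underline\lambda$ its smallest positive eigenvalue and $\bar\lambda$ its spectral radius. Let $f_i(x)=\mathbb E_{\xi\sim\mathcal D_i}[F_i(x,\xi)]$ on $\mathbb R^d$, $f=\frac1n\sum_{i=1}^n f_i$ and $f^*=\inf f$. Assume: * each $f_i$ is differentiable with $L_f$-Lipschitz gradient, $L_f>0$; * $\mathbb E_{\xi\sim\mathcal D_i}[\nabla F_i(x,\xi)]=\nabla f_i(x)$ and $\mathbb E_{\xi\sim\mathcal D_i}\|\nabla F_i(x,\xi)-\nabla f_i(x)\|^2\le\sigma^2$ for all $i$ and $x$, with $\sigma>0$; * $f^*>-\infty$, and the Polyak–Łojasiewicz condition $\frac12\|\nabla f(x)\|^2\ge\nu(f(x)-f^*)$ holds for all $x$, with $\nu>0$; * $\mathcal C$ is a random compressor with $\mathbb E_{\mathcal C}\|\mathcal C(x)/r-x\|^2\le(1-\varphi)\|x\|^2+\sigma_{\mathcal C}$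 for all $x$, where $\varphi\in(0,1]$, $r>0$, $\sigma_{\mathcal C}\ge0$. **Algorithm.** From arbitrary deterministic $x_{i,0}$ and $v_{i,0}=x^c_{i,0}=0$ iterate $$\hat x_{j,k}=x^c_{j,k}+h_k\,\mathcal C\big((x_{j,k}-x^c_{j,k})/h_k\big),\qquad x^c_{j,k+1}=(1-\alpha_x)x^c_{j,k}+\alpha_x\hat x_{j,k},$$ $$x_{i,k+1}=x_{i,k}-\eta\Big(\gamma\sum_j L_{ij}\hat x_{j,k}+\omega v_{i,k}+\nabla F_i(x_{i,k},\xi_{i,k})\Big),\qquad v_{i,k+1}=v_{i,k}+\eta\omega\sum_j L_{ij}\hat x_{j,k},$$ where the $\xi_{i,k}\sim\mathcal D_i$ are mutually independent and the compressor uses fresh randomness in each step, independent of the data. Put $\bar x_k=\frac1n\sum_i x_{i,k}$. **Parameters.** Let $\theta\in(0,1)$, $h_0\in(0,\frac12)$, $\alpha_x\in(0,\frac1r)$, $\beta_5>0$, $\beta_1>c_0:=\max\{\frac{9+\beta_5}{2\underline\lambda},1\}$ and $\beta_2\in(0,1)$. For the horizon $T\in\mathbb N$ take $\omega=\beta_2(T+1)^\theta$,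 $\gamma=\beta_1\omega$, $\eta=\beta_2/\omega$, $h_k=h_0^k$. Put $\varphi_1=\alpha_x r\varphi$, $r_0=2r^2(1-\varphi)+2(1-r)^2$ and $$\tilde\epsilon_1=\tfrac{\gamma\underline\lambda}2-\tfrac{9\omega+4}4-\tfrac54L_f^2,\qquad \tilde\epsilon_2=(7+\tfrac{16}{\varphi_1})L_f^2+(7+\tfrac8{\varphi_1})\gamma^2\bar\lambda^2+1+2\omega^2,$$ $$\epsilon_4=\tfrac{3\omega-1}4-\tfrac3{\underline\lambda},\qquad \epsilon_5=2\omega^2\bar\lambda+\tfrac1{\underline\lambda}+(4+\tfrac8{\varphi_1})\omega^2\underline\lambda,$$ $$\epsilon_6=\tfrac18-\Big(\tfrac{2(1+\beta_1)^2}{\omega^2\underline\lambda}+\tfrac1{\omega^2\underline\lambda^2}\Big)L_f^2,\qquad \epsilon_7=\Big(\tfrac{1+\beta_1}{\omega^2\underline\lambda}+\tfrac1{\omega^2\underline\lambda^2}+\tfrac32\Big)L_f^2+L_f,$$ $$\epsilon_{10}=\tfrac{\varphi_1+\varphi_1^2}2,\qquad \epsilon_{11}=\tfrac12(\gamma+2\omega)\bar\lambda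 r_0+2\omega r_0,\qquad \epsilon_{12}=\tfrac{(8+7\varphi_1)\gamma^2\bar\lambda^2r_0}{\varphi_1}+(1+2\omega^2)r_0,$$ $$\beta_4=\min\Big\{\tfrac{\tilde\epsilon_1}{\tilde\epsilon_2},\tfrac{\epsilon_4}{\epsilon_5},\tfrac{\epsilon_6}{\epsilon_7},\tfrac{\sqrt{\epsilon_{11}^2+4\epsilon_{10}\epsilon_{12}}-\epsilon_{11}}{2\epsilon_{12}},1\Big\},\qquad \beta_6=\Big(\tfrac{16(1+\beta_1)^2}{\underline\lambda}+\tfrac8{\underline\lambda^2}\Big)L_f^2,$$ $$\beta_3=\max\Big\{\tfrac{4+5L_f^2}{\beta_5},\tfrac{12\underline\lambda^{-1}+1}3,\sqrt{\beta_6},\tfrac{\beta_2}{\beta_4},4\beta_2L_f\Big\},$$ where the fourth entry of $\beta_4$ is omitted if $r_0=0$. Note that $\beta_3$ depends on $T$ through $\omega$. **Theorem.** There is a constant $C_1$ depending only on $L_f,\sigma,\nu,\theta$, and a constant $C_2$ depending only on these, on $\varphi,r,\sigma_{\mathcal C},\alpha_x,\beta_1,\beta_2,\beta_5,h_0,\underline\lambda,\bar\lambda$,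 and on an upper bound $M$ for the initial quantities $\frac1n\sum_i\|x_{i,0}\|^2$, $f(\bar x_0)-f^*$ and $\frac1n\sum_i\|\nabla f_i(\bar x_0)\|^2$ (in particular, neither constant depends on $n$, $d$ or $T$), such that for every $T\in\mathbb N$ with $T\ge(\beta_3/\beta_2)^{1/\theta}$ the expectations below are finite and $$\mathbb E\Big[\frac1n\sum_{i=1}^n\|x_{i,T}-\bar x_T\|^2\Big]\le\frac{C_2}{T^{2\theta}},\qquad \mathbb E\big[f(\bar x_T)-f^*\big]\le\frac{C_1}{nT^\theta}+\frac{C_2}{T^{2\theta}}.$$ -/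

import Mathlib

open MeasureTheory ProbabilityTheory

noncomputable section

namespace RCPSGD

/-- The decision space `ℝ^d` with its Euclidean norm. -/
abbrev E (d : ℕ) : Type := EuclideanSpace ℝ (Fin d)

/-! ### The communication network -/

/-- `W` is a coupling weight matrix of the undirected graph `G`. -/
structure IsWeightMatrix {n : ℕ} (G : SimpleGraph (Fin n)) (W : Matrix (Fin n) (Fin n) ℝ) :
    Prop where
  symm : W.IsSymm
  pos : ∀ i j, G.Adj i j → 0 < W i j
  zero : ∀ i j, ¬ G.Adj i j → W i j = 0

/-- The Laplacian `L = D - W`, with `D` the diagonal matrix of the weighted degrees. -/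
def laplacian {n : ℕ} (W : Matrix (Fin n) (Fin n) ℝ) : Matrix (Fin n) (Fin n) ℝ :=
  Matrix.diagonal (fun i => ∑ j, W i j) - W

/-- `lam` is the minimum positive eigenvalue of `L`. -/
def IsMinPosEigenvalue {n : ℕ} (L : Matrix (Fin n) (Fin n) ℝ) (lam : ℝ) : Prop :=
  IsLeast {μ : ℝ | 0 < μ ∧ Module.End.HasEigenvalue (Matrix.toLin' L) μ} lam

/-- `Lam` is the spectral radius of the (real symmetric) matrix `L`. -/
def IsSpectralRadius {n : ℕ} (L : Matrix (Fin n) (Fin n) ℝ) (Lam : ℝ) : Prop :=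
  IsGreatest {s : ℝ | ∃ μ : ℝ, Module.End.HasEigenvalue (Matrix.toLin' L) μ ∧ s = |μ|} Lam

/-! ### The stochastic optimization problem -/

section Problem

variable {n d : ℕ} {Ξ : Type*}

/-- The local cost `f_i(x) = E_{ξ ∼ D_i} [F_i(x, ξ)]`. -/
def localCost [MeasurableSpace Ξ] (F : Fin n → E d → Ξ → ℝ) (D : Fin n → Measure Ξ)
    (i : Fin n) (x : E d) : ℝ :=
  ∫ s, F i x s ∂(D i)

/-- The global cost `f = (1/n) ∑ f_i`. -/
def globalCost [MeasurableSpace Ξ] (F : Fin n → E d → Ξ → ℝ) (D : Fin n → Measure Ξ)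
    (x : E d) : ℝ :=
  (1 / (n : ℝ)) * ∑ i, localCost F D i x

/-- The optimal value `f^*`, the infimum of the global cost (which is assumed bounded below). -/
def optimalValue [MeasurableSpace Ξ] (F : Fin n → E d → Ξ → ℝ) (D : Fin n → Measure Ξ) : ℝ :=
  ⨅ x, globalCost F D x

/-- The stochastic gradient `∇F_i(x, s)`, the gradient being taken in `x`. -/
def stochGrad (F : Fin n → E d → Ξ → ℝ) (i : Fin n) (x : E d) (s : Ξ) : E d :=
  gradient (fun y => F i y s) x

/-- The average `x̄ = (1/n) ∑ x_i`. -/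
def avg (x : Fin n → E d) : E d := (1 / (n : ℝ)) • ∑ i, x i

/-- The local stochastic costs are well defined: integrable in the data, differentiable in the
decision variable, with a jointly measurable gradient. -/
structure WellPosed [MeasurableSpace Ξ] (F : Fin n → E d → Ξ → ℝ) (D : Fin n → Measure Ξ) :
    Prop where
  prob : ∀ i, IsProbabilityMeasure (D i)
  integrable : ∀ i x, Integrable (F i x) (D i)
  differentiable : ∀ i s, Differentiable ℝ (fun x => F i x s)
  measurable_grad : ∀ i, Measurable (fun q : E d × Ξ => stochGrad F i q.1 q.2)

/-- Every local cost is `Lf`-smooth. -/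
def SmoothCosts [MeasurableSpace Ξ] (F : Fin n → E d → Ξ → ℝ) (D : Fin n → Measure Ξ)
    (Lf : ℝ) : Prop :=
  ∀ i, Differentiable ℝ (localCost F D i) ∧
    ∀ x y, ‖gradient (localCost F D i) x - gradient (localCost F D i) y‖ ≤ Lf * ‖x - y‖

/-- The stochastic gradients are unbiased with variance at most `σ²`. -/
def UnbiasedBoundedVariance [MeasurableSpace Ξ] (F : Fin n → E d → Ξ → ℝ)
    (D : Fin n → Measure Ξ) (σ : ℝ) : Prop :=
  ∀ i x,
    Integrable (stochGrad F i x) (D i) ∧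
    ∫ s, stochGrad F i x s ∂(D i) = gradient (localCost F D i) x ∧
    Integrable (fun s => ‖stochGrad F i x s - gradient (localCost F D i) x‖ ^ 2) (D i) ∧
    ∫ s, ‖stochGrad F i x s - gradient (localCost F D i) x‖ ^ 2 ∂(D i) ≤ σ ^ 2

/-- The Polyak–Łojasiewicz condition with constant `ν`. -/
def PolyakLojasiewicz [MeasurableSpace Ξ] (F : Fin n → E d → Ξ → ℝ) (D : Fin n → Measure Ξ)
    (ν : ℝ) : Prop :=
  ∀ x, ν * (globalCost F D x - optimalValue F D) ≤ (1 / 2) * ‖gradient (globalCost F D) x‖ ^ 2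

/-- The initial data `(1/n) ∑ ‖x_{i,0}‖²`, `f(x̄_0) - f^*` and `(1/n) ∑ ‖∇f_i(x̄_0)‖²`
are at most `M`. -/
def InitialBound [MeasurableSpace Ξ] (F : Fin n → E d → Ξ → ℝ) (D : Fin n → Measure Ξ)
    (x₀ : Fin n → E d) (M : ℝ) : Prop :=
  (1 / (n : ℝ)) * ∑ i, ‖x₀ i‖ ^ 2 ≤ M ∧
  globalCost F D (avg x₀) - optimalValue F D ≤ M ∧
  (1 / (n : ℝ)) * ∑ i, ‖gradient (localCost F D i) (avg x₀)‖ ^ 2 ≤ M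

end Problem

/-! ### Compressors -/

/-- A stochastic compressor `C(x) = C(x, z)`, with a random seed `z ∼ Q`, satisfies
`E ‖C(x)/r - x‖² ≤ (1 - φ) ‖x‖² + σC` for all `x`. -/
structure IsCompressor {d : ℕ} {Z : Type*} [MeasurableSpace Z] (C : E d → Z → E d)
    (Q : Measure Z) (φ r σC : ℝ) : Prop where
  prob : IsProbabilityMeasure Q
  measurable : Measurable (fun q : E d × Z => C q.1 q.2)
  integrable : ∀ x, Integrable (fun z => ‖(1 / r) • C x z - x‖ ^ 2) Q
  bound : ∀ x, ∫ z, ‖(1 / r) • C x z - x‖ ^ 2 ∂Q ≤ (1 - φ) * ‖x‖ ^ 2 + σC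

/-- The data points `ξ_{i,k} ∼ D_i` are mutually independent; the compressor seeds `ζ_{i,k} ∼ Q`
are fresh at each step (independent over `k`; seeds of different agents in the same step may be
dependent) and independent of the data. -/
structure IsSampling {n : ℕ} {Ω Ξ Z : Type*} [MeasurableSpace Ω] [MeasurableSpace Ξ]
    [MeasurableSpace Z] (P : Measure Ω) (D : Fin n → Measure Ξ) (Q : Measure Z)
    (ξ : Fin n → ℕ → Ω → Ξ) (ζ : Fin n → ℕ → Ω → Z) : Prop where
  measurable_data : ∀ i k, Measurable (ξ i k)
  measurable_seed : ∀ i k, Measurable (ζ i k)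
  law_data : ∀ i k, P.map (ξ i k) = D i
  law_seed : ∀ i k, P.map (ζ i k) = Q
  indep_data : iIndepFun (fun (q : Fin n × ℕ) => ξ q.1 q.2) P
  indep_seed : iIndepFun (fun (k : ℕ) (o : Ω) (i : Fin n) => ζ i k o) P
  indep_data_seed : IndepFun (fun (o : Ω) (q : Fin n × ℕ) => ξ q.1 q.2 o)
    (fun (o : Ω) (q : Fin n × ℕ) => ζ q.1 q.2 o) P

/-! ### The algorithm -/

/-- The variables `x_{i,k}`, `v_{i,k}`, `x^c_{i,k}` of all agents at one time step. -/
structure State (n d : ℕ) where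
  x : Fin n → E d
  v : Fin n → E d
  xc : Fin n → E d

section Algorithm

variable {n d : ℕ} {Ξ Z : Type*}

/-- `x̂_j = x^c_j + h C((x_j - x^c_j) / h)`, with seed `z j`. -/
def xhat (C : E d → Z → E d) (h : ℝ) (s : State n d) (z : Fin n → Z) (j : Fin n) : E d :=
  s.xc j + h • C ((1 / h) • (s.x j - s.xc j)) (z j)

/-- One step of the algorithm with step parameters `η, γ, ω, h`, data `a` and seeds `z`. -/
def step (W : Matrix (Fin n) (Fin n) ℝ) (F : Fin n → E d → Ξ → ℝ) (C : E d → Z → E d)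
    (αx η γ ω h : ℝ) (a : Fin n → Ξ) (z : Fin n → Z) (s : State n d) : State n d where
  x := fun i => s.x i - η • (γ • ∑ j, laplacian W i j • xhat C h s z j
    + ω • s.v i + stochGrad F i (s.x i) (a i))
  v := fun i => s.v i + (η * ω) • ∑ j, laplacian W i j • xhat C h s z j
  xc := fun j => (1 - αx) • s.xc j + αx • xhat C h s z j

/-- The iterates for given realizations `ξ i k` of the data and `ζ i k` of the seeds, started at
`x_{i,0} = x₀ i`, `v_{i,0} = 0`, `x^c_{i,0} = 0`. -/
def iterates (W : Matrix (Fin n) (Fin n) ℝ) (F : Fin n → E d → Ξ → ℝ) (C : E d → Z → E d)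
    (αx : ℝ) (η γ ω h : ℕ → ℝ) (x₀ : Fin n → E d) (ξ : Fin n → ℕ → Ξ) (ζ : Fin n → ℕ → Z) :
    ℕ → State n d
  | 0 => { x := x₀, v := fun _ => 0, xc := fun _ => 0 }
  | k + 1 => step W F C αx (η k) (γ k) (ω k) (h k) (fun i => ξ i k) (fun i => ζ i k)
      (iterates W F C αx η γ ω h x₀ ξ ζ k)

end Algorithm

/-! ### The parameter thresholds -/

/-- The quantities on which the thresholds depend: the smoothness constant `Lf`, the compressor
constants `φ, r`, the algorithm parameters `αx, β₁, β₂`, the auxiliary `β₅`, and the smallest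
positive eigenvalue `lam` and spectral radius `Lam` of the Laplacian. -/
structure Consts where
  Lf : ℝ
  φ : ℝ
  r : ℝ
  αx : ℝ
  β₁ : ℝ
  β₂ : ℝ
  β₅ : ℝ
  lam : ℝ
  Lam : ℝ

namespace Consts

variable (p : Consts) (ω : ℝ)

def c₀ : ℝ := max ((9 + p.β₅) / (2 * p.lam)) 1

def r₀ : ℝ := 2 * p.r ^ 2 * (1 - p.φ) + 2 * (1 - p.r) ^ 2

def φ₁ : ℝ := p.αx * p.r * p.φ

/-- The parameter `γ` belonging to `ω`. -/
def γ : ℝ := p.β₁ * ω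

def ε₁' : ℝ := p.γ ω / 2 * p.lam - ((9 * ω + 4) / 4 + 5 / 4 * p.Lf ^ 2)

def ε₂' : ℝ :=
  (7 + 16 / p.φ₁) * p.Lf ^ 2 + (4 + 8 / p.φ₁) * p.γ ω ^ 2 * p.Lam ^ 2 + 1 + 2 * ω ^ 2
    + 3 * p.γ ω ^ 2 * p.Lam ^ 2

def ε₄ : ℝ := (3 * ω - 1) / 4 - 3 * p.lam⁻¹

def ε₅ : ℝ := 2 * ω ^ 2 * p.Lam + p.lam⁻¹ + (4 + 8 / p.φ₁) * ω ^ 2 * p.lam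

def ε₆ : ℝ :=
  1 / 8 - (2 * (1 + p.β₁) ^ 2 / (ω ^ 2 * p.lam) + 1 / (ω ^ 2 * p.lam ^ 2)) * p.Lf ^ 2

def ε₇ : ℝ :=
  ((1 + p.β₁) / (ω ^ 2 * p.lam) + 1 / (ω ^ 2 * p.lam ^ 2) + 3 / 2) * p.Lf ^ 2 + p.Lf

def ε₁₀ : ℝ := p.φ₁ / 2 + p.φ₁ ^ 2 / 2

def ε₁₁ : ℝ := 1 / 2 * (p.γ ω + 2 * ω) * p.Lam * p.r₀ + 2 * ω * p.r₀

def ε₁₂ : ℝ :=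
  (8 + 7 * p.φ₁) * p.γ ω ^ 2 * p.Lam ^ 2 * p.r₀ / p.φ₁ + (1 + 2 * ω ^ 2) * p.r₀

/-- The positive root of `ε₁₀ - t ε₁₁ - t² ε₁₂ = 0`. For `r₀ = 0` (so `ε₁₁ = ε₁₂ = 0`) there is no
root and no constraint; the value `1` makes the entry inactive in the minimum `β₄`. -/
def root : ℝ :=
  if p.r₀ = 0 then 1
  else (Real.sqrt (p.ε₁₁ ω ^ 2 + 4 * p.ε₁₀ * p.ε₁₂ ω) - p.ε₁₁ ω) / (2 * p.ε₁₂ ω)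

def β₄ : ℝ :=
  min (p.ε₁' ω / p.ε₂' ω) (min (p.ε₄ ω / p.ε₅ ω) (min (p.ε₆ ω / p.ε₇ ω) (min (p.root ω) 1)))

def β₆ : ℝ := (16 * (1 + p.β₁) ^ 2 / p.lam + 8 / p.lam ^ 2) * p.Lf ^ 2

/-- The threshold `β₃`; it depends on the parameter `ω` of the algorithm through `β₄`. -/
def β₃ : ℝ :=
  max ((4 + 5 * p.Lf ^ 2) / p.β₅) (max ((12 * p.lam⁻¹ + 1) / 3)
    (max (Real.sqrt p.β₆) (max (p.β₂ / p.β₄ ω) (4 * p.β₂ * p.Lf))))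

end Consts

/-- The constant parameter `ω = β₂ (T + 1)^θ`. -/
def omega (β₂ θ : ℝ) (T : ℕ) : ℝ := β₂ * ((T : ℝ) + 1) ^ θ

end RCPSGD

end

universe u v w

open RCPSGD

noncomputable section

namespace RCPSGD

/-! ### Scalar recursions -/

/-! The argument reduces the algorithm to a pair of scalar recursions whose constants do not depend
on the number of agents, the dimension or the horizon.

Since `η * ω = β₂` and `γ = β₁ * ω`, the consensus part of one step does not see the horizon.
Diagonalising the Laplacian splits it into modes (`exists_isModalBasis`). Take as dual variable `u i
= v i + (1 / ω) • ∇f_i(x̄)`, which should vanish at equilibrium. In a mode with eigenvalue `ℓ ≠ 0`,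
the pair `(x, u)` then follows a fixed linear map, up to the compression error and a perturbation of
order `η`. The perturbation comes from the gradient noise, the disagreement and the drift of
`∇f_i(x̄)`. The quadratic form `modeForm` contracts under this map (`modeForm_step_aux`) with
something to spare, and the spare part pays for the motion of `x` relative to its compressed
reference `xc`. Adding `∑ ‖x i - xc i‖²` gives a Lyapunov function (`lyapunov_step`,
`Setting.lyap_step`).

The average evolves differently. The columns of the Laplacian sum to zero, so neither communication
nor compression enters it (`Setting.avg_succ`), and `x̄` performs inexact stochastic gradient
descent. The noises of different agents are orthogonal, so the averaged noise has variance at most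
`σ² / n`. Together with the Polyak–Łojasiewicz inequality this gives `Setting.gap_step`.

With `A` the expected Lyapunov function per agent and `B` the expected optimality gap,
`CoupledRecursion` says that `A` contracts at a fixed rate with forcing `η² (A + B + 1)` and a
geometric term, while `B` contracts at rate `η ν` with forcing `η A` and `η² / n`. The sum `B + s η
A`, for suitable `s`, contracts at rate `η ν / 2`. Dividing its forcing by this rate leaves `O(η /
n) + O(η²)`, and the leading coefficient contains only `Lf`, `σ` and `ν`. Then `B` is bounded, and
the first recursion gives `A = O(η²)`. Initial data are damped like `exp (-c T^(1-θ))`, which is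
negligible (`exists_coupled_recursion_bound`).

The horizon condition enters through `η < β₄` and `η * Lf ≤ 1`. The first and fourth entries of `β₄`
become inequalities between constants free of `T`, so the contraction rate, and with it `C₂`, can be
fixed before `T`. -/

/-- A perturbed geometric recursion with a constant and a fast decaying forcing term. -/
lemma geometric_recursion_bound {S : ℕ → ℝ} {ρ D K : ℝ} (hρ : 1 / 2 ≤ ρ) (hρ1 : ρ < 1)
    (hD : 0 ≤ D) (hK : 0 ≤ K) (hS : ∀ k, S (k + 1) ≤ ρ * S k + D + K * (1 / 4) ^ k) (k : ℕ) :
    S k ≤ ρ ^ k * (S 0 + 4 * K) + D / (1 - ρ) := by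
  have h1 : 0 < 1 - ρ := by linarith
  -- The difference `ρ ^ k - (1 / 4) ^ k` makes the induction close: the step needs exactly `4 * ρ -
  -- 2 ≥ 0`.
  have key : ∀ k, S k ≤ ρ ^ k * S 0 + 4 * K * (ρ ^ k - (1 / 4) ^ k) + D / (1 - ρ) := by
    intro k
    induction k with
    | zero => simp; positivity
    | succ k ih =>
      have h4 : (0 : ℝ) ≤ K * (1 / 4) ^ k := by positivity
      have hDD : ρ * (D / (1 - ρ)) + D = D / (1 - ρ) := by field_simp; ring
      have h5 := mul_le_mul_of_nonneg_left ih (by linarith : 0 ≤ ρ)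
      have h6 : 0 ≤ (K * (1 / 4) ^ k) * (4 * ρ - 2) := mul_nonneg h4 (by linarith)
      have h7 := hS k
      rw [pow_succ, pow_succ]
      nlinarith
  have h4 : (0 : ℝ) ≤ K * (1 / 4) ^ k := by positivity
  have := key k
  nlinarith

/-- With `y = T^(1-θ)` the claim is that `y^(2θ/(1-θ)) * exp (-c y)` is bounded, which holds because
it tends to zero. -/
lemma exists_exp_neg_rpow_bound {c θ : ℝ} (hc : 0 < c) (hθ : θ ∈ Set.Ioo (0 : ℝ) 1) :
    ∃ C : ℝ, 0 < C ∧ ∀ T : ℕ, 1 ≤ T →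
      Real.exp (-c * (T : ℝ) ^ (1 - θ)) ≤ C / (T : ℝ) ^ (2 * θ) := by
  have h1 : 0 < 1 - θ := by linarith [hθ.2]
  have hlim := (tendsto_rpow_mul_exp_neg_mul_atTop_nhds_zero (2 * θ / (1 - θ)) c hc).comp
    ((tendsto_rpow_atTop h1).comp tendsto_natCast_atTop_atTop)
  obtain ⟨C, hC⟩ := hlim.bddAbove_range
  refine ⟨max C 1, by positivity, fun T hT => ?_⟩
  have hT0 : (0 : ℝ) < T := by exact_mod_cast hT
  have := hC ⟨T, rfl⟩
  simp only [Function.comp_apply] at this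
  rw [← Real.rpow_mul hT0.le, mul_div_cancel₀ _ h1.ne'] at this
  rw [le_div_iff₀ (Real.rpow_pos_of_pos hT0 _), mul_comm]
  exact this.trans (le_max_left _ _)

lemma pow_le_exp_neg_rpow {x c θ : ℝ} {T : ℕ} (hx1 : x ≤ 1)
    (h : c * (T : ℝ) ^ (1 - θ) ≤ x * T) : (1 - x) ^ T ≤ Real.exp (-c * (T : ℝ) ^ (1 - θ)) := by
  calc (1 - x) ^ T ≤ (Real.exp (-x)) ^ T := by
        gcongr
        have := Real.add_one_le_exp (-x); linarith
    _ = Real.exp (-(x * T)) := by rw [← Real.exp_nat_mul]; ring_nf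
    _ ≤ _ := Real.exp_le_exp.mpr (by linarith)

/-- The total contraction over the horizon is governed by `η * T`, of order `T^(1-θ)`. The factor `1
/ 2` pays for `T + 1 ≤ 2 * T`. -/
lemma half_rpow_le_mul_rpow_neg {θ : ℝ} (hθ : θ ∈ Set.Ioo (0 : ℝ) 1) {T : ℕ} (hT : 1 ≤ T) :
    (1 / 2) * (T : ℝ) ^ (1 - θ) ≤ ((T : ℝ) + 1) ^ (-θ) * T := by
  have hT0 : (1 : ℝ) ≤ T := by exact_mod_cast hT
  have h1 : (T : ℝ) ^ (1 - θ) ≤ ((T : ℝ) + 1) ^ (1 - θ) :=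
    Real.rpow_le_rpow (by linarith) (by linarith) (by linarith [hθ.2])
  have h2 : ((T : ℝ) + 1) ^ (1 - θ) = ((T : ℝ) + 1) ^ (-θ) * (T + 1) := by
    rw [sub_eq_neg_add, Real.rpow_add (by linarith), Real.rpow_one]
  have h3 : 0 < ((T : ℝ) + 1) ^ (-θ) := Real.rpow_pos_of_pos (by linarith) _
  nlinarith

lemma rpow_neg_le_one_div {θ : ℝ} (hθ : 0 < θ) {T : ℕ} (hT : 1 ≤ T) :
    ((T : ℝ) + 1) ^ (-θ) ≤ 1 / (T : ℝ) ^ θ := by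
  have hT0 : (1 : ℝ) ≤ T := by exact_mod_cast hT
  rw [Real.rpow_neg (by linarith), ← one_div]
  exact one_div_le_one_div_of_le (Real.rpow_pos_of_pos (by linarith) _)
    (Real.rpow_le_rpow (by linarith) (by linarith) hθ.le)

/-- The coupled recursion satisfied by the consensus Lyapunov function `A` and the optimality
gap `B`, for the step size `η = (T + 1)^(-θ)`. -/
structure CoupledRecursion (κ ν c₁ c₂ c₃ c₄ h₀ η N : ℝ) (A B : ℕ → ℝ) : Prop where
  A_nonneg : ∀ k, 0 ≤ A k
  B_nonneg : ∀ k, 0 ≤ B k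
  A_step : ∀ k, A (k + 1) ≤ (1 - κ) * A k + c₁ * η ^ 2 * (A k + B k + 1) + c₂ * (h₀ ^ k) ^ 2
  B_step : ∀ k, B (k + 1) ≤ (1 - η * ν) * B k + c₃ * η * A k + c₄ * η ^ 2 / N

lemma sq_pow_le_quarter_pow {h₀ : ℝ} (h : h₀ ∈ Set.Ioo (0 : ℝ) (1 / 2)) (k : ℕ) :
    (h₀ ^ k) ^ 2 ≤ (1 / 4 : ℝ) ^ k := by
  rw [← pow_mul, mul_comm, pow_mul]
  have := h.1
  have := h.2
  gcongr
  nlinarith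

/-- Serves the finitely many short horizons for which `η` is too large for the weighted sum to
contract. The summand `1` absorbs all forcing terms. -/
lemma CoupledRecursion.crude_bound {κ ν c₁ c₂ c₃ c₄ h₀ η N : ℝ} {A B : ℕ → ℝ}
    (H : CoupledRecursion κ ν c₁ c₂ c₃ c₄ h₀ η N A B) (hκ : 0 < κ) (hν : 0 < ν)
    (h1 : 0 ≤ c₁) (h2 : 0 ≤ c₂) (h3 : 0 ≤ c₃) (h4 : 0 ≤ c₄) (hh : h₀ ∈ Set.Ioo (0 : ℝ) (1 / 2))
    (hη : 0 < η) (hη1 : η ≤ 1) (hN : 1 ≤ N) (k : ℕ) :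
    A k + B k + 1 ≤ (1 + c₁ + c₂ + c₃ + c₄) ^ k * (A 0 + B 0 + 1) := by
  induction k with
  | zero => simp
  | succ k ih =>
    have hA := H.A_step k
    have hB := H.B_step k
    have hA0 := H.A_nonneg k
    have hB0 := H.B_nonneg k
    have e1 : η ^ 2 ≤ 1 := by nlinarith
    have e2 : (h₀ ^ k) ^ 2 ≤ 1 :=
      (sq_pow_le_quarter_pow hh k).trans (pow_le_one₀ (by norm_num) (by norm_num))
    have t1 : c₁ * η ^ 2 * (A k + B k + 1) ≤ c₁ * (A k + B k + 1) := by
      have : c₁ * η ^ 2 ≤ c₁ := by nlinarith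
      nlinarith
    have t2 : c₂ * (h₀ ^ k) ^ 2 ≤ c₂ * (A k + B k + 1) := by
      have : (h₀ ^ k) ^ 2 ≤ A k + B k + 1 := by linarith
      gcongr
    have t3 : c₃ * η * A k ≤ c₃ * (A k + B k + 1) := by
      have : c₃ * η ≤ c₃ := by nlinarith
      have := mul_le_mul_of_nonneg_right this hA0
      nlinarith
    have t4 : c₄ * η ^ 2 / N ≤ c₄ * (A k + B k + 1) := by
      rw [div_le_iff₀ (by linarith)]
      have q : η ^ 2 ≤ (A k + B k + 1) * N := by nlinarith
      have := mul_le_mul_of_nonneg_left q h4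
      linarith
    have t5 : 0 ≤ η * ν * B k := by positivity
    have t6 : 0 ≤ κ * A k := by positivity
    have := mul_le_mul_of_nonneg_left ih (by positivity : 0 ≤ 1 + c₁ + c₂ + c₃ + c₄)
    rw [pow_succ']
    nlinarith

/-- The weight is chosen so that `c₃ η A` is a quarter of the decay `κ s η A`. Another quarter
absorbs the feedback of `A` into itself, and the remaining half leaves the rate `η ν / 2` for the
`A` part. The feedback of `B` through `A` has order `η³` and costs at most half of the decay `η ν
B`. -/
lemma CoupledRecursion.weighted_step {κ ν c₁ c₂ c₃ c₄ h₀ η N : ℝ} {A B : ℕ → ℝ}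
    (H : CoupledRecursion κ ν c₁ c₂ c₃ c₄ h₀ η N A B) (hκ : 0 < κ)
    (h2 : 0 ≤ c₂) (h3 : 0 ≤ c₃) (hh : h₀ ∈ Set.Ioo (0 : ℝ) (1 / 2))
    (hη : 0 < η) (hη1 : η ≤ 1) (hc : c₁ * η ^ 2 ≤ κ / 4) (hs : 4 * c₃ / κ * c₁ * η ^ 2 ≤ ν / 2)
    (hνκ : η * ν ≤ κ) (k : ℕ) :
    B (k + 1) + 4 * c₃ / κ * η * A (k + 1) ≤
      (1 - η * ν / 2) * (B k + 4 * c₃ / κ * η * A k)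
        + (c₄ * η ^ 2 / N + 4 * c₃ / κ * c₁ * η ^ 3) + 4 * c₃ / κ * c₂ * (1 / 4) ^ k := by
  set s := 4 * c₃ / κ with hs'
  have hs0 : 0 ≤ s := by positivity
  have hsκ : c₃ = s * κ / 4 := by rw [hs']; field_simp
  have hA := mul_le_mul_of_nonneg_left (H.A_step k) (by positivity : 0 ≤ s * η)
  have hB := H.B_step k
  have hA0 := H.A_nonneg k
  have hB0 := H.B_nonneg k
  have e2 := sq_pow_le_quarter_pow hh k
  have e3 : s * η * (c₂ * (h₀ ^ k) ^ 2) ≤ s * c₂ * (1 / 4) ^ k := by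
    have : s * η * (c₂ * (h₀ ^ k) ^ 2) ≤ s * 1 * (c₂ * (1 / 4) ^ k) := by gcongr
    linarith
  have e4 : s * c₁ * η ^ 2 * (η * B k) ≤ ν / 2 * (η * B k) := by gcongr
  have hsA : 0 ≤ s * η * A k := by positivity
  have e5 : c₁ * η ^ 2 * (s * η * A k) ≤ κ / 4 * (s * η * A k) := by gcongr
  have e6 : η * ν * (s * η * A k) ≤ κ * (s * η * A k) := by gcongr
  rw [hsκ] at hB
  nlinarith

-- The weighted sum first bounds `B` at every step. Inserting that bound decouples the recursion for
-- `A`. Only `c₄` reaches the `η / N` term of `B`; the constants `c₁`, `c₂`, `c₃` affect `C` alone.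
set_option maxHeartbeats 1000000 in
theorem exists_coupled_recursion_bound {κ ν θ c₁ c₂ c₃ c₄ h₀ M : ℝ} (hκ : 0 < κ) (hκ1 : κ ≤ 1)
    (hν : 0 < ν) (hθ : θ ∈ Set.Ioo (0 : ℝ) 1) (h1 : 0 ≤ c₁) (h2 : 0 ≤ c₂) (h3 : 0 ≤ c₃)
    (h4 : 0 ≤ c₄) (hh : h₀ ∈ Set.Ioo (0 : ℝ) (1 / 2)) (hM : 0 ≤ M) :
    ∃ C : ℝ, 0 < C ∧ ∀ (T : ℕ) (N : ℝ) (A B : ℕ → ℝ), 1 ≤ T → 1 ≤ N →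
      CoupledRecursion κ ν c₁ c₂ c₃ c₄ h₀ (((T : ℝ) + 1) ^ (-θ)) N A B → A 0 ≤ M → B 0 ≤ M →
      A T ≤ C / (T : ℝ) ^ (2 * θ) ∧
      B T ≤ (2 * c₄ / ν) / (N * (T : ℝ) ^ θ) + C / (T : ℝ) ^ (2 * θ) := by
  -- The rates are those reached after `T` steps: `η ν / 2 * T ≥ ν / 4 * T^(1-θ)` for the weighted
  -- sum and `κ / 2 * T ≥ κ / 2 * T^(1-θ)` for `A`.
  obtain ⟨E₁, hE₁, hE₁'⟩ := exists_exp_neg_rpow_bound (c := ν / 4) (by positivity) hθ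
  obtain ⟨E₂, hE₂, hE₂'⟩ := exists_exp_neg_rpow_bound (c := κ / 2) (by positivity) hθ
  have hηlim : Filter.Tendsto (fun T : ℕ => ((T : ℝ) + 1) ^ (-θ)) Filter.atTop (nhds 0) :=
    (tendsto_rpow_neg_atTop hθ.1).comp
      (Filter.tendsto_atTop_add_const_right _ _ tendsto_natCast_atTop_atTop)
  set s := 4 * c₃ / κ with hs
  have hs0 : 0 ≤ s := by positivity
  have ev : ∀ {a b : ℝ} (j : ℕ), j ≠ 0 → 0 < b →
      ∀ᶠ T : ℕ in Filter.atTop, a * (((T : ℝ) + 1) ^ (-θ)) ^ j ≤ b := by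
    intro a b j hj hb
    have : Filter.Tendsto (fun T : ℕ => a * (((T : ℝ) + 1) ^ (-θ)) ^ j) Filter.atTop (nhds 0) := by
      simpa [hj] using (hηlim.pow j).const_mul a
    exact (this.eventually_lt_const hb).mono fun _ h => h.le
  -- `T₀` depends only on the constants, so the crude growth `Q ^ T₀` before it may be put into `C`.
  obtain ⟨T₀, hT₀⟩ := Filter.eventually_atTop.mp
    (((ev (a := c₁) 2 two_ne_zero (by positivity : 0 < κ / 4)).and
      (ev (a := s * c₁) 2 two_ne_zero (by positivity : 0 < ν / 2))).and
      (ev (a := ν) 1 one_ne_zero hκ))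
  set F : ℝ := 2 * (c₄ + s * c₁) / ν with hF
  have hF0 : 0 ≤ F := by positivity
  set S₀ : ℝ := M + s * M + 4 * (s * c₂) with hS₀
  have hS₀0 : 0 ≤ S₀ := by positivity
  set Q : ℝ := 1 + c₁ + c₂ + c₃ + c₄ with hQ
  set Ca : ℝ := (M + 4 * c₂) * E₂ + 2 * (c₁ * (S₀ + F + 1)) / κ
  set Cb : ℝ := S₀ * E₁ + 2 * (s * c₁) / ν
  set Cc : ℝ := Q ^ T₀ * (M + M + 1) * (T₀ : ℝ) ^ (2 * θ)
  have hCa : 0 ≤ Ca := by positivity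
  have hCb : 0 ≤ Cb := by positivity
  have hCc : 0 ≤ Cc := by positivity
  refine ⟨Ca + Cb + Cc + 1, by positivity, fun T N A B hT hN H hA0 hB0 => ?_⟩
  have hT1 : (1 : ℝ) ≤ T := by exact_mod_cast hT
  have hTp : 0 < (T : ℝ) ^ (2 * θ) := Real.rpow_pos_of_pos (by linarith) _
  have hTp1 : 0 < (T : ℝ) ^ θ := Real.rpow_pos_of_pos (by linarith) _
  have hNT : 0 ≤ (2 * c₄ / ν) / (N * (T : ℝ) ^ θ) := by positivity
  set η := ((T : ℝ) + 1) ^ (-θ) with hη_def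
  have hη : 0 < η := Real.rpow_pos_of_pos (by linarith) _
  have hη1 : η ≤ 1 := Real.rpow_le_one_of_one_le_of_nonpos (by linarith) (by linarith [hθ.1])
  have hηT : η ≤ 1 / (T : ℝ) ^ θ := rpow_neg_le_one_div hθ.1 hT
  have hηT2 : η ^ 2 ≤ 1 / (T : ℝ) ^ (2 * θ) := by
    have : (T : ℝ) ^ (2 * θ) = ((T : ℝ) ^ θ) ^ 2 := by
      rw [mul_comm, Real.rpow_mul (by linarith)]; norm_cast
    rw [this, ← one_div_pow]
    gcongr
  rcases lt_or_ge T T₀ with hlt | hge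
  · have hc := H.crude_bound hκ hν h1 h2 h3 h4 hh hη hη1 hN T
    have hb : A T + B T + 1 ≤ Q ^ T₀ * (M + M + 1) := by
      refine hc.trans ?_
      have hA00 := H.A_nonneg 0
      have hB00 := H.B_nonneg 0
      have : (1 : ℝ) ≤ Q := by rw [hQ]; linarith
      gcongr
    have hb' : Q ^ T₀ * (M + M + 1) ≤ (Ca + Cb + Cc + 1) / (T : ℝ) ^ (2 * θ) := by
      rw [le_div_iff₀ hTp]
      have : Q ^ T₀ * (M + M + 1) * (T : ℝ) ^ (2 * θ) ≤ Cc := by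
        have : (T : ℝ) ≤ T₀ := by exact_mod_cast hlt.le
        have := hθ.1
        simp only [Cc]
        gcongr
      linarith
    have := H.A_nonneg T
    have := H.B_nonneg T
    constructor <;> linarith
  · obtain ⟨⟨g1, g2⟩, g3⟩ := hT₀ T hge
    rw [pow_one, mul_comm] at g3
    have hην1 : η * ν ≤ 1 := g3.trans hκ1
    have hηpos : 0 < η * ν := by positivity
    have hSb := geometric_recursion_bound (S := fun k => B k + s * η * A k)
      (ρ := 1 - η * ν / 2) (D := c₄ * η ^ 2 / N + s * c₁ * η ^ 3) (K := s * c₂)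
      (by linarith) (by linarith) (by positivity) (by positivity)
      (H.weighted_step hκ h2 h3 hh hη hη1 g1 g2 g3)
    have hS00 : B 0 + s * η * A 0 + 4 * (s * c₂) ≤ S₀ := by
      have : s * η * A 0 ≤ s * 1 * M := by
        have := H.A_nonneg 0
        gcongr
      linarith
    -- Division by the rate `η ν / 2` lowers each power of `η` by one; this is where the leading
    -- constant `2 * c₄ / ν` arises.
    have hfrac : (c₄ * η ^ 2 / N + s * c₁ * η ^ 3) / (1 - (1 - η * ν / 2))
        = (2 * c₄ / ν) * η / N + 2 * (s * c₁) / ν * η ^ 2 := by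
      have : N ≠ 0 := by linarith
      field_simp
      ring
    have hρ0 : 0 ≤ 1 - η * ν / 2 := by linarith
    have hBk : ∀ k, B k ≤ (1 - η * ν / 2) ^ k * S₀
        + ((2 * c₄ / ν) * η / N + 2 * (s * c₁) / ν * η ^ 2) := by
      intro k
      have h := hSb k
      simp only [hfrac] at h
      have hA := H.A_nonneg k
      have : 0 ≤ s * η * A k := by positivity
      have := mul_le_mul_of_nonneg_left hS00 (pow_nonneg hρ0 k)
      linarith
    have hBc : ∀ k, B k ≤ S₀ + F := by
      intro k
      refine (hBk k).trans ?_
      have i1 : (1 - η * ν / 2) ^ k * S₀ ≤ 1 * S₀ := by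
        have : (1 - η * ν / 2) ^ k ≤ 1 := pow_le_one₀ hρ0 (by linarith)
        gcongr
      have i2 : (2 * c₄ / ν) * η / N ≤ 2 * c₄ / ν := by
        rw [div_le_iff₀ (by linarith)]
        have : 0 ≤ 2 * c₄ / ν := by positivity
        gcongr
        linarith
      have i3 : 2 * (s * c₁) / ν * η ^ 2 ≤ 2 * (s * c₁) / ν * 1 ^ 2 := by gcongr
      have i4 : F = 2 * c₄ / ν + 2 * (s * c₁) / ν := by rw [hF]; ring
      linarith
    constructor
    -- With `B` bounded by `S₀ + F`, the forcing of `A` is a constant times `η²`, and its rate stays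
    -- fixed.
    · have hAk := geometric_recursion_bound (S := A) (ρ := 1 - κ / 2)
        (D := c₁ * η ^ 2 * (S₀ + F + 1)) (K := c₂) (by linarith) (by linarith) (by positivity) h2
        (by
          intro k
          have hA := H.A_nonneg k
          have hs := H.A_step k
          have j1 : c₁ * η ^ 2 * A k ≤ κ / 4 * A k := by gcongr
          have j2 : c₁ * η ^ 2 * B k ≤ c₁ * η ^ 2 * (S₀ + F) := by
            have := hBc k
            gcongr
          have j3 : c₂ * (h₀ ^ k) ^ 2 ≤ c₂ * (1 / 4) ^ k := by
            have := sq_pow_le_quarter_pow hh k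
            gcongr
          have j4 : 0 ≤ κ * A k := by positivity
          nlinarith) T
      have k1 : (1 - κ / 2) ^ T ≤ E₂ / (T : ℝ) ^ (2 * θ) := by
        refine (pow_le_exp_neg_rpow (by linarith) ?_).trans (hE₂' T hT)
        have : (T : ℝ) ^ (1 - θ) ≤ T := by
          nth_rewrite 2 [← Real.rpow_one (T : ℝ)]
          exact Real.rpow_le_rpow_of_exponent_le hT1 (by linarith [hθ.1])
        gcongr
      have k2 : (1 - κ / 2) ^ T * (A 0 + 4 * c₂) ≤ E₂ / (T : ℝ) ^ (2 * θ) * (M + 4 * c₂) := by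
        have := H.A_nonneg 0
        gcongr
      have k3 : c₁ * η ^ 2 * (S₀ + F + 1) / (1 - (1 - κ / 2))
          ≤ 2 * (c₁ * (S₀ + F + 1)) / κ * (1 / (T : ℝ) ^ (2 * θ)) := by
        have : c₁ * η ^ 2 * (S₀ + F + 1) / (1 - (1 - κ / 2))
          = 2 * (c₁ * (S₀ + F + 1)) / κ * η ^ 2 := by
          rw [show 1 - (1 - κ / 2) = κ / 2 by ring]
          field_simp
        rw [this]
        gcongr
      have : Ca / (T : ℝ) ^ (2 * θ) ≤ (Ca + Cb + Cc + 1) / (T : ℝ) ^ (2 * θ) := by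
        gcongr; linarith
      refine le_trans ?_ this
      calc A T ≤ E₂ / (T : ℝ) ^ (2 * θ) * (M + 4 * c₂)
            + 2 * (c₁ * (S₀ + F + 1)) / κ * (1 / (T : ℝ) ^ (2 * θ)) := by linarith
        _ = _ := by simp only [Ca]; ring
    · have k1 : (1 - η * ν / 2) ^ T ≤ E₁ / (T : ℝ) ^ (2 * θ) := by
        refine (pow_le_exp_neg_rpow (by linarith) ?_).trans (hE₁' T hT)
        have := half_rpow_le_mul_rpow_neg hθ hT
        nlinarith
      have k2 : (1 - η * ν / 2) ^ T * S₀ ≤ E₁ / (T : ℝ) ^ (2 * θ) * S₀ := by gcongr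
      have k3 : (2 * c₄ / ν) * η / N ≤ (2 * c₄ / ν) * (1 / (T : ℝ) ^ θ) / N := by gcongr
      have k4 : 2 * (s * c₁) / ν * η ^ 2 ≤ 2 * (s * c₁) / ν * (1 / (T : ℝ) ^ (2 * θ)) := by gcongr
      have : Cb / (T : ℝ) ^ (2 * θ) ≤ (Ca + Cb + Cc + 1) / (T : ℝ) ^ (2 * θ) := by
        gcongr; linarith
      have k5 : (2 * c₄ / ν) * (1 / (T : ℝ) ^ θ) / N = (2 * c₄ / ν) / (N * (T : ℝ) ^ θ) := by
        field_simp
      have k6 : Cb / (T : ℝ) ^ (2 * θ) = E₁ / (T : ℝ) ^ (2 * θ) * S₀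
          + 2 * (s * c₁) / ν * (1 / (T : ℝ) ^ (2 * θ)) := by simp only [Cb]; ring
      have := hBk T
      linarith

/-! ### The quadratic form attached to one eigenvalue of the Laplacian -/

section ModeForm

variable {V : Type*} [NormedAddCommGroup V] [InnerProductSpace ℝ V]

/-- The quadratic form `½‖x‖² + ½(1+B)ℓ⁻¹‖u‖² + ℓ⁻¹⟪x, u⟫`. -/
def modeForm (B ℓ : ℝ) (x u : V) : ℝ :=
  ‖x‖ ^ 2 / 2 + (1 + B) / 2 * ℓ⁻¹ * ‖u‖ ^ 2 + ℓ⁻¹ * inner ℝ x u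

lemma modeForm_smul_right {B ℓ : ℝ} (hℓ : ℓ ≠ 0) (x w : V) :
    modeForm B ℓ x (ℓ • w) = ‖x‖ ^ 2 / 2 + (1 + B) / 2 * ℓ * ‖w‖ ^ 2 + inner ℝ x w := by
  rw [modeForm, norm_smul, mul_pow, inner_smul_right, Real.norm_eq_abs, sq_abs]
  field_simp

/-- With `u = ℓ • w`, expanding `‖x / 2 + w‖² ≥ 0` bounds the cross term below by `-‖x‖² / 4 -
‖w‖²`. The coefficient `(1 + B) ℓ / 2` of `‖w‖²` is at least `1`. -/
lemma quarter_norm_sq_le_modeForm {B ℓ : ℝ} (hℓ : 0 < ℓ) (hBℓ : 2 ≤ B * ℓ) (x u : V) :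
    ‖x‖ ^ 2 / 4 ≤ modeForm B ℓ x u := by
  obtain ⟨w, rfl⟩ : ∃ w, u = ℓ • w := ⟨ℓ⁻¹ • u, by rw [smul_inv_smul₀ hℓ.ne']⟩
  rw [modeForm_smul_right hℓ.ne']
  have h1 : 0 ≤ ‖(1 / 2 : ℝ) • x + w‖ ^ 2 := by positivity
  rw [norm_add_sq_real, norm_smul, real_inner_smul_left] at h1
  norm_num at h1
  have h2 : 0 ≤ (B * ℓ - 2 + ℓ) * ‖w‖ ^ 2 := by
    have : 0 ≤ B * ℓ - 2 + ℓ := by linarith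
    positivity
  nlinarith

lemma modeForm_nonneg {B ℓ : ℝ} (hℓ : 0 < ℓ) (hBℓ : 2 ≤ B * ℓ) (x u : V) :
    0 ≤ modeForm B ℓ x u :=
  le_trans (by positivity) (quarter_norm_sq_le_modeForm hℓ hBℓ x u)

lemma modeForm_le {B ℓ lam : ℝ} (hlam : 0 < lam) (hℓ : lam ≤ ℓ) (x u : V) :
    modeForm B ℓ x u ≤ ‖x‖ ^ 2 + ((1 + B) / 2 + 1 / lam) * (ℓ⁻¹ * ‖u‖ ^ 2) := by
  have hℓ0 : 0 < ℓ := by linarith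
  obtain ⟨w, rfl⟩ : ∃ w, u = ℓ • w := ⟨ℓ⁻¹ • u, by rw [smul_inv_smul₀ hℓ0.ne']⟩
  rw [modeForm_smul_right hℓ0.ne', norm_smul, mul_pow, Real.norm_eq_abs, sq_abs]
  have e : ℓ⁻¹ * (ℓ ^ 2 * ‖w‖ ^ 2) = ℓ * ‖w‖ ^ 2 := by field_simp
  rw [e]
  have h1 : 0 ≤ ‖x - w‖ ^ 2 := by positivity
  rw [norm_sub_sq_real] at h1
  have h2 : ‖w‖ ^ 2 ≤ 1 / lam * (ℓ * ‖w‖ ^ 2) := by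
    have : 1 ≤ 1 / lam * ℓ := by rw [one_div, inv_mul_eq_div, le_div_iff₀ hlam]; linarith
    nlinarith [sq_nonneg ‖w‖]
  nlinarith [sq_nonneg ‖w‖]

/-- Young's inequality for a nonnegative quadratic form: the defect is `1 / t` times the form at `(t
• x - y, t • u - w)`. -/
lemma modeForm_add_le {B ℓ t : ℝ} (hℓ : 0 < ℓ) (hBℓ : 2 ≤ B * ℓ) (ht : 0 < t) (x u y w : V) :
    modeForm B ℓ (x + y) (u + w)
      ≤ (1 + t) * modeForm B ℓ x u + (1 + 1 / t) * modeForm B ℓ y w := by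
  have h := modeForm_nonneg hℓ hBℓ (t • x - y) (t • u - w)
  have e : (1 + t) * modeForm B ℓ x u + (1 + 1 / t) * modeForm B ℓ y w
      - modeForm B ℓ (x + y) (u + w) = 1 / t * modeForm B ℓ (t • x - y) (t • u - w) := by
    simp only [modeForm, norm_add_sq_real, norm_sub_sq_real, norm_smul, inner_add_left,
      inner_add_right, inner_sub_left, inner_sub_right, real_inner_smul_left,
      real_inner_smul_right, mul_pow, Real.norm_eq_abs, sq_abs]
    rw [real_inner_comm u y]
    field_simp
    ring
  have : 0 ≤ 1 / t * modeForm B ℓ (t • x - y) (t • u - w) := by positivity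
  linarith

lemma norm_add_three_sq_le (a b c : V) :
    ‖a + b + c‖ ^ 2 ≤ 3 * (‖a‖ ^ 2 + ‖b‖ ^ 2 + ‖c‖ ^ 2) := by
  have h1 : 0 ≤ ‖a - b‖ ^ 2 := by positivity
  have h2 : 0 ≤ ‖a - c‖ ^ 2 := by positivity
  have h3 : 0 ≤ ‖b - c‖ ^ 2 := by positivity
  simp only [norm_add_sq_real, norm_sub_sq_real, inner_add_left] at *
  linarith

lemma norm_add_sq_le_young {s : ℝ} (hs : 0 < s) (a b : V) :
    ‖a + b‖ ^ 2 ≤ (1 + s) * ‖a‖ ^ 2 + (1 + 1 / s) * ‖b‖ ^ 2 := by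
  have h1 : 0 ≤ ‖s • a - b‖ ^ 2 := by positivity
  simp only [norm_add_sq_real, norm_sub_sq_real, norm_smul, real_inner_smul_left, mul_pow,
    Real.norm_eq_abs, sq_abs] at *
  have h2 : 0 ≤ 1 / s * (s ^ 2 * ‖a‖ ^ 2 - 2 * (s * inner ℝ a b) + ‖b‖ ^ 2) := by positivity
  have h3 : 1 / s * (s ^ 2 * ‖a‖ ^ 2 - 2 * (s * inner ℝ a b) + ‖b‖ ^ 2)
      = s * ‖a‖ ^ 2 - 2 * inner ℝ a b + 1 / s * ‖b‖ ^ 2 := by field_simp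
  linarith

/-- The weight of the compression error in the one-step estimate. -/
def errWeight (b B Lam φ₁ : ℝ) : ℝ :=
  b * ((B / 2 + 1) * Lam + 1) + b ^ 2 * ((11 / 2 + 8 / φ₁) * B ^ 2 * Lam ^ 2 + 2)

/-- One step of the unperturbed dynamics, in the variables `x` and `w = ℓ⁻¹ u`. -/
lemma modeForm_step_aux {b B ℓ lam Lam φ₁ : ℝ} (hb : 0 < b) (hB : 1 ≤ B) (hlam : 0 < lam)
    (hℓ : lam ≤ ℓ) (hℓ' : ℓ ≤ Lam) (hφ : 0 < φ₁)
    (hcond : b * ((7 + 8 / φ₁) * B ^ 2 * Lam ^ 2 + 2) ≤ B * lam / 2 - 9 / 4) (x w δ : V) :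
    modeForm B ℓ (x - b • (B • ℓ • (x + δ) + ℓ • w)) (ℓ • (w + b • (x + δ)))
        + 4 / 3 * (1 + 2 / φ₁) * (b ^ 2 * ‖B • ℓ • (x + δ) + ℓ • w‖ ^ 2)
      ≤ modeForm B ℓ x (ℓ • w) - b * ‖x‖ ^ 2 - b / 4 * (ℓ * ‖w‖ ^ 2)
        + errWeight b B Lam φ₁ * ‖δ‖ ^ 2 := by
  have hℓ0 : 0 < ℓ := by linarith
  have hLam : 0 < Lam := by linarith
  set f := 8 / φ₁ with hf
  have hf0 : 0 < f := by positivity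
  have hf2 : 2 / φ₁ = f / 4 := by rw [hf]; ring
  have hp : B • ℓ • (x + δ) + ℓ • w = ℓ • (B • x + B • δ + w) := by
    rw [smul_add, smul_add, smul_add, smul_add, smul_comm B ℓ, smul_comm B ℓ]
  rw [modeForm_smul_right hℓ0.ne', modeForm_smul_right hℓ0.ne', hf2, hp]
  have h3 := norm_add_three_sq_le (B • x) (B • δ) w
  set p := B • x + B • δ + w with hp'
  have hpx : inner ℝ x p = B * ‖x‖ ^ 2 + B * inner ℝ x δ + inner ℝ x w := by
    rw [hp', inner_add_right, inner_add_right, real_inner_smul_right, real_inner_smul_right,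
      real_inner_self_eq_norm_sq]
  have hpδ : inner ℝ p δ = B * inner ℝ x δ + B * ‖δ‖ ^ 2 + inner ℝ w δ := by
    rw [hp', inner_add_left, inner_add_left, real_inner_smul_left, real_inner_smul_left,
      real_inner_self_eq_norm_sq]
  have hpw : inner ℝ p w = B * inner ℝ x w + B * inner ℝ w δ + ‖w‖ ^ 2 := by
    rw [hp', inner_add_left, inner_add_left, real_inner_smul_left, real_inner_smul_left,
      real_inner_self_eq_norm_sq, real_inner_comm δ w]
  have hpx' : inner ℝ p x = inner ℝ x p := real_inner_comm _ _
  simp only [norm_smul, mul_pow, Real.norm_eq_abs, sq_abs] at h3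
  have exp1 : ‖x - b • ℓ • p‖ ^ 2 = ‖x‖ ^ 2 - 2 * b * ℓ * inner ℝ x p
      + b ^ 2 * ℓ ^ 2 * ‖p‖ ^ 2 := by
    rw [norm_sub_sq_real, real_inner_smul_right, real_inner_smul_right, norm_smul, norm_smul,
      mul_pow, mul_pow, Real.norm_eq_abs, Real.norm_eq_abs, sq_abs, sq_abs]
    ring
  have exp2 : ‖w + b • (x + δ)‖ ^ 2 = ‖w‖ ^ 2 + 2 * b * (inner ℝ x w + inner ℝ w δ)
      + b ^ 2 * (‖x‖ ^ 2 + 2 * inner ℝ x δ + ‖δ‖ ^ 2) := by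
    rw [norm_add_sq_real, real_inner_smul_right, inner_add_right, norm_smul, mul_pow,
      Real.norm_eq_abs, sq_abs, norm_add_sq_real, real_inner_comm x w]
    ring
  have exp3 : inner ℝ (x - b • ℓ • p) (w + b • (x + δ)) = inner ℝ x w
      + b * (‖x‖ ^ 2 + inner ℝ x δ) - b * ℓ * inner ℝ p w
      - b ^ 2 * ℓ * (inner ℝ x p + inner ℝ p δ) := by
    rw [inner_sub_left, inner_add_right, inner_add_right, real_inner_smul_left,
      real_inner_smul_left, real_inner_smul_left, real_inner_smul_left, real_inner_smul_right,
      real_inner_smul_right, inner_add_right, inner_add_right, real_inner_self_eq_norm_sq, hpx']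
    ring
  have exp4 : ‖ℓ • p‖ ^ 2 = ℓ ^ 2 * ‖p‖ ^ 2 := by
    rw [norm_smul, mul_pow, Real.norm_eq_abs, sq_abs]
  rw [exp1, exp2, exp3, exp4, hpx, hpδ, hpw]
  -- To first order in `b` the terms in `⟪x, w⟫` cancel; this dictates the coefficient `(1 + B) / 2`
  -- in the form. What remains is decay in `‖x‖²` and `ℓ ‖w‖²` plus cross terms with `δ`, absorbed
  -- by the squares `s1`, `s2`, `s3`. The squares `s4`, `s5` and `s1` once more handle the cross
  -- terms of order `b²`.
  have s1 : 0 ≤ ‖x + δ‖ ^ 2 := by positivity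
  have s2 : 0 ≤ ‖(1 / 2 : ℝ) • w - δ‖ ^ 2 := by positivity
  have s3 : 0 ≤ ‖(1 / 2 : ℝ) • x - δ‖ ^ 2 := by positivity
  have s4 : 0 ≤ ‖(ℓ / 2) • w + (x + δ)‖ ^ 2 := by positivity
  have s5 : 0 ≤ ‖x - δ‖ ^ 2 := by positivity
  simp only [norm_add_sq_real, norm_sub_sq_real, norm_smul, real_inner_smul_left, inner_add_right,
    mul_pow, Real.norm_eq_abs, sq_abs, real_inner_comm x w] at s1 s2 s3 s4 s5
  norm_num at s2 s3
  set X := ‖x‖ ^ 2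
  set W := ‖w‖ ^ 2
  set Y := ‖δ‖ ^ 2
  set N := ‖p‖ ^ 2
  set xd := inner ℝ x δ
  set xw := inner ℝ x w
  set wd := inner ℝ w δ
  have hX : 0 ≤ X := by positivity
  have hW : 0 ≤ W := by positivity
  have hY : 0 ≤ Y := by positivity
  have hBL : B ^ 2 * ℓ ^ 2 ≤ B ^ 2 * Lam ^ 2 := by gcongr
  -- `hcond` already controls the `w` part: its right side is at most `B * Lam / 2`, and a factor `B
  -- * Lam` cancels.
  have k0 : b * ((7 + f) * B * Lam) ≤ 1 / 2 := by
    have : b * ((7 + f) * B * Lam) * (B * Lam) ≤ 1 / 2 * (B * Lam) := by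
      have : B * lam ≤ B * Lam := by gcongr; linarith
      linarith
    exact le_of_mul_le_mul_right this (by positivity)
  have k1 : b * (7 + f) * ℓ ≤ 1 / 2 := by
    have : b * (7 + f) * ℓ ≤ b * ((7 + f) * B * Lam) := by
      have : 1 * ℓ ≤ B * Lam := by gcongr
      have : b * (7 + f) * (1 * ℓ) ≤ b * (7 + f) * (B * Lam) := by gcongr
      linarith
    linarith
  have cW : b * (1 / 2 - b * (7 + f) * ℓ) * (ℓ * W) ≥ 0 := by
    have : 0 ≤ 1 / 2 - b * (7 + f) * ℓ := by linarith
    positivity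
  have cX : b * (B * ℓ / 2 - 9 / 4 - b * ((7 + f) * (B ^ 2 * ℓ ^ 2) + 2)) * X ≥ 0 := by
    have h : b * ((7 + f) * (B ^ 2 * ℓ ^ 2) + 2) ≤ b * ((7 + f) * (B ^ 2 * Lam ^ 2) + 2) := by
      gcongr
    have h' : B * lam ≤ B * ℓ := by gcongr
    have : 0 ≤ B * ℓ / 2 - 9 / 4 - b * ((7 + f) * (B ^ 2 * ℓ ^ 2) + 2) := by
      linarith
    positivity
  have cY : (b * ((B / 2 + 1) * ℓ + 1) + b ^ 2 * ((11 / 2 + f) * (B ^ 2 * ℓ ^ 2) + 2)) * Y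
      ≤ errWeight b B Lam φ₁ * Y := by
    rw [errWeight, ← hf, mul_assoc (11 / 2 + f)]
    gcongr
  have n1 : b ^ 2 * ℓ ^ 2 * (1 / 2 + 4 / 3 * (1 + f / 4)) * N
      ≤ b ^ 2 * ℓ ^ 2 * (1 / 2 + 4 / 3 * (1 + f / 4)) * (3 * (B ^ 2 * X + B ^ 2 * Y + W)) := by
    gcongr
  have m1 := mul_nonneg (by positivity : 0 ≤ b * B * ℓ / 2) s1
  have m2 := mul_nonneg (by positivity : 0 ≤ b * ℓ) s2
  have m3 := mul_nonneg hb.le s3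
  have m4 := mul_nonneg (by positivity : 0 ≤ b ^ 2) s4
  have m5 := mul_nonneg (by positivity : 0 ≤ b ^ 2) s5
  have m6 := mul_nonneg (by have : 0 ≤ B - 1 := by linarith
                            positivity : 0 ≤ b ^ 2 * ℓ * (B - 1) / 2) s1
  have m7 : 0 ≤ b ^ 2 * ℓ ^ 2 * B ^ 2 * X := by positivity
  have m8 : 0 ≤ b ^ 2 * ℓ ^ 2 * W := by positivity
  refine le_trans ?_ (add_le_add_right cY _)
  linarith

end ModeForm

/-! ### Spectral decomposition of the Laplacian -/

section Laplacian

variable {n : ℕ} {W : Matrix (Fin n) (Fin n) ℝ}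

lemma laplacian_isSymm (hW : W.IsSymm) : (laplacian W).IsSymm := by
  simp [laplacian, Matrix.IsSymm, Matrix.transpose_sub, hW.eq]

lemma laplacian_mulVec_apply (y : Fin n → ℝ) (i : Fin n) :
    (laplacian W).mulVec y i = ∑ j, W i j * (y i - y j) := by
  rw [laplacian, Matrix.sub_mulVec, Pi.sub_apply, Matrix.mulVec_diagonal, Matrix.mulVec,
    dotProduct, Finset.sum_mul, ← Finset.sum_sub_distrib]
  exact Finset.sum_congr rfl fun j _ => by ring

lemma sum_laplacian_row (i : Fin n) : ∑ j, laplacian W i j = 0 := by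
  have := laplacian_mulVec_apply (W := W) (fun _ => 1) i
  simpa [Matrix.mulVec, dotProduct] using this

lemma sum_laplacian_col (hW : W.IsSymm) (j : Fin n) : ∑ i, laplacian W i j = 0 := by
  rw [← sum_laplacian_row (W := W) j]
  exact Finset.sum_congr rfl fun i _ => (laplacian_isSymm hW).apply j i

lemma laplacian_quadratic_form (hW : W.IsSymm) (y : Fin n → ℝ) :
    2 * ∑ i, y i * (laplacian W).mulVec y i = ∑ i, ∑ j, W i j * (y i - y j) ^ 2 := by
  have h1 : ∑ i, y i * (laplacian W).mulVec y i = ∑ i, ∑ j, W i j * (y i * (y i - y j)) := by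
    refine Finset.sum_congr rfl fun i _ => ?_
    rw [laplacian_mulVec_apply, Finset.mul_sum]
    exact Finset.sum_congr rfl fun j _ => by ring
  have h2 : ∑ i, y i * (laplacian W).mulVec y i = ∑ i, ∑ j, W i j * (y j * (y j - y i)) := by
    rw [h1, Finset.sum_comm]
    refine Finset.sum_congr rfl fun i _ => Finset.sum_congr rfl fun j _ => ?_
    rw [hW.apply i j]
  rw [two_mul]
  nth_rewrite 1 [h1]
  rw [h2, ← Finset.sum_add_distrib]
  refine Finset.sum_congr rfl fun i _ => ?_
  rw [← Finset.sum_add_distrib]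
  exact Finset.sum_congr rfl fun j _ => by ring

lemma IsWeightMatrix.nonneg {G : SimpleGraph (Fin n)} (hW : IsWeightMatrix G W) (i j : Fin n) :
    0 ≤ W i j := by
  by_cases h : G.Adj i j
  · exact (hW.pos i j h).le
  · exact (hW.zero i j h).ge

/-- The quadratic form is a weighted sum of squared differences, so a kernel vector agrees across
every edge, hence along every walk. -/
lemma eq_of_laplacian_mulVec_eq_zero {G : SimpleGraph (Fin n)} (hG : G.Connected)
    (hW : IsWeightMatrix G W) {y : Fin n → ℝ} (hy : (laplacian W).mulVec y = 0) (i j : Fin n) :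
    y i = y j := by
  have h0 : ∑ i, ∑ j, W i j * (y i - y j) ^ 2 = 0 := by
    rw [← laplacian_quadratic_form hW.symm, hy]; simp
  have hnn : ∀ i j, 0 ≤ W i j * (y i - y j) ^ 2 := fun i j =>
    mul_nonneg (hW.nonneg i j) (sq_nonneg _)
  have hadj : ∀ i j, G.Adj i j → y i = y j := by
    intro i j hij
    have h1 := (Finset.sum_eq_zero_iff_of_nonneg
      (fun i _ => Finset.sum_nonneg fun j _ => hnn i j)).mp h0 i (Finset.mem_univ _)
    have h2 := (Finset.sum_eq_zero_iff_of_nonneg (fun j _ => hnn i j)).mp h1 j (Finset.mem_univ _)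
    have h3 := (mul_eq_zero.mp h2).resolve_left (hW.pos i j hij).ne'
    exact sub_eq_zero.mp (pow_eq_zero_iff two_ne_zero |>.mp h3)
  obtain ⟨w⟩ := hG.preconnected i j
  induction w with
  | nil => rfl
  | cons h _ ih => exact (hadj _ _ h).trans ih

/-- An orthonormal eigenbasis `b` of a Laplacian with eigenvalues `ℓ`: the zero modes are
constant, the others are orthogonal to constants with eigenvalue in `[lam, Lam]`. -/
structure IsModalBasis (L : Matrix (Fin n) (Fin n) ℝ) (lam Lam : ℝ) (b : Fin n → Fin n → ℝ)
    (ℓ : Fin n → ℝ) : Prop where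
  complete : ∀ i j, ∑ m, b m i * b m j = if i = j then 1 else 0
  eigen : ∀ m j, ∑ i, b m i * L i j = ℓ m * b m j
  lower : ∀ m, ℓ m ≠ 0 → lam ≤ ℓ m
  upper : ∀ m, ℓ m ≠ 0 → ℓ m ≤ Lam
  sum_eq_zero : ∀ m, ℓ m ≠ 0 → ∑ i, b m i = 0
  const : ∀ m, ℓ m = 0 → ∀ i j, b m i = b m j

/-- The spectral theorem supplies the basis. Eigenvalues are nonnegative by the quadratic form, so a
nonzero one is at least `lam`. Zero column sums make its eigenvector orthogonal to constants, and
connectivity makes the kernel constant. -/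
theorem exists_isModalBasis {G : SimpleGraph (Fin n)} (hG : G.Connected)
    (hW : IsWeightMatrix G W) {lam Lam : ℝ} (hlam : IsMinPosEigenvalue (laplacian W) lam)
    (hLam : IsSpectralRadius (laplacian W) Lam) :
    ∃ b ℓ, IsModalBasis (laplacian W) lam Lam b ℓ := by
  have hS := laplacian_isSymm hW.symm
  have hH : (laplacian W).IsHermitian := by
    rw [Matrix.IsHermitian, Matrix.conjTranspose_eq_transpose_of_trivial]
    exact hS
  set u := hH.eigenvectorBasis with hu
  set ℓ := hH.eigenvalues with hℓ
  have hmul : ∀ m, (laplacian W).mulVec (u m).ofLp = ℓ m • (u m).ofLp :=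
    fun m => hH.mulVec_eigenvectorBasis m
  have hne : ∀ m, (u m).ofLp ≠ 0 := by
    intro m h
    exact u.orthonormal.ne_zero m (by ext i; exact congrFun h i)
  have heig : ∀ m, Module.End.HasEigenvalue (Matrix.toLin' (laplacian W)) (ℓ m) := fun m =>
    Module.End.hasEigenvalue_of_hasEigenvector (x := (u m).ofLp)
      ⟨Module.End.mem_eigenspace_iff.mpr (by rw [Matrix.toLin'_apply]; exact hmul m), hne m⟩
  have hnn : ∀ m, 0 ≤ ℓ m := by
    intro m
    have h1 := laplacian_quadratic_form hW.symm (u m).ofLp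
    rw [hmul m] at h1
    have h2 : ∑ i, (u m).ofLp i * (ℓ m • (u m).ofLp) i = ℓ m := by
      have h3 : ∑ i, (u m).ofLp i ^ 2 = 1 := by
        have := u.orthonormal.1 m
        rw [EuclideanSpace.norm_eq, Real.sqrt_eq_one] at this
        simpa using this
      calc _ = ℓ m * ∑ i, (u m).ofLp i ^ 2 := by
            rw [Finset.mul_sum]
            exact Finset.sum_congr rfl fun i _ => by simp; ring
        _ = _ := by rw [h3, mul_one]
    rw [h2] at h1
    have h4 : 0 ≤ ∑ i, ∑ j, W i j * ((u m).ofLp i - (u m).ofLp j) ^ 2 :=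
      Finset.sum_nonneg fun i _ => Finset.sum_nonneg fun j _ =>
        mul_nonneg (hW.nonneg i j) (sq_nonneg _)
    linarith
  have hleft : ∀ m j, ∑ i, (u m).ofLp i * laplacian W i j = ℓ m * (u m).ofLp j := by
    intro m j
    have := congrFun (hmul m) j
    rw [Pi.smul_apply, smul_eq_mul, Matrix.mulVec, dotProduct] at this
    rw [← this]
    exact Finset.sum_congr rfl fun i _ => by rw [hS.apply i j, mul_comm]
  refine ⟨fun m i => (u m).ofLp i, ℓ, ⟨?_, hleft, ?_, ?_, ?_, ?_⟩⟩
  · intro i j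
    -- Parseval on two standard basis vectors gives the resolution of the identity.
    have h := u.sum_inner_mul_inner (EuclideanSpace.single i (1 : ℝ)) (EuclideanSpace.single j 1)
    simp only [EuclideanSpace.inner_single_left, EuclideanSpace.inner_single_right] at h
    simpa [PiLp.single_apply, eq_comm] using h
  · exact fun m hm => hlam.2 ⟨lt_of_le_of_ne (hnn m) (Ne.symm hm), heig m⟩
  · exact fun m _ => (le_abs_self _).trans (hLam.2 ⟨ℓ m, heig m, rfl⟩)
  · intro m hm
    have h : ∑ j, ∑ i, (u m).ofLp i * laplacian W i j = 0 := by
      rw [Finset.sum_comm]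
      exact Finset.sum_eq_zero fun i _ => by rw [← Finset.mul_sum, sum_laplacian_row, mul_zero]
    simp only [hleft, ← Finset.mul_sum] at h
    exact (mul_eq_zero.mp h).resolve_left hm
  · intro m hm i j
    exact eq_of_laplacian_mulVec_eq_zero hG hW (by rw [hmul m, hm, zero_smul]) i j

end Laplacian

/-! ### Modal coefficients of vector-valued families -/

section Modes

variable {n : ℕ} {V : Type*} [NormedAddCommGroup V] [InnerProductSpace ℝ V]

/-- The `m`-th modal coefficient `∑ i, b m i • x i` of a family `x`. -/
def mode (b : Fin n → Fin n → ℝ) (x : Fin n → V) (m : Fin n) : V := ∑ i, b m i • x i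

variable {b : Fin n → Fin n → ℝ} {ℓ : Fin n → ℝ} {L : Matrix (Fin n) (Fin n) ℝ} {lam Lam : ℝ}

lemma mode_add (x y : Fin n → V) (m : Fin n) :
    mode b (fun i => x i + y i) m = mode b x m + mode b y m := by
  simp [mode, smul_add, Finset.sum_add_distrib]

lemma mode_smul (c : ℝ) (x : Fin n → V) (m : Fin n) :
    mode b (fun i => c • x i) m = c • mode b x m := by
  simp only [mode, Finset.smul_sum]
  exact Finset.sum_congr rfl fun i _ => smul_comm _ _ _

lemma mode_sub (x y : Fin n → V) (m : Fin n) :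
    mode b (fun i => x i - y i) m = mode b x m - mode b y m := by
  simp [mode, smul_sub, Finset.sum_sub_distrib]

lemma IsModalBasis.mode_const (hb : IsModalBasis L lam Lam b ℓ) (c : V) {m : Fin n}
    (hm : ℓ m ≠ 0) : mode b (fun _ => c) m = 0 := by
  rw [mode, ← Finset.sum_smul, hb.sum_eq_zero m hm, zero_smul]

lemma IsModalBasis.mode_eq_zero (hb : IsModalBasis L lam Lam b ℓ) {x : Fin n → V}
    (hx : ∑ i, x i = 0) {m : Fin n} (hm : ℓ m = 0) : mode b x m = 0 := by
  rcases isEmpty_or_nonempty (Fin n) with h | ⟨⟨i₀⟩⟩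
  · simp [mode]
  · rw [mode, Finset.sum_congr rfl fun i _ => by rw [hb.const m hm i i₀], ← Finset.smul_sum, hx,
      smul_zero]

lemma IsModalBasis.mode_matrix (hb : IsModalBasis L lam Lam b ℓ) (x : Fin n → V) (m : Fin n) :
    mode b (fun i => ∑ j, L i j • x j) m = ℓ m • mode b x m := by
  simp only [mode, Finset.smul_sum, smul_smul, ← hb.eigen m]
  rw [Finset.sum_comm]
  exact Finset.sum_congr rfl fun j _ => by rw [Finset.sum_smul]

/-- Parseval. The basis acts on the agent index only, so `V` is arbitrary and no dimension enters.
-/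
lemma IsModalBasis.sum_norm_mode_sq (hb : IsModalBasis L lam Lam b ℓ) (x : Fin n → V) :
    ∑ m, ‖mode b x m‖ ^ 2 = ∑ i, ‖x i‖ ^ 2 := by
  have h1 : ∀ m, ‖mode b x m‖ ^ 2 = ∑ i, ∑ j, (b m i * b m j) * inner ℝ (x i) (x j) := by
    intro m
    rw [← real_inner_self_eq_norm_sq, mode, sum_inner]
    refine Finset.sum_congr rfl fun i _ => ?_
    rw [inner_sum]
    refine Finset.sum_congr rfl fun j _ => ?_
    rw [real_inner_smul_left, real_inner_smul_right]
    ring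
  simp only [h1]
  rw [Finset.sum_comm]
  refine Finset.sum_congr rfl fun i _ => ?_
  rw [Finset.sum_comm]
  simp only [← Finset.sum_mul, hb.complete]
  simp

/-- The modes with non-zero eigenvalue. -/
def activeModes (ℓ : Fin n → ℝ) : Finset (Fin n) := Finset.univ.filter fun m => ℓ m ≠ 0

lemma IsModalBasis.sum_active_le (hb : IsModalBasis L lam Lam b ℓ) (x : Fin n → V) :
    ∑ m ∈ activeModes ℓ, ‖mode b x m‖ ^ 2 ≤ ∑ i, ‖x i‖ ^ 2 := by
  rw [← hb.sum_norm_mode_sq]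
  exact Finset.sum_le_sum_of_subset_of_nonneg (Finset.subset_univ _) fun _ _ _ => by positivity

lemma IsModalBasis.sum_active_eq (hb : IsModalBasis L lam Lam b ℓ) {x : Fin n → V}
    (hx : ∑ i, x i = 0) : ∑ m ∈ activeModes ℓ, ‖mode b x m‖ ^ 2 = ∑ i, ‖x i‖ ^ 2 := by
  rw [← hb.sum_norm_mode_sq]
  refine Finset.sum_subset (Finset.subset_univ _) fun m _ hm => ?_
  have : ℓ m = 0 := by simpa [activeModes] using hm
  simp [hb.mode_eq_zero hx this]

end Modes

/-! ### Active modes and deviations from the average -/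

section Average

variable {n d : ℕ}

lemma sum_eq_smul_avg (hn : n ≠ 0) (x : Fin n → E d) : ∑ i, x i = (n : ℝ) • avg x := by
  rw [avg, smul_smul, mul_one_div_cancel (by exact_mod_cast hn), one_smul]

lemma sum_sub_avg (hn : n ≠ 0) (x : Fin n → E d) : ∑ i, (x i - avg x) = 0 := by
  rw [Finset.sum_sub_distrib, sum_eq_smul_avg hn]
  simp [Nat.cast_smul_eq_nsmul]

/-- Subtracting the mean leaves the active modes unchanged and annihilates the others. -/
lemma IsModalBasis.sum_active_eq_sub_avg {b : Fin n → Fin n → ℝ} {ℓ : Fin n → ℝ}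
    {L : Matrix (Fin n) (Fin n) ℝ} {lam Lam : ℝ} (hb : IsModalBasis L lam Lam b ℓ) (hn : n ≠ 0)
    (x : Fin n → E d) :
    ∑ m ∈ activeModes ℓ, ‖mode b x m‖ ^ 2 = ∑ i, ‖x i - avg x‖ ^ 2 := by
  rw [← hb.sum_active_eq (sum_sub_avg hn x)]
  refine Finset.sum_congr rfl fun m hm => ?_
  have hm' : ℓ m ≠ 0 := by simpa [activeModes] using hm
  rw [mode_sub, hb.mode_const _ hm', sub_zero]

end Average

/-! ### The pathwise one-step estimate -/

/-- Parameters for which the unperturbed consensus dynamics contracts with rate `κ`. -/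
structure IsContractive (β B lam Lam φ₁ κ : ℝ) : Prop where
  β_pos : 0 < β
  one_le_B : 1 ≤ B
  lam_pos : 0 < lam
  lam_le : lam ≤ Lam
  φ₁_pos : 0 < φ₁
  cond : β * ((7 + 8 / φ₁) * B ^ 2 * Lam ^ 2 + 2) ≤ B * lam / 2 - 9 / 4
  κ_pos : 0 < κ
  κ_le : κ ≤ β
  κ_le' : κ * ((1 + B) / 2 + 1 / lam) ≤ β / 4

lemma IsContractive.two_le {β B lam Lam φ₁ κ ℓ : ℝ} (h : IsContractive β B lam Lam φ₁ κ)
    (hℓ : lam ≤ ℓ) : 2 ≤ B * ℓ := by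
  have h1 := h.cond
  have h2 := h.β_pos
  have h3 := h.φ₁_pos
  have h4 : 0 ≤ β * ((7 + 8 / φ₁) * B ^ 2 * Lam ^ 2 + 2) := by positivity
  have h5 : B * lam ≤ B * ℓ := by
    have := h.one_le_B
    gcongr
  linarith

section ModeStep

variable {V : Type*} [NormedAddCommGroup V] [InnerProductSpace ℝ V]

/-- The bound `modeForm_le` turns the decay in `‖x‖²` and `ℓ ‖w‖²` into a fraction `κ` of the form
itself; `κ_le` and `κ_le'` are the two comparisons needed. -/
lemma IsContractive.modeForm_step {β B lam Lam φ₁ κ ℓ : ℝ} (h : IsContractive β B lam Lam φ₁ κ)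
    (hℓ : lam ≤ ℓ) (hℓ' : ℓ ≤ Lam) (x u z : V) :
    modeForm B ℓ (x - β • (B • ℓ • z + u)) (u + β • ℓ • z)
        + 4 / 3 * (1 + 2 / φ₁) * (β ^ 2 * ‖B • ℓ • z + u‖ ^ 2)
      ≤ (1 - κ) * modeForm B ℓ x u + errWeight β B Lam φ₁ * ‖z - x‖ ^ 2 := by
  have hℓ0 : 0 < ℓ := h.lam_pos.trans_le hℓ
  obtain ⟨w, rfl⟩ : ∃ w, u = ℓ • w := ⟨ℓ⁻¹ • u, by rw [smul_inv_smul₀ hℓ0.ne']⟩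
  obtain ⟨δ, rfl⟩ : ∃ δ, z = x + δ := ⟨z - x, by abel⟩
  have h1 := modeForm_step_aux h.β_pos h.one_le_B h.lam_pos hℓ hℓ' h.φ₁_pos h.cond x w δ
  have h2 := modeForm_le (B := B) h.lam_pos hℓ x (ℓ • w)
  have e1 : ℓ⁻¹ * ‖ℓ • w‖ ^ 2 = ℓ * ‖w‖ ^ 2 := by
    rw [norm_smul, mul_pow, Real.norm_eq_abs, sq_abs]
    field_simp
  have e2 : ℓ • (w + β • (x + δ)) = ℓ • w + β • ℓ • (x + δ) := by
    rw [smul_add, smul_comm ℓ β]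
  rw [e1] at h2
  rw [e2] at h1
  rw [add_sub_cancel_left]
  have h3 := mul_le_mul_of_nonneg_left h2 h.κ_pos.le
  have h4 : κ * ‖x‖ ^ 2 ≤ β * ‖x‖ ^ 2 := by
    have := h.κ_le
    gcongr
  have h5 : κ * ((1 + B) / 2 + 1 / lam) * (ℓ * ‖w‖ ^ 2) ≤ β / 4 * (ℓ * ‖w‖ ^ 2) := by
    have := h.κ_le'
    gcongr
  linarith

end ModeStep

section Lyapunov

variable {n d : ℕ} {b : Fin n → Fin n → ℝ} {ℓ : Fin n → ℝ} {L : Matrix (Fin n) (Fin n) ℝ}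
  {β B lam Lam φ₁ κ : ℝ}

/-- The consensus Lyapunov function: the sum of the quadratic forms of the active modes. -/
def consensusForm (B : ℝ) (b : Fin n → Fin n → ℝ) (ℓ : Fin n → ℝ) (x u : Fin n → E d) : ℝ :=
  ∑ m ∈ activeModes ℓ, modeForm B (ℓ m) (mode b x m) (mode b u m)

lemma mem_activeModes {m : Fin n} : m ∈ activeModes ℓ ↔ ℓ m ≠ 0 := by simp [activeModes]

lemma sum_sq_sub_avg_le_consensusForm (h : IsContractive β B lam Lam φ₁ κ)
    (hb : IsModalBasis L lam Lam b ℓ) (hn : n ≠ 0) (x u : Fin n → E d) :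
    ∑ i, ‖x i - avg x‖ ^ 2 ≤ 4 * consensusForm B b ℓ x u := by
  rw [← hb.sum_active_eq_sub_avg hn, consensusForm, Finset.mul_sum]
  refine Finset.sum_le_sum fun m hm => ?_
  have hl := hb.lower m (mem_activeModes.mp hm)
  have := quarter_norm_sq_le_modeForm (h.lam_pos.trans_le hl) (h.two_le hl) (mode b x m)
    (mode b u m)
  linarith

lemma consensusForm_nonneg (h : IsContractive β B lam Lam φ₁ κ)
    (hb : IsModalBasis L lam Lam b ℓ) (x u : Fin n → E d) : 0 ≤ consensusForm B b ℓ x u :=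
  Finset.sum_nonneg fun m hm =>
    have hl := hb.lower m (mem_activeModes.mp hm)
    modeForm_nonneg (h.lam_pos.trans_le hl) (h.two_le hl) _ _

lemma consensusForm_le (h : IsContractive β B lam Lam φ₁ κ)
    (hb : IsModalBasis L lam Lam b ℓ) (x u : Fin n → E d) :
    consensusForm B b ℓ x u
      ≤ ∑ i, ‖x i‖ ^ 2 + ((1 + B) / 2 + 1 / lam) / lam * ∑ i, ‖u i‖ ^ 2 := by
  have hlam := h.lam_pos
  have hB := h.one_le_B
  have hK : 0 ≤ ((1 + B) / 2 + 1 / lam) / lam := by positivity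
  have h1 := hb.sum_active_le x
  have h2 := mul_le_mul_of_nonneg_left (hb.sum_active_le u) hK
  refine le_trans ?_ (add_le_add h1 h2)
  rw [Finset.mul_sum, ← Finset.sum_add_distrib]
  refine Finset.sum_le_sum fun m hm => ?_
  have hl := hb.lower m (mem_activeModes.mp hm)
  refine (modeForm_le hlam hl _ _).trans ?_
  have : (ℓ m)⁻¹ ≤ lam⁻¹ := inv_anti₀ hlam hl
  have : ((1 + B) / 2 + 1 / lam) * ((ℓ m)⁻¹ * ‖mode b u m‖ ^ 2)
      ≤ ((1 + B) / 2 + 1 / lam) * (lam⁻¹ * ‖mode b u m‖ ^ 2) := by gcongr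
  have e : ((1 + B) / 2 + 1 / lam) * (lam⁻¹ * ‖mode b u m‖ ^ 2)
      = ((1 + B) / 2 + 1 / lam) / lam * ‖mode b u m‖ ^ 2 := by field_simp
  linarith

lemma norm_avg_sq_le (x : Fin n → E d) : (n : ℝ) * ‖avg x‖ ^ 2 ≤ ∑ i, ‖x i‖ ^ 2 := by
  rcases Nat.eq_zero_or_pos n with rfl | hn
  · simp
  have hn' : (0 : ℝ) < n := by exact_mod_cast hn
  have h1 : ‖∑ i, x i‖ ^ 2 ≤ n * ∑ i, ‖x i‖ ^ 2 := by
    have h2 : (∑ i, ‖x i‖) ^ 2 ≤ (n : ℝ) * ∑ i, ‖x i‖ ^ 2 := by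
      simpa using sq_sum_le_card_mul_sum_sq (s := Finset.univ) (f := fun i => ‖x i‖)
    exact (pow_le_pow_left₀ (norm_nonneg _) (norm_sum_le _ _) 2).trans h2
  rw [avg, norm_smul, mul_pow, Real.norm_eq_abs, sq_abs, one_div, inv_pow]
  calc (n : ℝ) * (((n : ℝ) ^ 2)⁻¹ * ‖∑ i, x i‖ ^ 2) = (n : ℝ)⁻¹ * ‖∑ i, x i‖ ^ 2 := by
        field_simp
    _ ≤ (n : ℝ)⁻¹ * (n * ∑ i, ‖x i‖ ^ 2) := by gcongr
    _ = _ := by field_simp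

/-- The factor of the perturbation in the one-step estimate. -/
def pertWeight (β B lam φ₁ Lf κ : ℝ) : ℝ :=
  (1 + 1 / κ) * (1 + ((1 + B) / 2 + 1 / lam) / lam * (2 * Lf ^ 2 / β ^ 2)) + 8 * (1 + 2 / φ₁)

lemma pertWeight_nonneg {Lf : ℝ} (h : IsContractive β B lam Lam φ₁ κ) :
    0 ≤ pertWeight β B lam φ₁ Lf κ := by
  have := h.lam_pos
  have := h.one_le_B
  have := h.φ₁_pos
  have := h.κ_pos
  unfold pertWeight
  positivity

/-- One step of the algorithm, with stochastic gradients `G` and local gradients `g`. -/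
theorem lyapunov_step {Lf ω η : ℝ} (h : IsContractive β B lam Lam φ₁ κ)
    (hb : IsModalBasis L lam Lam b ℓ) (hn : n ≠ 0) (hω : 0 < ω) (hη : η = β / ω) (hη1 : η ≤ 1)
    (hcol : ∀ j, ∑ i, L i j = 0) {g : E d → Fin n → E d}
    (hg : ∀ i y y', ‖g y i - g y' i‖ ≤ Lf * ‖y - y'‖)
    {x v xh G x' v' xc' : Fin n → E d} (hv : ∑ i, v i = 0)
    (hx' : ∀ i, x' i = x i - η • ((B * ω) • ∑ j, L i j • xh j + ω • v i + G i))
    (hv' : ∀ i, v' i = v i + (η * ω) • ∑ j, L i j • xh j) :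
    consensusForm B b ℓ x' (fun i => v' i + (1 / ω) • g (avg x') i) + ∑ i, ‖x' i - xc' i‖ ^ 2
      ≤ (1 + κ) * ((1 - κ) * consensusForm B b ℓ x (fun i => v i + (1 / ω) • g (avg x) i)
          + errWeight β B Lam φ₁ * ∑ i, ‖xh i - x i‖ ^ 2
          + (1 + φ₁ / 2) * ∑ i, ‖x i - xc' i‖ ^ 2)
        + η ^ 2 * pertWeight β B lam φ₁ Lf κ
          * (n * ‖avg (g (avg x))‖ ^ 2 + ∑ i, ‖G i - g (avg x) i‖ ^ 2) := by
  have hβ := h.β_pos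
  have hκ := h.κ_pos
  have hφ := h.φ₁_pos
  have hlam := h.lam_pos
  have hB := h.one_le_B
  have hη0 : 0 < η := by rw [hη]; positivity
  have hηω : η * ω = β := by rw [hη]; field_simp
  have hηβ : 1 / ω = η / β := by rw [hη]; field_simp
  have hβη : β * (1 / ω) = η := by rw [hη]; ring
  have hn' : (0 : ℝ) < n := by positivity
  set u : Fin n → E d := fun i => v i + (1 / ω) • g (avg x) i with hu
  set D : Fin n → E d := fun i => G i - g (avg x) i with hD
  set gb := avg (g (avg x)) with hgb
  set Lx : Fin n → E d := fun i => ∑ j, L i j • xh j with hLx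
  set Δ : Fin n → E d := fun i => g (avg x') i - g (avg x) i with hΔ
  set S := ∑ i, ‖D i‖ ^ 2 with hS
  have hLx0 : ∑ i, Lx i = 0 := by
    simp only [hLx]
    rw [Finset.sum_comm]
    simp [← Finset.sum_smul, hcol]
  -- the displacement of one agent
  have hdisp : ∀ i, x' i = x i + ((-β) • (B • Lx i + u i) + (-η) • D i) := by
    intro i
    rw [hx' i]
    simp only [hu, hD]
    rw [← hβη, ← hηω]
    match_scalars <;> field_simp
    ring
  -- modes of the new point
  have hmx : ∀ m, mode b x' m = (mode b x m - β • (B • ℓ m • mode b xh m + mode b u m))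
      + (-η) • mode b D m := by
    intro m
    have : x' = fun i => x i + ((-β) • (B • Lx i + u i) + (-η) • D i) := funext hdisp
    rw [this, mode_add, mode_add (fun i => (-β) • (B • Lx i + u i)), mode_smul, mode_add
      (fun i => B • Lx i), mode_smul, mode_smul, hLx, hb.mode_matrix]
    module
  have hmu : ∀ m, mode b (fun i => v' i + (1 / ω) • g (avg x') i) m
      = (mode b u m + β • ℓ m • mode b xh m) + (1 / ω) • mode b Δ m := by
    intro m
    have : (fun i => v' i + (1 / ω) • g (avg x') i)
        = fun i => (u i + β • Lx i) + (1 / ω) • Δ i := by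
      funext i
      simp only [hu, hΔ, hv' i, hηω, hLx]
      module
    rw [this, mode_add (fun i => u i + β • Lx i), mode_add, mode_smul, mode_smul, hLx,
      hb.mode_matrix]
  set R := errWeight β B Lam φ₁ with hR
  have hR0 : 0 ≤ R := by
    have := hlam.trans_le h.lam_le
    rw [hR, errWeight]
    positivity
  set K := ((1 + B) / 2 + 1 / lam) / lam with hK
  have hK0 : 0 ≤ K := by positivity
  set q := consensusForm B b ℓ x u with hq
  -- the displacement splits into a part without mean and a perturbation
  set a : Fin n → E d := fun i => (-β) • (B • Lx i + (u i - (1 / ω) • gb)) with ha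
  set r : Fin n → E d := fun i => (-η) • (gb + D i) with hr
  have har : ∀ i, x' i - x i = a i + r i := by
    intro i
    rw [hdisp i]
    simp only [ha, hr]
    rw [← hβη]
    module
  have ha0 : ∑ i, a i = 0 := by
    have h1 : ∑ i, u i = ∑ _i : Fin n, (1 / ω) • gb := by
      simp only [hu]
      rw [Finset.sum_add_distrib, hv, ← Finset.smul_sum, sum_eq_smul_avg hn, ← hgb]
      simp only [Finset.sum_const, Finset.card_univ, Fintype.card_fin, zero_add,
        ← Nat.cast_smul_eq_nsmul ℝ]
      rw [smul_comm]
    simp only [ha]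
    rw [← Finset.smul_sum, Finset.sum_add_distrib, ← Finset.smul_sum, hLx0,
      Finset.sum_sub_distrib, h1]
    simp
  have hma : ∀ m ∈ activeModes ℓ, ‖mode b a m‖ ^ 2
      = β ^ 2 * ‖B • ℓ m • mode b xh m + mode b u m‖ ^ 2 := by
    intro m hm
    simp only [ha]
    rw [mode_smul, mode_add (fun i => B • Lx i), mode_smul, hLx, hb.mode_matrix, mode_sub,
      hb.mode_const _ (mem_activeModes.mp hm), sub_zero, norm_smul, mul_pow, norm_neg,
      Real.norm_eq_abs, sq_abs]
  have hsa : ∑ i, ‖a i‖ ^ 2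
      = ∑ m ∈ activeModes ℓ, β ^ 2 * ‖B • ℓ m • mode b xh m + mode b u m‖ ^ 2 := by
    rw [← hb.sum_active_eq ha0]
    exact Finset.sum_congr rfl hma
  have hsr : ∑ i, ‖r i‖ ^ 2 ≤ 2 * η ^ 2 * (n * ‖gb‖ ^ 2 + S) := by
    have : ∀ i, ‖r i‖ ^ 2 ≤ 2 * η ^ 2 * (‖gb‖ ^ 2 + ‖D i‖ ^ 2) := by
      intro i
      simp only [hr]
      rw [norm_smul, mul_pow, norm_neg, Real.norm_eq_abs, sq_abs]
      have h1 := norm_add_sq_le_young one_pos gb (D i)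
      have h2 := mul_le_mul_of_nonneg_left h1 (sq_nonneg η)
      linarith
    refine (Finset.sum_le_sum fun i _ => this i).trans (le_of_eq ?_)
    rw [← Finset.mul_sum, Finset.sum_add_distrib]
    simp [hS]
  -- Young's inequality with parameter `1 / 3` matches the factor `4 / 3` reserved in the
  -- contraction of the modes.
  have hdx : ∑ i, ‖x' i - x i‖ ^ 2 ≤ 4 / 3 * ∑ i, ‖a i‖ ^ 2 + 8 * η ^ 2 * (n * ‖gb‖ ^ 2 + S) := by
    have : ∑ i, ‖x' i - x i‖ ^ 2 ≤ ∑ i, (4 / 3 * ‖a i‖ ^ 2 + 4 * ‖r i‖ ^ 2) := by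
      refine Finset.sum_le_sum fun i _ => ?_
      rw [har i]
      have := norm_add_sq_le_young (by norm_num : (0 : ℝ) < 1 / 3) (a i) (r i)
      norm_num at this
      linarith
    rw [Finset.sum_add_distrib, ← Finset.mul_sum, ← Finset.mul_sum] at this
    linarith
  -- As `a` has zero sum, the average moves only by the mean of `r`, which is of order `η`. The
  -- drift of the gradients at the average is therefore of order `η` too.
  have hΔsum : ∑ i, ‖Δ i‖ ^ 2 ≤ 2 * Lf ^ 2 * η ^ 2 * (n * ‖gb‖ ^ 2 + S) := by
    have h1 : avg x' - avg x = avg r := by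
      have : ∑ i, x' i - ∑ i, x i = ∑ i, r i := by
        rw [← Finset.sum_sub_distrib, Finset.sum_congr rfl fun i _ => har i,
          Finset.sum_add_distrib, ha0, zero_add]
      rw [avg, avg, avg, ← smul_sub, this]
    have h2 : ∀ i, ‖Δ i‖ ^ 2 ≤ Lf ^ 2 * ‖avg r‖ ^ 2 := by
      intro i
      rw [← mul_pow, ← h1]
      exact pow_le_pow_left₀ (norm_nonneg _) (hg i _ _) 2
    have h3 : ∑ i, ‖Δ i‖ ^ 2 ≤ Lf ^ 2 * (n * ‖avg r‖ ^ 2) := by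
      refine (Finset.sum_le_sum fun i _ => h2 i).trans (le_of_eq ?_)
      simp
      ring
    have h4 := mul_le_mul_of_nonneg_left ((norm_avg_sq_le r).trans hsr) (sq_nonneg Lf)
    linarith
  -- the consensus part
  have hcons : consensusForm B b ℓ x' (fun i => v' i + (1 / ω) • g (avg x') i)
      ≤ (1 + κ) * ((1 - κ) * q + R * ∑ i, ‖xh i - x i‖ ^ 2
          - 4 / 3 * (1 + 2 / φ₁) * ∑ i, ‖a i‖ ^ 2)
        + (1 + 1 / κ) * consensusForm B b ℓ (fun i => (-η) • D i) (fun i => (1 / ω) • Δ i) := by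
    have h1 : R * ∑ m ∈ activeModes ℓ, ‖mode b xh m - mode b x m‖ ^ 2
        ≤ R * ∑ i, ‖xh i - x i‖ ^ 2 := by
      refine mul_le_mul_of_nonneg_left ?_ hR0
      simp only [← mode_sub]
      exact hb.sum_active_le _
    have h2 : consensusForm B b ℓ x' (fun i => v' i + (1 / ω) • g (avg x') i)
        ≤ ∑ m ∈ activeModes ℓ, ((1 + κ) * ((1 - κ) * modeForm B (ℓ m) (mode b x m) (mode b u m)
            + R * ‖mode b xh m - mode b x m‖ ^ 2
            - 4 / 3 * (1 + 2 / φ₁) * (β ^ 2 * ‖B • ℓ m • mode b xh m + mode b u m‖ ^ 2))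
          + (1 + 1 / κ) * modeForm B (ℓ m) (mode b (fun i => (-η) • D i) m)
            (mode b (fun i => (1 / ω) • Δ i) m)) := by
      refine Finset.sum_le_sum fun m hm => ?_
      have hl := hb.lower m (mem_activeModes.mp hm)
      have hl' := hb.upper m (mem_activeModes.mp hm)
      rw [hmx, hmu, mode_smul, mode_smul]
      have h3 := modeForm_add_le (hlam.trans_le hl) (h.two_le hl) hκ
        (mode b x m - β • (B • ℓ m • mode b xh m + mode b u m))
        (mode b u m + β • ℓ m • mode b xh m) ((-η) • mode b D m) ((1 / ω) • mode b Δ m)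
      have h4 := h.modeForm_step hl hl' (mode b x m) (mode b u m) (mode b xh m)
      have h5 := mul_le_mul_of_nonneg_left h4 (by linarith : 0 ≤ 1 + κ)
      linarith
    rw [Finset.sum_add_distrib, ← Finset.mul_sum, ← Finset.mul_sum, Finset.sum_sub_distrib,
      Finset.sum_add_distrib, ← Finset.mul_sum, ← Finset.mul_sum, ← Finset.mul_sum, ← hsa] at h2
    refine h2.trans ?_
    have h6 := mul_le_mul_of_nonneg_left h1 (by linarith : 0 ≤ 1 + κ)
    rw [hq]
    unfold consensusForm
    linarith
  have hpert : consensusForm B b ℓ (fun i => (-η) • D i) (fun i => (1 / ω) • Δ i)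
      ≤ η ^ 2 * (1 + K * (2 * Lf ^ 2 / β ^ 2)) * (n * ‖gb‖ ^ 2 + S) := by
    refine (consensusForm_le h hb _ _).trans ?_
    simp only [norm_smul, mul_pow, norm_neg, Real.norm_eq_abs, sq_abs, ← Finset.mul_sum]
    rw [← hS, ← hK, hηβ]
    have h1 : (η / β) ^ 2 * ∑ i, ‖Δ i‖ ^ 2
        ≤ 1 / β ^ 2 * (2 * Lf ^ 2 * η ^ 2 * (n * ‖gb‖ ^ 2 + S)) := by
      have : (η / β) ^ 2 ≤ 1 / β ^ 2 := by
        rw [div_pow]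
        gcongr
        exact pow_le_one₀ hη0.le hη1
      gcongr
    have h2 := mul_le_mul_of_nonneg_left h1 hK0
    have h3 : 0 ≤ η ^ 2 * (n * ‖gb‖ ^ 2) := by positivity
    have e : K * (1 / β ^ 2 * (2 * Lf ^ 2 * η ^ 2 * (n * ‖gb‖ ^ 2 + S)))
      = η ^ 2 * (K * (2 * Lf ^ 2 / β ^ 2)) * (n * ‖gb‖ ^ 2 + S) := by field_simp
    linarith
  have herr : ∑ i, ‖x' i - xc' i‖ ^ 2 ≤ (1 + 2 / φ₁) * ∑ i, ‖x' i - x i‖ ^ 2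
      + (1 + φ₁ / 2) * ∑ i, ‖x i - xc' i‖ ^ 2 := by
    rw [Finset.mul_sum, Finset.mul_sum, ← Finset.sum_add_distrib]
    refine Finset.sum_le_sum fun i _ => ?_
    have := norm_add_sq_le_young (by positivity : 0 < 2 / φ₁) (x' i - x i) (x i - xc' i)
    rw [sub_add_sub_cancel, one_div_div] at this
    exact this
  -- The reserve `4 / 3 * (1 + 2 / φ₁) * ∑ ‖a i‖²` in `hcons` cancels the displacement term of
  -- `herr`; `p3` and `p4` account for the extra factor `1 + κ`.
  have p1 := mul_le_mul_of_nonneg_left hpert (by positivity : 0 ≤ 1 + 1 / κ)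
  have p2 := mul_le_mul_of_nonneg_left hdx (by positivity : 0 ≤ 1 + 2 / φ₁)
  have p3 : 0 ≤ κ * (4 / 3 * (1 + 2 / φ₁) * ∑ i, ‖a i‖ ^ 2) := by positivity
  have p4 : 0 ≤ κ * ((1 + φ₁ / 2) * ∑ i, ‖x i - xc' i‖ ^ 2) := by positivity
  rw [pertWeight, ← hK]
  linarith

end Lyapunov

/-! ### Smooth functions -/

section Smooth

variable {V : Type*} [NormedAddCommGroup V] [InnerProductSpace ℝ V] [CompleteSpace V]

/-- The descent lemma for a function with Lipschitz gradient. -/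
theorem descent_lemma {f : V → ℝ} {K : ℝ} (hf : Differentiable ℝ f)
    (hK : ∀ x y, ‖gradient f x - gradient f y‖ ≤ K * ‖x - y‖) (x y : V) :
    f y ≤ f x + inner ℝ (gradient f x) (y - x) + K / 2 * ‖y - x‖ ^ 2 := by
  set e := y - x with he
  -- Along the segment, `f` minus its quadratic majorant has nonpositive derivative, by
  -- Cauchy–Schwarz and the Lipschitz bound.
  set φ : ℝ → ℝ := fun t => f (x + t • e) - (t * inner ℝ (gradient f x) e + K / 2 * t ^ 2 * ‖e‖ ^ 2)
    with hφ
  have hd : ∀ t : ℝ, HasDerivAt φ (inner ℝ (gradient f (x + t • e)) e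
      - (inner ℝ (gradient f x) e + K * t * ‖e‖ ^ 2)) t := by
    intro t
    have h1 : HasDerivAt (fun t : ℝ => x + t • e) e t := by
      simpa using ((hasDerivAt_id t).smul_const e).const_add x
    have h2 := ((hf (x + t • e)).hasGradientAt.hasFDerivAt).comp_hasDerivAt t h1
    rw [InnerProductSpace.toDual_apply_apply] at h2
    refine h2.sub ?_
    have h3 := ((hasDerivAt_id t).mul_const (inner ℝ (gradient f x) e)).add
      (((hasDerivAt_pow 2 t).const_mul (K / 2)).mul_const (‖e‖ ^ 2))
    refine h3.congr_deriv ?_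
    simp only [one_mul, Nat.cast_ofNat, Nat.add_one_sub_one, pow_one]
    ring
  have hanti : AntitoneOn φ (Set.Icc 0 1) := by
    refine antitoneOn_of_deriv_nonpos (convex_Icc 0 1)
      (fun t _ => (hd t).continuousAt.continuousWithinAt)
      (fun t _ => (hd t).differentiableAt.differentiableWithinAt) fun t ht => ?_
    rw [interior_Icc] at ht
    rw [(hd t).deriv]
    have h1 := hK (x + t • e) x
    rw [add_sub_cancel_left, norm_smul, Real.norm_eq_abs, abs_of_pos ht.1] at h1
    have h2 := real_inner_le_norm (gradient f (x + t • e) - gradient f x) e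
    rw [inner_sub_left] at h2
    have h3 := mul_le_mul_of_nonneg_right h1 (norm_nonneg e)
    nlinarith
  have h := hanti (Set.left_mem_Icc.mpr zero_le_one) (Set.right_mem_Icc.mpr zero_le_one) zero_le_one
  simp only [hφ, one_smul, zero_smul, add_zero] at h
  have hxy : x + e = y := by rw [he]; abel
  rw [hxy] at h
  linarith

/-- The gradient of a smooth function is controlled by its distance to a lower bound. -/
theorem norm_gradient_sq_le {f : V → ℝ} {K m : ℝ} (hK0 : 0 < K) (hf : Differentiable ℝ f)
    (hK : ∀ x y, ‖gradient f x - gradient f y‖ ≤ K * ‖x - y‖) (hm : ∀ x, m ≤ f x) (x : V) :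
    ‖gradient f x‖ ^ 2 ≤ 2 * K * (f x - m) := by
  -- The step `1 / K` minimises the quadratic upper bound.
  have h := descent_lemma hf hK x (x - (1 / K) • gradient f x)
  have h1 := hm (x - (1 / K) • gradient f x)
  rw [sub_sub_cancel_left, inner_neg_right, real_inner_smul_right, real_inner_self_eq_norm_sq,
    norm_neg, norm_smul, mul_pow, Real.norm_eq_abs, sq_abs] at h
  have h2 : K / 2 * ((1 / K) ^ 2 * ‖gradient f x‖ ^ 2) = 1 / (2 * K) * ‖gradient f x‖ ^ 2 := by
    field_simp
  have h3 : 1 / K * ‖gradient f x‖ ^ 2 = 2 * (1 / (2 * K) * ‖gradient f x‖ ^ 2) := by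
    field_simp
  have h4 : 1 / (2 * K) * ‖gradient f x‖ ^ 2 ≤ f x - m := by linarith
  rw [one_div, inv_mul_le_iff₀ (by positivity)] at h4
  linarith

end Smooth

/-! ### Regularity of the global cost -/

section Costs

variable {n d : ℕ} {Ξ : Type*} [MeasurableSpace Ξ] {F : Fin n → E d → Ξ → ℝ}
  {D : Fin n → Measure Ξ} {Lf : ℝ}

lemma SmoothCosts.differentiable_globalCost (h : SmoothCosts F D Lf) :
    Differentiable ℝ (globalCost F D) := by
  unfold globalCost
  exact (Differentiable.fun_sum fun i _ => (h i).1).const_mul _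

lemma SmoothCosts.gradient_globalCost (h : SmoothCosts F D Lf) (x : E d) :
    gradient (globalCost F D) x = avg (fun i => gradient (localCost F D i) x) := by
  have h1 : HasFDerivAt (globalCost F D)
      ((1 / (n : ℝ)) • ∑ i, fderiv ℝ (localCost F D i) x) x := by
    unfold globalCost
    exact (HasFDerivAt.fun_sum fun i _ => ((h i).1 x).hasFDerivAt).const_mul _
  rw [gradient, h1.fderiv, avg, map_smulₛₗ, map_sum]
  simp [gradient]

lemma norm_avg_sub_le (hn : n ≠ 0) {x y : Fin n → E d} {c : ℝ} (h : ∀ i, ‖x i - y i‖ ≤ c) :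
    ‖avg x - avg y‖ ≤ c := by
  have hn' : (0 : ℝ) < n := by positivity
  rw [avg, avg, ← smul_sub, ← Finset.sum_sub_distrib, norm_smul, Real.norm_eq_abs,
    abs_of_pos (by positivity)]
  have h1 : ‖∑ i, (x i - y i)‖ ≤ n * c := by
    refine (norm_sum_le _ _).trans ((Finset.sum_le_sum fun i _ => h i).trans ?_)
    simp
  calc 1 / (n : ℝ) * ‖∑ i, (x i - y i)‖ ≤ 1 / (n : ℝ) * (n * c) := by gcongr
    _ = c := by field_simp

lemma SmoothCosts.lipschitz_globalCost (h : SmoothCosts F D Lf) (hn : n ≠ 0) (x y : E d) :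
    ‖gradient (globalCost F D) x - gradient (globalCost F D) y‖ ≤ Lf * ‖x - y‖ := by
  rw [h.gradient_globalCost, h.gradient_globalCost]
  exact norm_avg_sub_le hn fun i => (h i).2 x y

lemma optimalValue_le (h : BddBelow (Set.range (globalCost F D))) (x : E d) :
    optimalValue F D ≤ globalCost F D x := ciInf_le h x

lemma SmoothCosts.continuous_gradient (h : SmoothCosts F D Lf) (i : Fin n) :
    Continuous (gradient (localCost F D i)) := by
  refine (LipschitzWith.of_dist_le_mul (K := Real.toNNReal Lf) fun x y => ?_).continuous
  rw [dist_eq_norm, dist_eq_norm]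
  refine ((h i).2 x y).trans ?_
  gcongr
  exact Real.le_coe_toNNReal Lf

end Costs

/-! ### Integration against fresh randomness -/

section Fresh

variable {Ω 𝒮 𝒴 : Type*} [MeasurableSpace Ω] [MeasurableSpace 𝒮] [MeasurableSpace 𝒴]
  {P : Measure Ω} [IsProbabilityMeasure P] {Q : Measure 𝒴} {S : Ω → 𝒮} {Y : Ω → 𝒴}

lemma map_prod_of_indep (hS : Measurable S) (hY : Measurable Y) (hSY : IndepFun S Y P)
    (hQ : P.map Y = Q) : P.map (fun o => (S o, Y o)) = (P.map S).prod Q := by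
  rw [← hQ]
  exact (indepFun_iff_map_prod_eq_prod_map_map hS.aemeasurable hY.aemeasurable).mp hSY

/-- Plays the role of a conditional expectation bound: freeze the past `S`, integrate over the fresh
`Y`. Joint integrability is a conclusion, since for `f ≥ 0` it follows from Tonelli and the bound
`ψ`. -/
lemma integrable_and_integral_le_of_fresh (hS : Measurable S) (hY : Measurable Y)
    (hSY : IndepFun S Y P) (hQ : P.map Y = Q) {f : 𝒮 × 𝒴 → ℝ} {ψ : 𝒮 → ℝ} (hf : Measurable f)
    (hf0 : ∀ q, 0 ≤ f q) (hψm : Measurable ψ) (hint : ∀ s, Integrable (fun y => f (s, y)) Q)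
    (hle : ∀ s, ∫ y, f (s, y) ∂Q ≤ ψ s) (hψ : Integrable (fun o => ψ (S o)) P) :
    Integrable (fun o => f (S o, Y o)) P ∧ ∫ o, f (S o, Y o) ∂P ≤ ∫ o, ψ (S o) ∂P := by
  have : IsProbabilityMeasure Q := hQ ▸ Measure.isProbabilityMeasure_map hY.aemeasurable
  have : IsProbabilityMeasure (P.map S) := Measure.isProbabilityMeasure_map hS.aemeasurable
  have hlaw := map_prod_of_indep hS hY hSY hQ
  have hSY' : Measurable fun o => (S o, Y o) := hS.prodMk hY
  have hψ' : Integrable ψ (P.map S) :=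
    (integrable_map_measure hψm.aestronglyMeasurable hS.aemeasurable).mpr hψ
  have hI0 : ∀ s, 0 ≤ ∫ y, f (s, y) ∂Q := fun s => integral_nonneg fun y => hf0 _
  have hfi : Integrable f ((P.map S).prod Q) := by
    rw [integrable_prod_iff hf.aestronglyMeasurable]
    refine ⟨Filter.Eventually.of_forall hint, ?_⟩
    have e : (fun s => ∫ y, ‖f (s, y)‖ ∂Q) = fun s => ∫ y, f (s, y) ∂Q := by
      funext s
      exact integral_congr_ae (Filter.Eventually.of_forall fun y => Real.norm_of_nonneg (hf0 _))
    rw [e]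
    refine hψ'.mono' hf.stronglyMeasurable.integral_prod_right'.aestronglyMeasurable
      (Filter.Eventually.of_forall fun s => ?_)
    rw [Real.norm_of_nonneg (hI0 s)]
    exact hle s
  constructor
  · rw [← hlaw] at hfi
    exact (integrable_map_measure hf.aestronglyMeasurable hSY'.aemeasurable).mp hfi
  · calc ∫ o, f (S o, Y o) ∂P = ∫ q, f q ∂(P.map fun o => (S o, Y o)) :=
          (integral_map hSY'.aemeasurable hf.aestronglyMeasurable).symm
      _ = ∫ s, ∫ y, f (s, y) ∂Q ∂(P.map S) := by rw [hlaw, integral_prod _ hfi]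
      _ ≤ ∫ s, ψ s ∂(P.map S) := integral_mono hfi.integral_prod_left hψ' hle
      _ = _ := integral_map hS.aemeasurable hψm.aestronglyMeasurable

/-- The signed analogue, by Fubini; without a sign, joint integrability has to be supplied. -/
lemma integral_eq_zero_of_fresh (hS : Measurable S) (hY : Measurable Y)
    (hSY : IndepFun S Y P) (hQ : P.map Y = Q) {f : 𝒮 × 𝒴 → ℝ} (hf : Measurable f)
    (h0 : ∀ s, ∫ y, f (s, y) ∂Q = 0) (hint : Integrable (fun o => f (S o, Y o)) P) :
    ∫ o, f (S o, Y o) ∂P = 0 := by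
  have : IsProbabilityMeasure Q := hQ ▸ Measure.isProbabilityMeasure_map hY.aemeasurable
  have : IsProbabilityMeasure (P.map S) := Measure.isProbabilityMeasure_map hS.aemeasurable
  have hlaw := map_prod_of_indep hS hY hSY hQ
  have hSY' : Measurable fun o => (S o, Y o) := hS.prodMk hY
  have hfi : Integrable f ((P.map S).prod Q) := by
    rw [← hlaw]
    exact (integrable_map_measure hf.aestronglyMeasurable hSY'.aemeasurable).mpr hint
  calc ∫ o, f (S o, Y o) ∂P = ∫ q, f q ∂(P.map fun o => (S o, Y o)) :=
        (integral_map hSY'.aemeasurable hf.aestronglyMeasurable).symm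
    _ = ∫ s, ∫ y, f (s, y) ∂Q ∂(P.map S) := by rw [hlaw, integral_prod _ hfi]
    _ = 0 := by simp [h0]

/-- Three independent variables `A`, `B`, `Y`, regrouped. -/
lemma indepFun_prodMk_regroup {𝒜 ℬ : Type*} [MeasurableSpace 𝒜] [MeasurableSpace ℬ]
    {A : Ω → 𝒜} {B : Ω → ℬ} (hA : Measurable A) (hB : Measurable B) (hY : Measurable Y)
    (hAB : IndepFun A B P) (hABY : IndepFun (fun o => (A o, B o)) Y P) :
    IndepFun (fun o => (A o, Y o)) B P := by
  have p1 : IsProbabilityMeasure (P.map A) := Measure.isProbabilityMeasure_map hA.aemeasurable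
  have p2 : IsProbabilityMeasure (P.map B) := Measure.isProbabilityMeasure_map hB.aemeasurable
  have p3 : IsProbabilityMeasure (P.map Y) := Measure.isProbabilityMeasure_map hY.aemeasurable
  have h2 : IndepFun A Y P := hABY.comp measurable_fst measurable_id
  rw [indepFun_iff_map_prod_eq_prod_map_map (hA.prodMk hY).aemeasurable hB.aemeasurable,
    map_prod_of_indep hA hY h2 rfl]
  -- Reassociating and swapping carries the product law of `((A, B), Y)` to that of `((A, Y), B)`.
  have hr := (((measurePreserving_prodAssoc (P.map A) (P.map Y) (P.map B)).symm
      MeasurableEquiv.prodAssoc).comp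
    ((MeasurePreserving.id (P.map A)).prod
      (Measure.measurePreserving_swap (μ := P.map B) (ν := P.map Y)))).comp
    (measurePreserving_prodAssoc (P.map A) (P.map B) (P.map Y))
  rw [← hr.map_eq, ← map_prod_of_indep hA hB hAB rfl,
    ← map_prod_of_indep (hA.prodMk hB) hY hABY rfl,
    Measure.map_map hr.measurable ((hA.prodMk hB).prodMk hY)]
  rfl

end Fresh

/-! ### The random trajectory -/

section Indep

variable {n : ℕ} {Ω Ξ Z : Type*} [mΩ : MeasurableSpace Ω] [MeasurableSpace Ξ] [MeasurableSpace Z]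
  {P : Measure Ω} [IsProbabilityMeasure P] {D : Fin n → Measure Ξ} {Q : Measure Z}
  {ξ : Fin n → ℕ → Ω → Ξ} {ζ : Fin n → ℕ → Ω → Z}

/-- The datum `ξ i K` is independent of the past and of the other data of step `K`. -/
lemma IsSampling.indepFun_data (h : IsSampling P D Q ξ ζ) (i : Fin n) (K : ℕ) {𝒮 : Type*}
    [MeasurableSpace 𝒮] {S : Ω → 𝒮}
    (hS : ∀ m : MeasurableSpace Ω, (∀ j l, l < K → Measurable[m] (ξ j l)) →
      (∀ j l, l < K → Measurable[m] (ζ j l)) → (∀ j, j ≠ i → Measurable[m] (ξ j K)) →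
      Measurable[m] S) : IndepFun S (ξ i K) P := by
  classical
  -- `A` holds the data up to and including step `K` except the one at `(i, K)`. `Y` may hold the
  -- seeds of all times, as data and seeds are independent.
  set I : Finset (Fin n × ℕ) := (Finset.univ ×ˢ Finset.range (K + 1)).erase (i, K) with hI
  set A : Ω → I → Ξ := fun o q => ξ q.1.1 q.1.2 o with hA
  set Y : Ω → Fin n × ℕ → Z := fun o q => ζ q.1 q.2 o with hY
  have hAm : Measurable A := measurable_pi_lambda _ fun q => h.measurable_data _ _
  have hYm : Measurable Y := measurable_pi_lambda _ fun q => h.measurable_seed _ _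
  have hAB : IndepFun A (ξ i K) P := by
    have h1 := h.indep_data.indepFun_finset I {(i, K)} (by simp [hI])
      fun q => h.measurable_data _ _
    exact h1.comp measurable_id
      (measurable_pi_apply (⟨(i, K), Finset.mem_singleton_self _⟩ : ({(i, K)} : Finset _)))
  have hABY : IndepFun (fun o => (A o, ξ i K o)) Y P := by
    refine h.indep_data_seed.comp
      (φ := fun w : Fin n × ℕ → Ξ => ((fun q : I => w q.1), w (i, K))) ?_ measurable_id
    exact (measurable_pi_lambda _ fun q => measurable_pi_apply _).prodMk (measurable_pi_apply _)
  have hind := indepFun_prodMk_regroup hAm (h.measurable_data i K) hYm hAB hABY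
  -- `hS` is applied to the σ-algebra generated by `(A, Y)`. Quantifying it over all σ-algebras lets
  -- one measurability induction along the trajectory prove adaptedness.
  refine (IndepFun_iff_Indep _ _ _).mpr (indep_of_indep_of_le_left
    ((IndepFun_iff_Indep _ _ _).mp hind) (hS _ ?_ ?_ ?_).comap_le)
  · intro j l hl
    have hq : (j, l) ∈ I := by
      simp only [hI, Finset.mem_erase, Finset.mem_product, Finset.mem_univ, Finset.mem_range,
        true_and, ne_eq, Prod.mk.injEq]
      omega
    exact ((measurable_pi_apply (⟨(j, l), hq⟩ : I)).comp measurable_fst).comp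
      (comap_measurable fun o => (A o, Y o))
  · intro j l _
    exact ((measurable_pi_apply (j, l)).comp measurable_snd).comp
      (comap_measurable fun o => (A o, Y o))
  · intro j hj
    have hq : (j, K) ∈ I := by
      simp [hI, hj]
    exact ((measurable_pi_apply (⟨(j, K), hq⟩ : I)).comp measurable_fst).comp
      (comap_measurable fun o => (A o, Y o))

/-- The seed `ζ i K` is independent of the past. -/
lemma IsSampling.indepFun_seed (h : IsSampling P D Q ξ ζ) (i : Fin n) (K : ℕ) {𝒮 : Type*}
    [MeasurableSpace 𝒮] {S : Ω → 𝒮}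
    (hS : ∀ m : MeasurableSpace Ω, (∀ j l, l < K → Measurable[m] (ξ j l)) →
      (∀ j l, l < K → Measurable[m] (ζ j l)) → Measurable[m] S) : IndepFun S (ζ i K) P := by
  classical
  -- Seeds are grouped by time step, because those of one step may be dependent across agents.
  set A : Ω → Finset.range K → Fin n → Z := fun o l j => ζ j l o with hA
  set Y : Ω → Fin n × ℕ → Ξ := fun o q => ξ q.1 q.2 o with hY
  have hAm : Measurable A :=
    measurable_pi_lambda _ fun q => measurable_pi_lambda _ fun j => h.measurable_seed _ _
  have hYm : Measurable Y := measurable_pi_lambda _ fun q => h.measurable_data _ _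
  have hAB : IndepFun A (ζ i K) P := by
    have h1 := h.indep_seed.indepFun_finset (Finset.range K) {K} (by simp)
      fun l => measurable_pi_lambda _ fun j => h.measurable_seed _ _
    exact h1.comp measurable_id ((measurable_pi_apply i).comp
      (measurable_pi_apply (⟨K, Finset.mem_singleton_self _⟩ : ({K} : Finset ℕ))))
  have hABY : IndepFun (fun o => (A o, ζ i K o)) Y P := by
    refine h.indep_data_seed.symm.comp
      (φ := fun w : Fin n × ℕ → Z =>
        ((fun (l : Finset.range K) (j : Fin n) => w (j, l)), w (i, K))) ?_ measurable_id
    exact (measurable_pi_lambda _ fun q => measurable_pi_lambda _ fun j =>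
      measurable_pi_apply _).prodMk (measurable_pi_apply _)
  have hind := indepFun_prodMk_regroup hAm (h.measurable_seed i K) hYm hAB hABY
  refine (IndepFun_iff_Indep _ _ _).mpr (indep_of_indep_of_le_left
    ((IndepFun_iff_Indep _ _ _).mp hind) (hS _ ?_ ?_).comap_le)
  · intro j l _
    exact ((measurable_pi_apply (j, l)).comp measurable_snd).comp
      (comap_measurable fun o => (A o, Y o))
  · intro j l hl
    exact ((measurable_pi_apply j).comp ((measurable_pi_apply
      (⟨l, Finset.mem_range.mpr hl⟩ : Finset.range K)).comp measurable_fst)).comp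
      (comap_measurable fun o => (A o, Y o))

end Indep

/-! ### Square-integrable random vectors -/

section SquareIntegrable

variable {Ω : Type*} [MeasurableSpace Ω] {P : Measure Ω}

lemma integrable_norm_sq_of_memLp {V : Type*} [NormedAddCommGroup V] {f : Ω → V} (hf : MemLp f 2 P) :
    Integrable (fun o => ‖f o‖ ^ 2) P :=
  (memLp_two_iff_integrable_sq_norm hf.1).mp hf

lemma integrable_inner_of_memLp {V : Type*} [NormedAddCommGroup V]
    [InnerProductSpace ℝ V] {f g : Ω → V} (hf : MemLp f 2 P) (hg : MemLp g 2 P) :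
    Integrable (fun o => inner ℝ (f o) (g o)) P := by
  refine ((integrable_norm_sq_of_memLp hf).add (integrable_norm_sq_of_memLp hg)).mono'
    (hf.1.inner hg.1) (Filter.Eventually.of_forall fun o => ?_)
  have h1 := norm_inner_le_norm (𝕜 := ℝ) (f o) (g o)
  have h2 : ‖f o‖ * ‖g o‖ ≤ ‖f o‖ ^ 2 + ‖g o‖ ^ 2 := by
    nlinarith [sq_nonneg (‖f o‖ - ‖g o‖), sq_nonneg ‖f o‖, sq_nonneg ‖g o‖]
  exact h1.trans h2

end SquareIntegrable

/-- The trajectory of the algorithm with constant parameters, as a random variable. -/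
def traj {n d : ℕ} {Ω Ξ Z : Type*} (W : Matrix (Fin n) (Fin n) ℝ) (F : Fin n → E d → Ξ → ℝ)
    (C : E d → Z → E d) (αx η γ ω h₀ : ℝ) (x₀ : Fin n → E d) (ξ : Fin n → ℕ → Ω → Ξ)
    (ζ : Fin n → ℕ → Ω → Z) (k : ℕ) (o : Ω) : State n d :=
  iterates W F C αx (fun _ => η) (fun _ => γ) (fun _ => ω) (fun k => h₀ ^ k) x₀
    (fun i k => ξ i k o) (fun i k => ζ i k o) k

section Trajectory

variable {n d : ℕ} {Ω Ξ Z : Type*} {W : Matrix (Fin n) (Fin n) ℝ} {F : Fin n → E d → Ξ → ℝ} {C : E d → Z → E d}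
  {αx η γ ω h₀ : ℝ} {x₀ : Fin n → E d} {ξ : Fin n → ℕ → Ω → Ξ} {ζ : Fin n → ℕ → Ω → Z}

/-- The estimate `x̂ j` of step `k`, as a random variable. -/
def trajHat (W : Matrix (Fin n) (Fin n) ℝ) (F : Fin n → E d → Ξ → ℝ)
    (C : E d → Z → E d) (αx η γ ω h₀ : ℝ) (x₀ : Fin n → E d) (ξ : Fin n → ℕ → Ω → Ξ)
    (ζ : Fin n → ℕ → Ω → Z) (k : ℕ) (o : Ω) (j : Fin n) : E d :=
  xhat C (h₀ ^ k) (traj W F C αx η γ ω h₀ x₀ ξ ζ k o) (fun i => ζ i k o) j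

lemma traj_succ_x (k : ℕ) (o : Ω) (i : Fin n) :
    (traj W F C αx η γ ω h₀ x₀ ξ ζ (k + 1) o).x i
      = (traj W F C αx η γ ω h₀ x₀ ξ ζ k o).x i
        - η • (γ • ∑ j, laplacian W i j • trajHat W F C αx η γ ω h₀ x₀ ξ ζ k o j
          + ω • (traj W F C αx η γ ω h₀ x₀ ξ ζ k o).v i
          + stochGrad F i ((traj W F C αx η γ ω h₀ x₀ ξ ζ k o).x i) (ξ i k o)) := rfl

lemma traj_succ_v (k : ℕ) (o : Ω) (i : Fin n) :
    (traj W F C αx η γ ω h₀ x₀ ξ ζ (k + 1) o).v i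
      = (traj W F C αx η γ ω h₀ x₀ ξ ζ k o).v i
        + (η * ω) • ∑ j, laplacian W i j • trajHat W F C αx η γ ω h₀ x₀ ξ ζ k o j := rfl

lemma traj_succ_xc (k : ℕ) (o : Ω) (i : Fin n) :
    (traj W F C αx η γ ω h₀ x₀ ξ ζ (k + 1) o).xc i
      = (1 - αx) • (traj W F C αx η γ ω h₀ x₀ ξ ζ k o).xc i
        + αx • trajHat W F C αx η γ ω h₀ x₀ ξ ζ k o i := rfl

/-- Zero column sums of the Laplacian preserve the initial value `0`; this removes the dual variable
from the dynamics of the average. -/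
lemma sum_v_traj (hW : W.IsSymm) (k : ℕ) (o : Ω) :
    ∑ i, (traj W F C αx η γ ω h₀ x₀ ξ ζ k o).v i = 0 := by
  induction k with
  | zero => simp [traj, iterates]
  | succ k ih =>
    simp only [traj_succ_v]
    rw [Finset.sum_add_distrib, ih, zero_add, ← Finset.smul_sum, Finset.sum_comm]
    simp [← Finset.sum_smul, sum_laplacian_col hW]

variable [mΩ : MeasurableSpace Ω] [MeasurableSpace Ξ] [MeasurableSpace Z]

/-- Only randomness of steps before `K` is required to be measurable. Taking a smaller σ-algebra for
`mΩ` then yields adaptedness. -/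
lemma measurable_traj (hF : ∀ i, Measurable fun q : E d × Ξ => stochGrad F i q.1 q.2)
    (hC : Measurable fun q : E d × Z => C q.1 q.2) {K : ℕ}
    (hξ : ∀ i l, l < K → Measurable (ξ i l)) (hζ : ∀ i l, l < K → Measurable (ζ i l)) :
    ∀ k ≤ K, ∀ i, Measurable (fun o => (traj W F C αx η γ ω h₀ x₀ ξ ζ k o).x i) ∧
      Measurable (fun o => (traj W F C αx η γ ω h₀ x₀ ξ ζ k o).v i) ∧
      Measurable (fun o => (traj W F C αx η γ ω h₀ x₀ ξ ζ k o).xc i) := by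
  intro k
  induction k with
  | zero =>
    intro _ i
    simp only [traj, iterates]
    exact ⟨measurable_const, measurable_const, measurable_const⟩
  | succ k ih =>
    intro hk
    have ih' := ih (by omega)
    have hxh : ∀ j, Measurable fun o => trajHat W F C αx η γ ω h₀ x₀ ξ ζ k o j := by
      intro j
      have h1 : Measurable fun o => (1 / h₀ ^ k) • ((traj W F C αx η γ ω h₀ x₀ ξ ζ k o).x j
          - (traj W F C αx η γ ω h₀ x₀ ξ ζ k o).xc j) :=
        ((ih' j).1.sub (ih' j).2.2).const_smul (1 / h₀ ^ k)
      have h2 : Measurable fun o => C ((1 / h₀ ^ k) • ((traj W F C αx η γ ω h₀ x₀ ξ ζ k o).x j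
          - (traj W F C αx η γ ω h₀ x₀ ξ ζ k o).xc j)) (ζ j k o) :=
        hC.comp (h1.prodMk (hζ j k (by omega)))
      exact (ih' j).2.2.add (h2.const_smul (h₀ ^ k))
    have hLx : ∀ i, Measurable fun o => ∑ j, laplacian W i j •
        trajHat W F C αx η γ ω h₀ x₀ ξ ζ k o j := fun i =>
      Finset.measurable_fun_sum _ fun j _ => (hxh j).const_smul (laplacian W i j)
    intro i
    have hG : Measurable fun o =>
        stochGrad F i ((traj W F C αx η γ ω h₀ x₀ ξ ζ k o).x i) (ξ i k o) :=
      (hF i).comp ((ih' i).1.prodMk (hξ i k (by omega)))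
    simp only [traj_succ_x, traj_succ_v, traj_succ_xc]
    exact ⟨(ih' i).1.sub (((((hLx i).const_smul γ).add ((ih' i).2.1.const_smul ω)).add
        hG).const_smul η), (ih' i).2.1.add ((hLx i).const_smul (η * ω)),
      ((ih' i).2.2.const_smul (1 - αx)).add ((hxh i).const_smul αx)⟩

end Trajectory

/-! ### Moments of the trajectory -/

/-- The standing assumptions on the problem, the compressor and the sampling. -/
structure Setting {n d : ℕ} {Ω Ξ Z : Type*} [MeasurableSpace Ω] [MeasurableSpace Ξ]
    [MeasurableSpace Z] (P : Measure Ω) (W : Matrix (Fin n) (Fin n) ℝ) (F : Fin n → E d → Ξ → ℝ)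
    (D : Fin n → Measure Ξ) (C : E d → Z → E d) (Q : Measure Z) (ξ : Fin n → ℕ → Ω → Ξ)
    (ζ : Fin n → ℕ → Ω → Z) (Lf σ φ r σC αx h₀ : ℝ) : Prop where
  n_ne : n ≠ 0
  symm : W.IsSymm
  wellPosed : WellPosed F D
  smooth : SmoothCosts F D Lf
  unbiased : UnbiasedBoundedVariance F D σ
  compressor : IsCompressor C Q φ r σC
  sampling : IsSampling P D Q ξ ζ
  r_pos : 0 < r
  αx_mem : αx ∈ Set.Ioo 0 (1 / r)
  h₀_pos : 0 < h₀

section LipschitzMemLp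

variable {Ω V V' : Type*} [MeasurableSpace Ω] {P : Measure Ω} [IsFiniteMeasure P]
  [NormedAddCommGroup V] [NormedAddCommGroup V']

lemma memLp_comp_of_lipschitz {f : V → V'} {K : ℝ} (hf : Continuous f)
    (hK : ∀ x y, ‖f x - f y‖ ≤ K * ‖x - y‖) {X : Ω → V} (hX : MemLp X 2 P) :
    MemLp (fun o => f (X o)) 2 P := by
  have hm : AEStronglyMeasurable (fun o => f (X o)) P := hf.comp_aestronglyMeasurable hX.1
  have h1 : MemLp (fun o => f (X o) - f 0) 2 P := by
    refine hX.of_le_mul (c := K) (hm.sub aestronglyMeasurable_const)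
      (Filter.Eventually.of_forall fun o => ?_)
    simpa using hK (X o) 0
  have h2 := h1.add (memLp_const (f 0) : MemLp (fun _ : Ω => f 0) 2 P)
  refine h2.ae_eq (Filter.Eventually.of_forall fun o => ?_)
  simp

end LipschitzMemLp

lemma UnbiasedBoundedVariance.integral_inner_eq_zero {n d : ℕ} {Ξ : Type*} [MeasurableSpace Ξ]
    {F : Fin n → E d → Ξ → ℝ} {D : Fin n → Measure Ξ} {σ : ℝ}
    (h : UnbiasedBoundedVariance F D σ) (hD : WellPosed F D) (i : Fin n) (x a : E d) :
    ∫ y, inner ℝ a (stochGrad F i x y - gradient (localCost F D i) x) ∂(D i) = 0 := by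
  obtain ⟨h1, h2, -, -⟩ := h i x
  have := hD.prob i
  generalize gradient (localCost F D i) x = c at *
  have h3 : Integrable (fun y => stochGrad F i x y - c) (D i) := h1.sub (integrable_const c)
  have h5 := integral_inner (𝕜 := ℝ) h3 a
  rw [h5, integral_sub h1 (integrable_const c), h2]
  simp

section Moments

variable {n d : ℕ} {Ω Ξ Z : Type*} [mΩ : MeasurableSpace Ω] [MeasurableSpace Ξ]
  [MeasurableSpace Z] {P : Measure Ω}
  {W : Matrix (Fin n) (Fin n) ℝ} {F : Fin n → E d → Ξ → ℝ} {D : Fin n → Measure Ξ}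
  {C : E d → Z → E d} {Q : Measure Z} {ξ : Fin n → ℕ → Ω → Ξ} {ζ : Fin n → ℕ → Ω → Z}
  {Lf σ φ r σC αx h₀ : ℝ} {η γ ω : ℝ} {x₀ : Fin n → E d}

local notation "𝔰" => traj W F C αx η γ ω h₀ x₀ ξ ζ
local notation "𝔥" => trajHat W F C αx η γ ω h₀ x₀ ξ ζ

/-- The gradient noise of agent `i` in step `k`. -/
def gradNoise (D : Fin n → Measure Ξ) (ξ : Fin n → ℕ → Ω → Ξ) (F : Fin n → E d → Ξ → ℝ)
    (s : ℕ → Ω → State n d) (k : ℕ) (o : Ω) (i : Fin n) : E d :=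
  stochGrad F i ((s k o).x i) (ξ i k o) - gradient (localCost F D i) ((s k o).x i)

local notation "𝔫" => gradNoise D ξ F (traj W F C αx η γ ω h₀ x₀ ξ ζ)

lemma Setting.measurable_of_past (H : Setting P W F D C Q ξ ζ Lf σ φ r σC αx h₀) (k : ℕ)
    (i : Fin n) : ∀ m : MeasurableSpace Ω, (∀ j l, l < k → Measurable[m] (ξ j l)) →
      (∀ j l, l < k → Measurable[m] (ζ j l)) →
      Measurable[m] (fun o => (𝔰 k o).x i) ∧ Measurable[m] (fun o => (𝔰 k o).v i) ∧
      Measurable[m] (fun o => (𝔰 k o).xc i) := by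
  have hF := H.wellPosed.measurable_grad
  have hC := H.compressor.measurable
  intro m hξ hζ
  exact measurable_traj (mΩ := m) hF hC hξ hζ k le_rfl i

lemma Setting.measurable (H : Setting P W F D C Q ξ ζ Lf σ φ r σC αx h₀) (k : ℕ) (i : Fin n) :
    Measurable (fun o => (𝔰 k o).x i) ∧ Measurable (fun o => (𝔰 k o).v i) ∧
      Measurable (fun o => (𝔰 k o).xc i) :=
  H.measurable_of_past k i mΩ (fun j l _ => H.sampling.measurable_data j l)
    (fun j l _ => H.sampling.measurable_seed j l)

lemma Setting.measurable_hat (H : Setting P W F D C Q ξ ζ Lf σ φ r σC αx h₀) (k : ℕ)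
    (j : Fin n) : Measurable (fun o => 𝔥 k o j) := by
  obtain ⟨hx, -, hxc⟩ := H.measurable (η := η) (γ := γ) (ω := ω) (x₀ := x₀) k j
  have h1 : Measurable fun o => (1 / h₀ ^ k) • ((𝔰 k o).x j - (𝔰 k o).xc j) :=
    (hx.sub hxc).const_smul (1 / h₀ ^ k)
  have h2 : Measurable fun o => C ((1 / h₀ ^ k) • ((𝔰 k o).x j - (𝔰 k o).xc j)) (ζ j k o) :=
    H.compressor.measurable.comp (h1.prodMk (H.sampling.measurable_seed j k))
  exact hxc.add (h2.const_smul (h₀ ^ k))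

lemma Setting.measurable_noise_map (H : Setting P W F D C Q ξ ζ Lf σ φ r σC αx h₀) (i : Fin n) :
    Measurable fun q : E d × Ξ => stochGrad F i q.1 q.2 - gradient (localCost F D i) q.1 :=
  (H.wellPosed.measurable_grad i).sub
    ((H.smooth.continuous_gradient i).measurable.comp measurable_fst)

lemma Setting.measurable_noise_of_past (H : Setting P W F D C Q ξ ζ Lf σ φ r σC αx h₀) (k : ℕ)
    (i : Fin n) : ∀ m : MeasurableSpace Ω, (∀ j l, l < k → Measurable[m] (ξ j l)) →
      (∀ j l, l < k → Measurable[m] (ζ j l)) → Measurable[m] (ξ i k) →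
      Measurable[m] (fun o => 𝔫 k o i) := by
  have h1 := H.measurable_of_past (η := η) (γ := γ) (ω := ω) (x₀ := x₀) k i
  have h2 := H.measurable_noise_map i
  intro m hξ hζ hi
  have h3 : Measurable[m] fun o => ((𝔰 k o).x i, ξ i k o) := (h1 m hξ hζ).1.prodMk hi
  have h4 := h2.comp h3
  exact h4

lemma Setting.measurable_noise (H : Setting P W F D C Q ξ ζ Lf σ φ r σC αx h₀) (k : ℕ)
    (i : Fin n) : Measurable (fun o => 𝔫 k o i) :=
  H.measurable_noise_of_past k i mΩ (fun j l _ => H.sampling.measurable_data j l)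
    (fun j l _ => H.sampling.measurable_seed j l) (H.sampling.measurable_data i k)

variable [IsProbabilityMeasure P]

/-- The second moment of the relative compression error. -/
lemma Setting.compression (H : Setting P W F D C Q ξ ζ Lf σ φ r σC αx h₀) {k : ℕ} {j : Fin n}
    (he : MemLp (fun o => (𝔰 k o).x j - (𝔰 k o).xc j) 2 P) :
    Integrable (fun o => ‖(1 / r) • (𝔥 k o j - (𝔰 k o).xc j)
      - ((𝔰 k o).x j - (𝔰 k o).xc j)‖ ^ 2) P ∧
    ∫ o, ‖(1 / r) • (𝔥 k o j - (𝔰 k o).xc j) - ((𝔰 k o).x j - (𝔰 k o).xc j)‖ ^ 2 ∂P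
      ≤ (1 - φ) * ∫ o, ‖(𝔰 k o).x j - (𝔰 k o).xc j‖ ^ 2 ∂P + (h₀ ^ k) ^ 2 * σC := by
  have hpast := H.measurable_of_past (η := η) (γ := γ) (ω := ω) (x₀ := x₀) k j
  have hind : IndepFun (fun o => (𝔰 k o).x j - (𝔰 k o).xc j) (ζ j k) P :=
    H.sampling.indepFun_seed j k fun m hξ hζ => (hpast m hξ hζ).1.sub (hpast m hξ hζ).2.2
  have hS : Measurable fun o => (𝔰 k o).x j - (𝔰 k o).xc j :=
    (H.measurable k j).1.sub (H.measurable k j).2.2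
  have hk : 0 < h₀ ^ k := pow_pos H.h₀_pos k
  have hmap : Measurable fun q : E d × Z =>
      ‖(1 / r) • (h₀ ^ k) • C ((1 / h₀ ^ k) • q.1) q.2 - q.1‖ ^ 2 := by
    have h1 : Measurable fun q : E d × Z => (1 / h₀ ^ k) • q.1 :=
      measurable_fst.const_smul (1 / h₀ ^ k)
    have h2 : Measurable fun q : E d × Z => C ((1 / h₀ ^ k) • q.1) q.2 :=
      H.compressor.measurable.comp (h1.prodMk measurable_snd)
    exact (((h2.const_smul (h₀ ^ k)).const_smul (1 / r)).sub measurable_fst).norm.pow_const 2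
  -- Scaling by `h₀ ^ k` keeps the relative part of the compression error and multiplies the
  -- absolute part `σC` by `(h₀ ^ k) ^ 2`.
  have hscale : ∀ (s : E d) (z : Z), ‖(1 / r) • (h₀ ^ k) • C ((1 / h₀ ^ k) • s) z - s‖ ^ 2
      = (h₀ ^ k) ^ 2 * ‖(1 / r) • C ((1 / h₀ ^ k) • s) z - (1 / h₀ ^ k) • s‖ ^ 2 := by
    intro s z
    have : (1 / r) • (h₀ ^ k) • C ((1 / h₀ ^ k) • s) z - s
        = (h₀ ^ k) • ((1 / r) • C ((1 / h₀ ^ k) • s) z - (1 / h₀ ^ k) • s) := by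
      rw [smul_sub, smul_comm, smul_smul (h₀ ^ k) (1 / h₀ ^ k), mul_one_div_cancel hk.ne', one_smul]
    rw [this, norm_smul, mul_pow, Real.norm_eq_abs, sq_abs]
  have hnorm := integrable_norm_sq_of_memLp he
  have hψ : Integrable (fun o => (1 - φ) * ‖(𝔰 k o).x j - (𝔰 k o).xc j‖ ^ 2
      + (h₀ ^ k) ^ 2 * σC) P := (hnorm.const_mul _).add (integrable_const _)
  obtain ⟨h1, h2⟩ := integrable_and_integral_le_of_fresh (Q := Q) hS
    (H.sampling.measurable_seed j k) hind
    (H.sampling.law_seed j k) hmap (fun _ => by positivity)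
    (ψ := fun s => (1 - φ) * ‖s‖ ^ 2 + (h₀ ^ k) ^ 2 * σC)
    ((measurable_norm.pow_const 2).const_mul _ |>.add_const _)
    (fun s => by simp only [hscale]; exact (H.compressor.integrable _).const_mul _)
    (fun s => by
      simp only [hscale]
      rw [integral_const_mul]
      have h3 := mul_le_mul_of_nonneg_left (H.compressor.bound ((1 / h₀ ^ k) • s))
        (sq_nonneg (h₀ ^ k))
      rw [norm_smul, mul_pow, Real.norm_eq_abs, sq_abs] at h3
      refine h3.trans (le_of_eq ?_)
      field_simp) hψ
  have e : ∀ o, (1 / r) • (𝔥 k o j - (𝔰 k o).xc j) = (1 / r) • (h₀ ^ k) •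
      C ((1 / h₀ ^ k) • ((𝔰 k o).x j - (𝔰 k o).xc j)) (ζ j k o) := by
    intro o
    simp [trajHat, xhat]
  simp only [e]
  refine ⟨h1, h2.trans (le_of_eq ?_)⟩
  rw [integral_add (hnorm.const_mul _) (integrable_const _), integral_const_mul]
  simp

lemma Setting.noise_sq (H : Setting P W F D C Q ξ ζ Lf σ φ r σC αx h₀) (k : ℕ) (i : Fin n) :
    Integrable (fun o => ‖𝔫 k o i‖ ^ 2) P ∧ ∫ o, ‖𝔫 k o i‖ ^ 2 ∂P ≤ σ ^ 2 := by
  have hpast := H.measurable_of_past (η := η) (γ := γ) (ω := ω) (x₀ := x₀) k i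
  have hind : IndepFun (fun o => (𝔰 k o).x i) (ξ i k) P :=
    H.sampling.indepFun_data i k fun m hξ hζ _ => (hpast m hξ hζ).1
  obtain ⟨h1, h2⟩ := integrable_and_integral_le_of_fresh (Q := D i) (H.measurable k i).1
    (H.sampling.measurable_data i k) hind
    (H.sampling.law_data i k)
    (f := fun q => ‖stochGrad F i q.1 q.2 - gradient (localCost F D i) q.1‖ ^ 2)
    (ψ := fun _ => σ ^ 2) ((H.measurable_noise_map i).norm.pow_const 2)
    (fun _ => by positivity) measurable_const (fun s => (H.unbiased i s).2.2.1)
    (fun s => (H.unbiased i s).2.2.2) (integrable_const _)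
  exact ⟨h1, h2.trans (le_of_eq (by simp))⟩

lemma Setting.memLp_noise (H : Setting P W F D C Q ξ ζ Lf σ φ r σC αx h₀) (k : ℕ) (i : Fin n) :
    MemLp (fun o => 𝔫 k o i) 2 P :=
  (memLp_two_iff_integrable_sq_norm (H.measurable_noise k i).aestronglyMeasurable).mpr
    (H.noise_sq k i).1

/-- The noise of agent `i` is orthogonal to everything determined before its datum is drawn. -/
lemma Setting.integral_inner_noise (H : Setting P W F D C Q ξ ζ Lf σ φ r σC αx h₀) {k : ℕ}
    {i : Fin n} {a : Ω → E d} (ha : Measurable a)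
    (hpa : ∀ m : MeasurableSpace Ω, (∀ j l, l < k → Measurable[m] (ξ j l)) →
      (∀ j l, l < k → Measurable[m] (ζ j l)) → (∀ j, j ≠ i → Measurable[m] (ξ j k)) →
      Measurable[m] a) (ha2 : MemLp a 2 P) :
    ∫ o, inner ℝ (a o) (𝔫 k o i) ∂P = 0 := by
  have hpast := H.measurable_of_past (η := η) (γ := γ) (ω := ω) (x₀ := x₀) k i
  -- The noise depends on the position as well as the datum, so `a` and `x i` are frozen jointly.
  have hind : IndepFun (fun o => (a o, (𝔰 k o).x i)) (ξ i k) P :=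
    H.sampling.indepFun_data i k fun m hξ hζ hj => (hpa m hξ hζ hj).prodMk (hpast m hξ hζ).1
  have hq : Measurable fun q : (E d × E d) × Ξ => (q.1.2, q.2) := by fun_prop
  have hg := (H.measurable_noise_map i).comp hq
  simp only [Function.comp_def] at hg
  have hf : Measurable fun q : (E d × E d) × Ξ =>
      inner ℝ q.1.1 (stochGrad F i q.1.2 q.2 - gradient (localCost F D i) q.1.2) :=
    Measurable.inner (by fun_prop) hg
  have hint := integrable_inner_of_memLp ha2 (H.memLp_noise (η := η) (γ := γ) (ω := ω)
    (x₀ := x₀) k i)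
  have hmean : ∀ s : E d × E d, ∫ y, inner ℝ s.1
      (stochGrad F i s.2 y - gradient (localCost F D i) s.2) ∂(D i) = 0 := fun s =>
    H.unbiased.integral_inner_eq_zero H.wellPosed i s.2 s.1
  simp only [gradNoise] at hint ⊢
  have key := integral_eq_zero_of_fresh (ha.prodMk (H.measurable k i).1)
    (H.sampling.measurable_data i k) hind (H.sampling.law_data i k) hf
  beta_reduce at key
  exact key hmean hint

/-- With `e = x - xc` and `ρ` the relative compression error, `x̂ = xc + r • (ρ + e)`. -/
lemma Setting.memLp_hat_of (H : Setting P W F D C Q ξ ζ Lf σ φ r σC αx h₀) {k : ℕ} {j : Fin n}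
    (hx2 : MemLp (fun o => (𝔰 k o).x j) 2 P) (hxc2 : MemLp (fun o => (𝔰 k o).xc j) 2 P) :
    MemLp (fun o => (1 / r) • (𝔥 k o j - (𝔰 k o).xc j)
        - ((𝔰 k o).x j - (𝔰 k o).xc j)) 2 P ∧ MemLp (fun o => 𝔥 k o j) 2 P := by
  have he := hx2.sub hxc2
  have h1 := H.compression (j := j) he
  have hm : AEStronglyMeasurable (fun o => (1 / r) • (𝔥 k o j - (𝔰 k o).xc j)
      - ((𝔰 k o).x j - (𝔰 k o).xc j)) P := by
    obtain ⟨hx, -, hxc⟩ := H.measurable (η := η) (γ := γ) (ω := ω) (x₀ := x₀) k j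
    exact ((((H.measurable_hat k j).sub hxc).const_smul (1 / r)).sub
      (hx.sub hxc)).aestronglyMeasurable
  have h0 := (memLp_two_iff_integrable_sq_norm hm).mpr h1.1
  refine ⟨h0, ?_⟩
  have h2 := (h0.add he).const_smul r
  refine (h2.add hxc2).ae_eq (Filter.Eventually.of_forall fun o => ?_)
  have hr := H.r_pos.ne'
  simp only [Pi.add_apply, Pi.smul_apply, Pi.sub_apply, sub_add_cancel]
  rw [smul_smul, mul_one_div_cancel hr, one_smul, sub_add_cancel]

/-- Qualitative only: finite second moments at each step justify splitting the expectations later.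
Growth in `k` plays no role. -/
lemma Setting.memLp (H : Setting P W F D C Q ξ ζ Lf σ φ r σC αx h₀) (k : ℕ) : ∀ i : Fin n,
    MemLp (fun o => (𝔰 k o).x i) 2 P ∧ MemLp (fun o => (𝔰 k o).v i) 2 P ∧
      MemLp (fun o => (𝔰 k o).xc i) 2 P := by
  induction k with
  | zero =>
    intro i
    simp only [traj, iterates]
    exact ⟨memLp_const _, memLp_const _, memLp_const _⟩
  | succ k ih =>
    have hhat : ∀ j, MemLp (fun o => 𝔥 k o j) 2 P := fun j =>
      (H.memLp_hat_of (ih j).1 (ih j).2.2).2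
    have hLx : ∀ i, MemLp (fun o => ∑ j, laplacian W i j • 𝔥 k o j) 2 P := fun i =>
      memLp_finsetSum _ fun j _ => (hhat j).const_smul (laplacian W i j)
    intro i
    have hG : MemLp (fun o => stochGrad F i ((𝔰 k o).x i) (ξ i k o)) 2 P := by
      have h1 := memLp_comp_of_lipschitz (H.smooth.continuous_gradient i) (H.smooth i).2 (ih i).1
      refine ((H.memLp_noise (η := η) (γ := γ) (ω := ω) (x₀ := x₀) k i).add h1).ae_eq (Filter.Eventually.of_forall fun o => ?_)
      simp [gradNoise]
    simp only [traj_succ_x, traj_succ_v, traj_succ_xc]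
    exact ⟨(ih i).1.sub (((((hLx i).const_smul γ).add ((ih i).2.1.const_smul ω)).add
        hG).const_smul η), (ih i).2.1.add ((hLx i).const_smul (η * ω)),
      ((ih i).2.2.const_smul (1 - αx)).add ((hhat i).const_smul αx)⟩

end Moments

/-! ### The recursions in expectation -/

section Recursions

variable {n d : ℕ} {Ω Ξ Z : Type*} [mΩ : MeasurableSpace Ω] [MeasurableSpace Ξ]
  [MeasurableSpace Z] {P : Measure Ω}
  {W : Matrix (Fin n) (Fin n) ℝ} {F : Fin n → E d → Ξ → ℝ} {D : Fin n → Measure Ξ}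
  {C : E d → Z → E d} {Q : Measure Z} {ξ : Fin n → ℕ → Ω → Ξ} {ζ : Fin n → ℕ → Ω → Z}
  {Lf σ φ r σC αx h₀ : ℝ} {η γ ω : ℝ} {x₀ : Fin n → E d}

local notation "𝔰" => traj W F C αx η γ ω h₀ x₀ ξ ζ
local notation "𝔥" => trajHat W F C αx η γ ω h₀ x₀ ξ ζ
local notation "𝔫" => gradNoise D ξ F (traj W F C αx η γ ω h₀ x₀ ξ ζ)

lemma memLp_avg {x : Ω → Fin n → E d} (hx : ∀ i, MemLp (fun o => x o i) 2 P) :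
    MemLp (fun o => avg (x o)) 2 P :=
  (memLp_finsetSum Finset.univ fun i _ => hx i).const_smul (1 / (n : ℝ))

lemma memLp_mode {b : Fin n → Fin n → ℝ} {x : Ω → Fin n → E d}
    (hx : ∀ i, MemLp (fun o => x o i) 2 P) (m : Fin n) : MemLp (fun o => mode b (x o) m) 2 P :=
  memLp_finsetSum Finset.univ fun i _ => (hx i).const_smul (b m i)

lemma integrable_consensusForm {B : ℝ} {b : Fin n → Fin n → ℝ} {ℓ : Fin n → ℝ}
    {x u : Ω → Fin n → E d} (hx : ∀ i, MemLp (fun o => x o i) 2 P)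
    (hu : ∀ i, MemLp (fun o => u o i) 2 P) :
    Integrable (fun o => consensusForm B b ℓ (x o) (u o)) P := by
  refine integrable_finsetSum _ fun m _ => ?_
  exact (((integrable_norm_sq_of_memLp (memLp_mode hx m)).div_const 2).add
    ((integrable_norm_sq_of_memLp (memLp_mode hu m)).const_mul _)).add
    ((integrable_inner_of_memLp (memLp_mode hx m) (memLp_mode hu m)).const_mul _)

/-- The mean of the local gradients at the agents' positions. -/
def meanGrad (F : Fin n → E d → Ξ → ℝ) (D : Fin n → Measure Ξ) (x : Fin n → E d) : E d :=
  avg fun i => gradient (localCost F D i) (x i)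

/-- Summing over agents kills the Laplacian term and the dual variable, so compression errors never
reach the average directly. -/
lemma Setting.avg_succ (H : Setting P W F D C Q ξ ζ Lf σ φ r σC αx h₀) (k : ℕ) (o : Ω) :
    avg (𝔰 (k + 1) o).x
      = avg (𝔰 k o).x - η • (meanGrad F D (𝔰 k o).x + avg (𝔫 k o)) := by
  have h1 : ∑ i, (𝔰 (k + 1) o).x i = ∑ i, (𝔰 k o).x i
      - η • (∑ i, gradient (localCost F D i) ((𝔰 k o).x i) + ∑ i, 𝔫 k o i) := by
    simp only [traj_succ_x]
    rw [Finset.sum_sub_distrib, ← Finset.smul_sum, Finset.sum_add_distrib,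
      Finset.sum_add_distrib, ← Finset.smul_sum, ← Finset.smul_sum, sum_v_traj H.symm,
      Finset.sum_comm]
    simp [← Finset.sum_smul, sum_laplacian_col H.symm, gradNoise]
  rw [avg, h1, avg, meanGrad, avg, avg]
  module

variable [IsProbabilityMeasure P]

/-- From `x̂ - x = r • ρ - (1 - r) • e`, with `ρ` the relative compression error and `e = x - xc`;
the coefficient that results is `r₀`. -/
lemma Setting.hat_error (H : Setting P W F D C Q ξ ζ Lf σ φ r σC αx h₀) (k : ℕ) (j : Fin n) :
    ∫ o, ‖𝔥 k o j - (𝔰 k o).x j‖ ^ 2 ∂P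
      ≤ (2 * r ^ 2 * (1 - φ) + 2 * (1 - r) ^ 2) * ∫ o, ‖(𝔰 k o).x j - (𝔰 k o).xc j‖ ^ 2 ∂P
        + 2 * r ^ 2 * σC * (h₀ ^ k) ^ 2 := by
  have hr := H.r_pos
  obtain ⟨hx, -, hxc⟩ := H.memLp (η := η) (γ := γ) (ω := ω) (x₀ := x₀) k j
  have hρ := H.memLp_hat_of hx hxc
  have he : MemLp (fun o => (𝔰 k o).x j - (𝔰 k o).xc j) 2 P := hx.sub hxc
  have hρi := integrable_norm_sq_of_memLp hρ.1
  have hei := integrable_norm_sq_of_memLp he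
  have hcomp := (H.compression he).2
  have hpt : ∀ o, ‖𝔥 k o j - (𝔰 k o).x j‖ ^ 2
      ≤ 2 * r ^ 2 * ‖(1 / r) • (𝔥 k o j - (𝔰 k o).xc j) - ((𝔰 k o).x j - (𝔰 k o).xc j)‖ ^ 2
        + 2 * (1 - r) ^ 2 * ‖(𝔰 k o).x j - (𝔰 k o).xc j‖ ^ 2 := by
    intro o
    have e : 𝔥 k o j - (𝔰 k o).x j
        = r • ((1 / r) • (𝔥 k o j - (𝔰 k o).xc j) - ((𝔰 k o).x j - (𝔰 k o).xc j))
          + (-(1 - r)) • ((𝔰 k o).x j - (𝔰 k o).xc j) := by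
      rw [smul_sub, smul_smul, mul_one_div_cancel hr.ne']
      module
    rw [e]
    refine (norm_add_sq_le_young one_pos _ _).trans (le_of_eq ?_)
    rw [norm_smul, norm_smul, mul_pow, mul_pow, norm_neg, Real.norm_eq_abs, Real.norm_eq_abs,
      sq_abs, sq_abs]
    ring
  have h1 := integral_mono (integrable_norm_sq_of_memLp (hρ.2.sub hx))
    ((hρi.const_mul (2 * r ^ 2)).add (hei.const_mul (2 * (1 - r) ^ 2))) hpt
  simp only [Pi.add_apply, Pi.sub_apply] at h1
  rw [integral_add (hρi.const_mul _) (hei.const_mul _), integral_const_mul,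
    integral_const_mul] at h1
  have h2 := mul_le_mul_of_nonneg_left hcomp (by positivity : 0 ≤ 2 * r ^ 2)
  linarith

/-- Since `αx * r < 1`, the new error `(1 - αx r) • e - (αx r) • ρ` is a convex combination of `e`
and `-ρ`. Convexity of the squared norm gives `αx r (1 - φ) + (1 - αx r) = 1 - αx r φ`. -/
lemma Setting.reference_error (H : Setting P W F D C Q ξ ζ Lf σ φ r σC αx h₀) (k : ℕ)
    (j : Fin n) :
    ∫ o, ‖(𝔰 k o).x j - (𝔰 (k + 1) o).xc j‖ ^ 2 ∂P
      ≤ (1 - αx * r * φ) * ∫ o, ‖(𝔰 k o).x j - (𝔰 k o).xc j‖ ^ 2 ∂P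
        + αx * r * σC * (h₀ ^ k) ^ 2 := by
  have hr := H.r_pos
  have hα := H.αx_mem.1
  have hαr : αx * r < 1 := by
    have := H.αx_mem.2
    rwa [lt_div_iff₀ hr] at this
  obtain ⟨hx, -, hxc⟩ := H.memLp (η := η) (γ := γ) (ω := ω) (x₀ := x₀) k j
  obtain ⟨-, -, hxc'⟩ := H.memLp (η := η) (γ := γ) (ω := ω) (x₀ := x₀) (k + 1) j
  have hρ := H.memLp_hat_of hx hxc
  have he : MemLp (fun o => (𝔰 k o).x j - (𝔰 k o).xc j) 2 P := hx.sub hxc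
  have hρi := integrable_norm_sq_of_memLp hρ.1
  have hei := integrable_norm_sq_of_memLp he
  have hcomp := (H.compression he).2
  have hpt : ∀ o, ‖(𝔰 k o).x j - (𝔰 (k + 1) o).xc j‖ ^ 2
      ≤ αx * r * ‖(1 / r) • (𝔥 k o j - (𝔰 k o).xc j) - ((𝔰 k o).x j - (𝔰 k o).xc j)‖ ^ 2
        + (1 - αx * r) * ‖(𝔰 k o).x j - (𝔰 k o).xc j‖ ^ 2 := by
    intro o
    set e := (𝔰 k o).x j - (𝔰 k o).xc j with he'
    set ρ := (1 / r) • (𝔥 k o j - (𝔰 k o).xc j) - e with hρ'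
    have e1 : (𝔰 k o).x j - (𝔰 (k + 1) o).xc j = (1 - αx * r) • e - (αx * r) • ρ := by
      have e2 : (αx * r) • ρ = αx • (𝔥 k o j - (𝔰 k o).xc j) - (αx * r) • e := by
        rw [hρ', smul_sub, smul_smul, mul_assoc, mul_one_div_cancel hr.ne', mul_one]
      rw [traj_succ_xc, e2, he']
      module
    have h0 : 0 ≤ αx * r * (1 - αx * r) * ‖e + ρ‖ ^ 2 := by
      have : 0 ≤ 1 - αx * r := by linarith
      positivity
    rw [e1, norm_sub_sq_real, norm_smul, norm_smul, mul_pow, mul_pow, Real.norm_eq_abs,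
      Real.norm_eq_abs, sq_abs, sq_abs, real_inner_smul_left, real_inner_smul_right]
    rw [norm_add_sq_real] at h0
    linarith
  have h1 := integral_mono (integrable_norm_sq_of_memLp (hx.sub hxc'))
    ((hρi.const_mul (αx * r)).add (hei.const_mul (1 - αx * r))) hpt
  simp only [Pi.add_apply, Pi.sub_apply] at h1
  rw [integral_add (hρi.const_mul _) (hei.const_mul _), integral_const_mul,
    integral_const_mul] at h1
  have h2 := mul_le_mul_of_nonneg_left hcomp (by positivity : 0 ≤ αx * r)
  linarith

/-- Averaging the independent noises divides the variance by `n`. -/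
lemma Setting.avg_noise_sq (H : Setting P W F D C Q ξ ζ Lf σ φ r σC αx h₀) (k : ℕ) :
    ∫ o, ‖avg (𝔫 k o)‖ ^ 2 ∂P ≤ σ ^ 2 / n := by
  have hn : (0 : ℝ) < n := by
    have := H.n_ne
    positivity
  have hN := fun i => H.memLp_noise (η := η) (γ := γ) (ω := ω) (x₀ := x₀) k i
  have hoff : ∀ i j, i ≠ j → ∫ o, inner ℝ (𝔫 k o i) (𝔫 k o j) ∂P = 0 := by
    intro i j hij
    have hp := H.measurable_noise_of_past (η := η) (γ := γ) (ω := ω) (x₀ := x₀) k i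
    -- Noise `i` is determined before datum `j ≠ i` is drawn, so it can serve as the test vector for
    -- noise `j`.
    exact H.integral_inner_noise (H.measurable_noise k i)
      (fun m hξ hζ hj => hp m hξ hζ (hj i hij)) (hN i)
  have e : ∀ o, ‖avg (𝔫 k o)‖ ^ 2
      = (1 / (n : ℝ)) ^ 2 * ∑ i, ∑ j, inner ℝ (𝔫 k o i) (𝔫 k o j) := by
    intro o
    rw [avg, norm_smul, mul_pow, Real.norm_eq_abs, sq_abs, ← real_inner_self_eq_norm_sq,
      sum_inner]
    simp only [inner_sum]
  have hint : ∀ i j, Integrable (fun o => inner ℝ (𝔫 k o i) (𝔫 k o j)) P := fun i j =>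
    integrable_inner_of_memLp (hN i) (hN j)
  simp only [e]
  rw [integral_const_mul, integral_finsetSum _ fun i _ => integrable_finsetSum _ fun j _ => hint i j]
  have h1 : ∀ i, ∫ o, ∑ j, inner ℝ (𝔫 k o i) (𝔫 k o j) ∂P ≤ σ ^ 2 := by
    intro i
    rw [integral_finsetSum _ fun j _ => hint i j, Finset.sum_eq_single i
      (fun j _ hj => hoff i j (Ne.symm hj)) (fun h => absurd (Finset.mem_univ i) h)]
    simp only [real_inner_self_eq_norm_sq]
    exact (H.noise_sq k i).2
  have h2 := Finset.sum_le_sum fun i (_ : i ∈ Finset.univ) => h1 i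
  rw [Finset.sum_const, Finset.card_univ, Fintype.card_fin, nsmul_eq_mul] at h2
  calc _ ≤ (1 / (n : ℝ)) ^ 2 * (n * σ ^ 2) := by gcongr
    _ = _ := by field_simp

lemma Setting.integral_inner_avg_noise (H : Setting P W F D C Q ξ ζ Lf σ φ r σC αx h₀) {k : ℕ}
    {a : Ω → E d} (ha : Measurable a)
    (hpa : ∀ m : MeasurableSpace Ω, (∀ j l, l < k → Measurable[m] (ξ j l)) →
      (∀ j l, l < k → Measurable[m] (ζ j l)) → Measurable[m] a) (ha2 : MemLp a 2 P) :
    ∫ o, inner ℝ (a o) (avg (𝔫 k o)) ∂P = 0 := by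
  have hN := fun i => H.memLp_noise (η := η) (γ := γ) (ω := ω) (x₀ := x₀) k i
  simp only [avg, real_inner_smul_right, inner_sum]
  rw [integral_const_mul, integral_finsetSum _ fun i _ => integrable_inner_of_memLp ha2 (hN i),
    Finset.sum_eq_zero fun i _ =>
      H.integral_inner_noise ha (fun m hξ hζ _ => hpa m hξ hζ) ha2, mul_zero]

end Recursions

section Recursions

variable {n d : ℕ} {Ω Ξ Z : Type*} [mΩ : MeasurableSpace Ω] [MeasurableSpace Ξ]
  [MeasurableSpace Z] {P : Measure Ω}
  {W : Matrix (Fin n) (Fin n) ℝ} {F : Fin n → E d → Ξ → ℝ} {D : Fin n → Measure Ξ}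
  {C : E d → Z → E d} {Q : Measure Z} {ξ : Fin n → ℕ → Ω → Ξ} {ζ : Fin n → ℕ → Ω → Z}
  {Lf σ φ r σC αx h₀ : ℝ} {η γ ω : ℝ} {x₀ : Fin n → E d}

local notation "𝔰" => traj W F C αx η γ ω h₀ x₀ ξ ζ
local notation "𝔥" => trajHat W F C αx η γ ω h₀ x₀ ξ ζ
local notation "𝔫" => gradNoise D ξ F (traj W F C αx η γ ω h₀ x₀ ξ ζ)

/-- The dual variable corrected by the local gradients at the average. -/
def corrDual (F : Fin n → E d → Ξ → ℝ) (D : Fin n → Measure Ξ) (ω : ℝ) (s : State n d)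
    (i : Fin n) : E d :=
  s.v i + (1 / ω) • gradient (localCost F D i) (avg s.x)

/-- The Lyapunov function of the consensus and compression errors. -/
def lyap (F : Fin n → E d → Ξ → ℝ) (D : Fin n → Measure Ξ) (B ω : ℝ) (b : Fin n → Fin n → ℝ)
    (ℓ : Fin n → ℝ) (s : State n d) : ℝ :=
  consensusForm B b ℓ s.x (corrDual F D ω s) + ∑ i, ‖s.x i - s.xc i‖ ^ 2

/-- The optimality gap at the average. -/
def gap (F : Fin n → E d → Ξ → ℝ) (D : Fin n → Measure Ξ) (s : State n d) : ℝ :=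
  globalCost F D (avg s.x) - optimalValue F D

lemma Setting.sum_gradient_deviation_le (H : Setting P W F D C Q ξ ζ Lf σ φ r σC αx h₀)
    (k : ℕ) (o : Ω) :
    ∑ i, ‖stochGrad F i ((𝔰 k o).x i) (ξ i k o) - gradient (localCost F D i) (avg (𝔰 k o).x)‖ ^ 2
      ≤ 2 * Lf ^ 2 * ∑ i, ‖(𝔰 k o).x i - avg (𝔰 k o).x‖ ^ 2 + 2 * ∑ i, ‖𝔫 k o i‖ ^ 2 := by
  rw [Finset.mul_sum, Finset.mul_sum, ← Finset.sum_add_distrib]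
  refine Finset.sum_le_sum fun i _ => ?_
  have h1 := norm_add_sq_le_young one_pos
    (gradient (localCost F D i) ((𝔰 k o).x i) - gradient (localCost F D i) (avg (𝔰 k o).x))
    (𝔫 k o i)
  have e : gradient (localCost F D i) ((𝔰 k o).x i)
      - gradient (localCost F D i) (avg (𝔰 k o).x) + 𝔫 k o i
      = stochGrad F i ((𝔰 k o).x i) (ξ i k o) - gradient (localCost F D i) (avg (𝔰 k o).x) := by
    rw [gradNoise]
    abel
  rw [e] at h1
  have h2 := pow_le_pow_left₀ (norm_nonneg _) ((H.smooth i).2 ((𝔰 k o).x i) (avg (𝔰 k o).x)) 2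
  rw [mul_pow] at h2
  linarith

variable [IsProbabilityMeasure P]

lemma Setting.memLp_avg_x (H : Setting P W F D C Q ξ ζ Lf σ φ r σC αx h₀) (k : ℕ) :
    MemLp (fun o => avg (𝔰 k o).x) 2 P :=
  memLp_avg fun i => (H.memLp k i).1

lemma Setting.memLp_corrDual (H : Setting P W F D C Q ξ ζ Lf σ φ r σC αx h₀) (k : ℕ)
    (i : Fin n) : MemLp (fun o => corrDual F D ω (𝔰 k o) i) 2 P := by
  have h := memLp_comp_of_lipschitz (H.smooth.continuous_gradient i) (H.smooth i).2
    (H.memLp_avg_x (η := η) (γ := γ) (ω := ω) (x₀ := x₀) k)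
  exact (H.memLp k i).2.1.add (h.const_smul (1 / ω))

lemma Setting.memLp_err (H : Setting P W F D C Q ξ ζ Lf σ φ r σC αx h₀) (k : ℕ) (i : Fin n) :
    MemLp (fun o => (𝔰 k o).x i - (𝔰 k o).xc i) 2 P :=
  (H.memLp k i).1.sub (H.memLp k i).2.2

lemma Setting.memLp_disagreement (H : Setting P W F D C Q ξ ζ Lf σ φ r σC αx h₀) (k : ℕ)
    (i : Fin n) : MemLp (fun o => (𝔰 k o).x i - avg (𝔰 k o).x) 2 P :=
  (H.memLp k i).1.sub (H.memLp_avg_x k)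

lemma Setting.integrable_consensus (H : Setting P W F D C Q ξ ζ Lf σ φ r σC αx h₀) (B : ℝ)
    (b : Fin n → Fin n → ℝ) (ℓ : Fin n → ℝ) (k : ℕ) :
    Integrable (fun o => consensusForm B b ℓ (𝔰 k o).x (corrDual F D ω (𝔰 k o))) P :=
  integrable_consensusForm (fun i => (H.memLp k i).1) (H.memLp_corrDual k)

lemma Setting.integrable_err (H : Setting P W F D C Q ξ ζ Lf σ φ r σC αx h₀) (k : ℕ) :
    Integrable (fun o => ∑ i, ‖(𝔰 k o).x i - (𝔰 k o).xc i‖ ^ 2) P :=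
  integrable_finsetSum _ fun i _ => integrable_norm_sq_of_memLp (H.memLp_err k i)

lemma Setting.integrable_lyap (H : Setting P W F D C Q ξ ζ Lf σ φ r σC αx h₀) (B : ℝ)
    (b : Fin n → Fin n → ℝ) (ℓ : Fin n → ℝ) (k : ℕ) :
    Integrable (fun o => lyap F D B ω b ℓ (𝔰 k o)) P :=
  (H.integrable_consensus B b ℓ k).add (H.integrable_err k)

lemma Setting.integrable_gap (H : Setting P W F D C Q ξ ζ Lf σ φ r σC αx h₀)
    (hbdd : BddBelow (Set.range (globalCost F D))) (k : ℕ) :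
    Integrable (fun o => gap F D (𝔰 k o)) P := by
  have hx := H.memLp_avg_x (η := η) (γ := γ) (ω := ω) (x₀ := x₀) k
  have hdiff := H.smooth.differentiable_globalCost
  have hb : Integrable (fun o => globalCost F D 0 - optimalValue F D
      + inner ℝ (gradient (globalCost F D) 0) (avg (𝔰 k o).x)
      + Lf / 2 * ‖avg (𝔰 k o).x‖ ^ 2) P :=
    ((integrable_const _).add (integrable_inner_of_memLp (memLp_const _) hx)).add
      ((integrable_norm_sq_of_memLp hx).const_mul _)
  refine hb.mono' ((hdiff.continuous.comp_aestronglyMeasurable hx.1).sub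
    aestronglyMeasurable_const) (Filter.Eventually.of_forall fun o => ?_)
  have h1 := descent_lemma hdiff (H.smooth.lipschitz_globalCost H.n_ne) 0 (avg (𝔰 k o).x)
  have h2 := optimalValue_le hbdd (avg (𝔰 k o).x)
  rw [sub_zero] at h1
  rw [gap, Real.norm_of_nonneg (by linarith)]
  linarith

/-- The expected Lyapunov function contracts up to the noise, the gradient at the average and
the absolute compression error. -/
theorem Setting.lyap_step {β B lam Lam κ : ℝ} {b : Fin n → Fin n → ℝ} {ℓ : Fin n → ℝ}
    (H : Setting P W F D C Q ξ ζ Lf σ φ r σC αx h₀)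
    (hc : IsContractive β B lam Lam (αx * r * φ) κ)
    (hb : IsModalBasis (laplacian W) lam Lam b ℓ) (hLf : 0 < Lf)
    (hbdd : BddBelow (Set.range (globalCost F D)))
    (hR : errWeight β B Lam (αx * r * φ) * (2 * r ^ 2 * (1 - φ) + 2 * (1 - r) ^ 2)
      + (1 + αx * r * φ / 2) * (1 - αx * r * φ) ≤ 1 - κ)
    (hω : 0 < ω) (hη : η = β / ω) (hη1 : η ≤ 1) (hγ : γ = B * ω) (k : ℕ) :
    ∫ o, lyap F D B ω b ℓ (𝔰 (k + 1) o) ∂P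
      ≤ (1 - κ ^ 2) * ∫ o, lyap F D B ω b ℓ (𝔰 k o) ∂P
        + η ^ 2 * pertWeight β B lam (αx * r * φ) Lf κ
          * (n * (2 * Lf * ∫ o, gap F D (𝔰 k o) ∂P)
            + 8 * Lf ^ 2 * ∫ o, lyap F D B ω b ℓ (𝔰 k o) ∂P + 2 * (n * σ ^ 2))
        + n * ((1 + κ) * σC * (errWeight β B Lam (αx * r * φ) * (2 * r ^ 2)
          + (1 + αx * r * φ / 2) * (αx * r))) * (h₀ ^ k) ^ 2 := by
  set φ₁ := αx * r * φ with hφ₁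
  set R := errWeight β B Lam φ₁ with hRdef
  set pw := pertWeight β B lam φ₁ Lf κ with hpw
  have hpw0 : 0 ≤ pw := pertWeight_nonneg hc
  have hκ := hc.κ_pos
  have hφ₁0 := hc.φ₁_pos
  have hR0 : 0 ≤ R := by
    have := hc.lam_pos.trans_le hc.lam_le
    have := hc.one_le_B
    have := hc.β_pos
    rw [hRdef, errWeight]
    positivity
  subst hγ
  have hΦ := H.integrable_consensus (η := η) (γ := B * ω) (ω := ω) (x₀ := x₀) B b ℓ k
  have hE := H.integrable_err (η := η) (γ := B * ω) (ω := ω) (x₀ := x₀) k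
  have hV := H.integrable_lyap (η := η) (γ := B * ω) (ω := ω) (x₀ := x₀) B b ℓ k
  have hG := H.integrable_gap (η := η) (γ := B * ω) (ω := ω) (x₀ := x₀) hbdd k
  have hmem := fun i => H.memLp (η := η) (γ := B * ω) (ω := ω) (x₀ := x₀) k i
  have hmem' := fun i => H.memLp (η := η) (γ := B * ω) (ω := ω) (x₀ := x₀) (k + 1) i
  have hhat := fun i => (H.memLp_hat_of (hmem i).1 (hmem i).2.2).2
  have hδi : ∀ i, Integrable (fun o => ‖trajHat W F C αx η (B * ω) ω h₀ x₀ ξ ζ k o i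
      - (traj W F C αx η (B * ω) ω h₀ x₀ ξ ζ k o).x i‖ ^ 2) P := fun i =>
    integrable_norm_sq_of_memLp ((hhat i).sub (hmem i).1)
  have hci : ∀ i, Integrable (fun o => ‖(traj W F C αx η (B * ω) ω h₀ x₀ ξ ζ k o).x i
      - (traj W F C αx η (B * ω) ω h₀ x₀ ξ ζ (k + 1) o).xc i‖ ^ 2) P := fun i =>
    integrable_norm_sq_of_memLp ((hmem i).1.sub (hmem' i).2.2)
  have hNi := fun i => (H.noise_sq (η := η) (γ := B * ω) (ω := ω) (x₀ := x₀) k i).1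
  set Φ : Ω → ℝ := fun o => consensusForm B b ℓ (traj W F C αx η (B * ω) ω h₀ x₀ ξ ζ k o).x
    (corrDual F D ω (traj W F C αx η (B * ω) ω h₀ x₀ ξ ζ k o)) with hΦdef
  set e : Ω → ℝ := fun o => ∑ i, ‖(traj W F C αx η (B * ω) ω h₀ x₀ ξ ζ k o).x i
    - (traj W F C αx η (B * ω) ω h₀ x₀ ξ ζ k o).xc i‖ ^ 2 with hedef
  set δ : Ω → ℝ := fun o => ∑ i, ‖trajHat W F C αx η (B * ω) ω h₀ x₀ ξ ζ k o i
      - (traj W F C αx η (B * ω) ω h₀ x₀ ξ ζ k o).x i‖ ^ 2 with hδdef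
  set c : Ω → ℝ := fun o => ∑ i, ‖(traj W F C αx η (B * ω) ω h₀ x₀ ξ ζ k o).x i
      - (traj W F C αx η (B * ω) ω h₀ x₀ ξ ζ (k + 1) o).xc i‖ ^ 2 with hcdef
  set N : Ω → ℝ := fun o => ∑ i, ‖gradNoise D ξ F (traj W F C αx η (B * ω) ω h₀ x₀ ξ ζ) k o i‖ ^ 2
    with hNdef
  set V : Ω → ℝ := fun o => lyap F D B ω b ℓ (traj W F C αx η (B * ω) ω h₀ x₀ ξ ζ k o) with hVdef
  set g : Ω → ℝ := fun o => gap F D (traj W F C αx η (B * ω) ω h₀ x₀ ξ ζ k o) with hgdef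
  have hδI : Integrable δ P := integrable_finsetSum _ fun i _ => hδi i
  have hcI : Integrable c P := integrable_finsetSum _ fun i _ => hci i
  have hNI : Integrable N P := integrable_finsetSum _ fun i _ => hNi i
  have hVe : ∀ o, V o = Φ o + e o := fun o => rfl
  have hpt : ∀ o, lyap F D B ω b ℓ (traj W F C αx η (B * ω) ω h₀ x₀ ξ ζ (k + 1) o)
      ≤ (1 + κ) * ((1 - κ) * Φ o + R * δ o + (1 + φ₁ / 2) * c o)
        + η ^ 2 * pw * (n * (2 * Lf * g o) + 8 * Lf ^ 2 * V o + 2 * N o) := by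
    intro o
    have h1 := lyapunov_step hc hb H.n_ne hω hη hη1 (sum_laplacian_col H.symm)
      (g := fun y i => gradient (localCost F D i) y) (fun i => (H.smooth i).2)
      (sum_v_traj H.symm k o) (traj_succ_x (W := W) (F := F) (C := C) (αx := αx) (η := η)
        (γ := B * ω) (ω := ω) (h₀ := h₀) (x₀ := x₀) (ξ := ξ) (ζ := ζ) k o)
      (traj_succ_v (W := W) (F := F) (C := C) (αx := αx) (η := η)
        (γ := B * ω) (ω := ω) (h₀ := h₀) (x₀ := x₀) (ξ := ξ) (ζ := ζ) k o)
      (xc' := (traj W F C αx η (B * ω) ω h₀ x₀ ξ ζ (k + 1) o).xc)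
    refine h1.trans ?_
    have h2 := H.sum_gradient_deviation_le (η := η) (γ := B * ω) (ω := ω) (x₀ := x₀) k o
    have h3 := sum_sq_sub_avg_le_consensusForm hc hb H.n_ne
      (traj W F C αx η (B * ω) ω h₀ x₀ ξ ζ k o).x
      (corrDual F D ω (traj W F C αx η (B * ω) ω h₀ x₀ ξ ζ k o))
    -- Smoothness trades the squared gradient at the average for the optimality gap, which couples
    -- this recursion to the other one.
    have h4 := norm_gradient_sq_le hLf H.smooth.differentiable_globalCost
      (H.smooth.lipschitz_globalCost H.n_ne) (optimalValue_le hbdd)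
      (avg (traj W F C αx η (B * ω) ω h₀ x₀ ξ ζ k o).x)
    rw [H.smooth.gradient_globalCost] at h4
    have h5 : 0 ≤ e o := Finset.sum_nonneg fun i _ => by positivity
    have h6 : 2 * Lf ^ 2 * ∑ i, ‖(traj W F C αx η (B * ω) ω h₀ x₀ ξ ζ k o).x i
        - avg (traj W F C αx η (B * ω) ω h₀ x₀ ξ ζ k o).x‖ ^ 2 ≤ 8 * Lf ^ 2 * V o := by
      have : ∑ i, ‖(traj W F C αx η (B * ω) ω h₀ x₀ ξ ζ k o).x i
        - avg (traj W F C αx η (B * ω) ω h₀ x₀ ξ ζ k o).x‖ ^ 2 ≤ 4 * V o := by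
        rw [hVe]
        linarith
      have := mul_le_mul_of_nonneg_left this (by positivity : 0 ≤ 2 * Lf ^ 2)
      linarith
    have h7 := mul_le_mul_of_nonneg_left h4 (Nat.cast_nonneg (α := ℝ) n)
    refine add_le_add le_rfl (mul_le_mul_of_nonneg_left ?_ (by positivity))
    have h8 : g o = globalCost F D (avg (traj W F C αx η (B * ω) ω h₀ x₀ ξ ζ k o).x)
      - optimalValue F D := rfl
    rw [h8]
    linarith
  have iA : Integrable (fun o => (1 - κ) * Φ o + R * δ o) P :=
    (hΦ.const_mul (1 - κ)).add (hδI.const_mul R)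
  have iB : Integrable (fun o => (1 - κ) * Φ o + R * δ o + (1 + φ₁ / 2) * c o) P :=
    iA.add (hcI.const_mul (1 + φ₁ / 2))
  have iC : Integrable (fun o => n * (2 * Lf * g o) + 8 * Lf ^ 2 * V o) P :=
    ((hG.const_mul (2 * Lf)).const_mul (n : ℝ)).add (hV.const_mul (8 * Lf ^ 2))
  have iD : Integrable (fun o => n * (2 * Lf * g o) + 8 * Lf ^ 2 * V o + 2 * N o) P :=
    iC.add (hNI.const_mul 2)
  have hint := integral_mono (H.integrable_lyap (η := η) (γ := B * ω) (ω := ω) (x₀ := x₀) B b ℓ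
    (k + 1)) ((iB.const_mul (1 + κ)).add (iD.const_mul (η ^ 2 * pw))) hpt
  simp only [Pi.add_apply] at hint
  rw [integral_add (iB.const_mul (1 + κ)) (iD.const_mul (η ^ 2 * pw)), integral_const_mul,
    integral_const_mul, integral_add iA (hcI.const_mul (1 + φ₁ / 2)),
    integral_add (hΦ.const_mul (1 - κ)) (hδI.const_mul R), integral_add iC (hNI.const_mul 2),
    integral_add ((hG.const_mul (2 * Lf)).const_mul (n : ℝ)) (hV.const_mul (8 * Lf ^ 2))] at hint
  simp only [integral_const_mul] at hint
  have hVI : ∫ o, V o ∂P = ∫ o, Φ o ∂P + ∫ o, e o ∂P := integral_add hΦ hE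
  have heI : ∫ o, e o ∂P = ∑ i, ∫ o, ‖(traj W F C αx η (B * ω) ω h₀ x₀ ξ ζ k o).x i
      - (traj W F C αx η (B * ω) ω h₀ x₀ ξ ζ k o).xc i‖ ^ 2 ∂P :=
    integral_finsetSum _ fun i _ => integrable_norm_sq_of_memLp (H.memLp_err k i)
  have hδb : ∫ o, δ o ∂P ≤ (2 * r ^ 2 * (1 - φ) + 2 * (1 - r) ^ 2) * ∫ o, e o ∂P
      + n * (2 * r ^ 2 * σC * (h₀ ^ k) ^ 2) := by
    rw [heI, integral_finsetSum _ fun i _ => hδi i, Finset.mul_sum]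
    refine (Finset.sum_le_sum fun i _ => H.hat_error k i).trans (le_of_eq ?_)
    rw [Finset.sum_add_distrib]
    simp
  have hcb : ∫ o, c o ∂P ≤ (1 - φ₁) * ∫ o, e o ∂P + n * (αx * r * σC * (h₀ ^ k) ^ 2) := by
    rw [heI, integral_finsetSum _ fun i _ => hci i, Finset.mul_sum]
    refine (Finset.sum_le_sum fun i _ => H.reference_error k i).trans (le_of_eq ?_)
    rw [Finset.sum_add_distrib]
    simp [hφ₁]
  have hNb : ∫ o, N o ∂P ≤ n * σ ^ 2 := by
    rw [integral_finsetSum _ fun i _ => hNi i]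
    refine (Finset.sum_le_sum fun i _ => (H.noise_sq k i).2).trans (le_of_eq ?_)
    simp
  have he0 : 0 ≤ ∫ o, e o ∂P :=
    integral_nonneg fun o => Finset.sum_nonneg fun i _ => by positivity
  refine hint.trans ?_
  have b1 := mul_le_mul_of_nonneg_left hδb hR0
  have b2 := mul_le_mul_of_nonneg_left hcb (by positivity : 0 ≤ 1 + φ₁ / 2)
  have b3 := mul_le_mul_of_nonneg_right hR he0
  -- `hR` makes the total coefficient of the compression error `e` at most `1 - κ`, so both parts of
  -- the Lyapunov function contract together. The factor `1 + κ` then yields `1 - κ ^ 2`.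
  have b4 : (1 - κ) * ∫ o, Φ o ∂P + R * ∫ o, δ o ∂P + (1 + φ₁ / 2) * ∫ o, c o ∂P
      ≤ (1 - κ) * ∫ o, V o ∂P + n * (σC * (R * (2 * r ^ 2) + (1 + φ₁ / 2) * (αx * r)))
        * (h₀ ^ k) ^ 2 := by
    rw [hVI]
    linarith
  have b5 := mul_le_mul_of_nonneg_left b4 (by linarith : 0 ≤ 1 + κ)
  have b6 := mul_le_mul_of_nonneg_left hNb (by positivity : 0 ≤ η ^ 2 * pw * 2)
  linarith

end Recursions

/-! ### Descent of the optimality gap at the average -/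

section GapStep

variable {n d : ℕ} {Ω Ξ Z : Type*} [mΩ : MeasurableSpace Ω] [MeasurableSpace Ξ]
  [MeasurableSpace Z] {P : Measure Ω} [IsProbabilityMeasure P]
  {W : Matrix (Fin n) (Fin n) ℝ} {F : Fin n → E d → Ξ → ℝ} {D : Fin n → Measure Ξ}
  {C : E d → Z → E d} {Q : Measure Z} {ξ : Fin n → ℕ → Ω → Ξ} {ζ : Fin n → ℕ → Ω → Z}
  {Lf σ φ r σC αx h₀ : ℝ} {η γ ω : ℝ} {x₀ : Fin n → E d}

local notation "𝔰" => traj W F C αx η γ ω h₀ x₀ ξ ζ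
local notation "𝔫" => gradNoise D ξ F (traj W F C αx η γ ω h₀ x₀ ξ ζ)

lemma continuous_avg : Continuous (avg : (Fin n → E d) → E d) := by
  unfold avg
  fun_prop

lemma SmoothCosts.continuous_meanGrad (h : SmoothCosts F D Lf) : Continuous (meanGrad F D) :=
  continuous_avg.comp
    (continuous_pi fun i => (h.continuous_gradient i).comp (continuous_apply i))

lemma SmoothCosts.continuous_gradient_globalCost (h : SmoothCosts F D Lf) :
    Continuous (gradient (globalCost F D)) := by
  have e : gradient (globalCost F D) = fun x => meanGrad F D fun _ => x :=
    funext h.gradient_globalCost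
  rw [e]
  exact h.continuous_meanGrad.comp (continuous_pi fun _ => continuous_id)

lemma SmoothCosts.norm_gradient_sub_meanGrad_sq_le (h : SmoothCosts F D Lf) (x : Fin n → E d) :
    (n : ℝ) * ‖gradient (globalCost F D) (avg x) - meanGrad F D x‖ ^ 2
      ≤ Lf ^ 2 * ∑ i, ‖x i - avg x‖ ^ 2 := by
  have e : gradient (globalCost F D) (avg x) - meanGrad F D x
      = avg fun i => gradient (localCost F D i) (avg x) - gradient (localCost F D i) (x i) := by
    rw [h.gradient_globalCost, meanGrad]
    generalize avg x = y
    rw [avg, avg, avg, ← smul_sub, ← Finset.sum_sub_distrib]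
  rw [e, Finset.mul_sum]
  refine (norm_avg_sq_le _).trans (Finset.sum_le_sum fun i _ => ?_)
  rw [← mul_pow, norm_sub_rev (x i)]
  exact pow_le_pow_left₀ (norm_nonneg _) ((h i).2 _ _) 2

/-- One inexact gradient step on a smooth Polyak–Łojasiewicz function. -/
lemma descent_step {V : Type*} [NormedAddCommGroup V] [InnerProductSpace ℝ V] [CompleteSpace V]
    {f : V → ℝ} {K fs ν : ℝ} (hf : Differentiable ℝ f)
    (hK : ∀ x y, ‖gradient f x - gradient f y‖ ≤ K * ‖x - y‖) (hη : 0 < η) (hηK : η * K ≤ 1)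
    (hPL : ∀ x, ν * (f x - fs) ≤ 1 / 2 * ‖gradient f x‖ ^ 2) (x m w : V) :
    f (x - η • (m + w)) - fs ≤ (1 - η * ν) * (f x - fs) + η / 2 * ‖gradient f x - m‖ ^ 2
      + K / 2 * η ^ 2 * ‖w‖ ^ 2 + inner ℝ ((-η) • gradient f x + (K * η ^ 2) • m) w := by
  have h1 := descent_lemma hf hK x (x - η • (m + w))
  have h2 := hPL x
  rw [sub_sub_cancel_left, inner_neg_right, real_inner_smul_right, inner_add_right, norm_neg,
    norm_smul, mul_pow, Real.norm_eq_abs, sq_abs, norm_add_sq_real] at h1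
  rw [norm_sub_sq_real, inner_add_left, real_inner_smul_left, real_inner_smul_left]
  have h3 := mul_le_mul_of_nonneg_left h2 hη.le
  -- The identity `-⟪g, m⟫ = (‖g - m‖² - ‖g‖² - ‖m‖²) / 2` leaves `-η / 2 * ‖m‖²`, which absorbs the
  -- quadratic term because `η * K ≤ 1`.
  have h4 : η * K * (η * ‖m‖ ^ 2) ≤ 1 * (η * ‖m‖ ^ 2) := by gcongr
  linarith

/-- The averaged noise is orthogonal to the past, so only its second moment, at most `σ² / n`,
survives. This is the source of the factor `1 / n` in the leading term. -/
theorem Setting.gap_step {β B lam Lam κ ν : ℝ} {b : Fin n → Fin n → ℝ} {ℓ : Fin n → ℝ}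
    (H : Setting P W F D C Q ξ ζ Lf σ φ r σC αx h₀)
    (hc : IsContractive β B lam Lam (αx * r * φ) κ)
    (hb : IsModalBasis (laplacian W) lam Lam b ℓ) (hLf : 0 < Lf)
    (hbdd : BddBelow (Set.range (globalCost F D))) (hPL : PolyakLojasiewicz F D ν)
    (hη : 0 < η) (hηL : η * Lf ≤ 1) (k : ℕ) :
    ∫ o, gap F D (𝔰 (k + 1) o) ∂P
      ≤ (1 - η * ν) * ∫ o, gap F D (𝔰 k o) ∂P
        + 2 * Lf ^ 2 * η * (1 / n * ∫ o, lyap F D B ω b ℓ (𝔰 k o) ∂P)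
        + Lf * σ ^ 2 / 2 * η ^ 2 / n := by
  have hn : (0 : ℝ) < n := by
    have := H.n_ne
    positivity
  have hV := H.integrable_lyap (η := η) (γ := γ) (ω := ω) (x₀ := x₀) B b ℓ k
  have hG := H.integrable_gap (η := η) (γ := γ) (ω := ω) (x₀ := x₀) hbdd k
  have hG' := H.integrable_gap (η := η) (γ := γ) (ω := ω) (x₀ := x₀) hbdd (k + 1)
  have hN : MemLp (fun o => avg (𝔫 k o)) 2 P := memLp_avg fun i => H.memLp_noise k i
  have hN2 := integrable_norm_sq_of_memLp hN
  -- Everything paired with the averaged noise in the descent bound, written as a function of the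
  -- current positions so that it is visibly adapted.
  set Ψ : (Fin n → E d) → E d := fun y =>
    (-η) • gradient (globalCost F D) (avg y) + (Lf * η ^ 2) • meanGrad F D y with hΨ
  have hΨm : Measurable Ψ := by
    have h1 : Continuous fun y : Fin n → E d => gradient (globalCost F D) (avg y) :=
      H.smooth.continuous_gradient_globalCost.comp continuous_avg
    exact ((h1.const_smul (-η)).add (H.smooth.continuous_meanGrad.const_smul
      (Lf * η ^ 2))).measurable
  have ha2 : MemLp (fun o => Ψ (𝔰 k o).x) 2 P := by
    have h1 := memLp_comp_of_lipschitz H.smooth.continuous_gradient_globalCost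
      (H.smooth.lipschitz_globalCost H.n_ne)
      (H.memLp_avg_x (η := η) (γ := γ) (ω := ω) (x₀ := x₀) k)
    have h2 : MemLp (fun o => meanGrad F D (𝔰 k o).x) 2 P := memLp_avg fun i =>
      memLp_comp_of_lipschitz (H.smooth.continuous_gradient i) (H.smooth i).2 (H.memLp k i).1
    exact (h1.const_smul (-η)).add (h2.const_smul (Lf * η ^ 2))
  have hzero : ∫ o, inner ℝ (Ψ (𝔰 k o).x) (avg (𝔫 k o)) ∂P = 0 := by
    have hpast := fun i => H.measurable_of_past (η := η) (γ := γ) (ω := ω) (x₀ := x₀) k i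
    exact H.integral_inner_avg_noise
      (hΨm.comp (measurable_pi_lambda _ fun i => (H.measurable k i).1))
      (fun m hξ hζ => hΨm.comp (measurable_pi_lambda _ fun i => (hpast i m hξ hζ).1)) ha2
  have hpt : ∀ o, gap F D (𝔰 (k + 1) o) ≤ (1 - η * ν) * gap F D (𝔰 k o)
      + 2 * Lf ^ 2 * η * (1 / n) * lyap F D B ω b ℓ (𝔰 k o)
      + Lf / 2 * η ^ 2 * ‖avg (𝔫 k o)‖ ^ 2 + inner ℝ (Ψ (𝔰 k o).x) (avg (𝔫 k o)) := by
    intro o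
    have h1 := descent_step H.smooth.differentiable_globalCost
      (H.smooth.lipschitz_globalCost H.n_ne) hη hηL hPL (avg (𝔰 k o).x)
      (meanGrad F D (𝔰 k o).x) (avg (𝔫 k o))
    rw [← H.avg_succ] at h1
    refine h1.trans ?_
    have h2 := H.smooth.norm_gradient_sub_meanGrad_sq_le (𝔰 k o).x
    have h3 := sum_sq_sub_avg_le_consensusForm hc hb H.n_ne (𝔰 k o).x (corrDual F D ω (𝔰 k o))
    have h4 : 0 ≤ ∑ i, ‖(𝔰 k o).x i - (𝔰 k o).xc i‖ ^ 2 :=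
      Finset.sum_nonneg fun i _ => by positivity
    have h5 : ‖gradient (globalCost F D) (avg (𝔰 k o).x) - meanGrad F D (𝔰 k o).x‖ ^ 2
        ≤ 1 / n * (Lf ^ 2 * (4 * lyap F D B ω b ℓ (𝔰 k o))) := by
      rw [one_div, ← div_eq_inv_mul, le_div_iff₀ hn, mul_comm]
      refine h2.trans (mul_le_mul_of_nonneg_left ?_ (by positivity))
      rw [lyap]
      linarith
    have h6 := mul_le_mul_of_nonneg_left h5 (by positivity : 0 ≤ η / 2)
    simp only [gap, hΨ]
    linarith
  have iA : Integrable (fun o => (1 - η * ν) * gap F D (𝔰 k o)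
      + 2 * Lf ^ 2 * η * (1 / n) * lyap F D B ω b ℓ (𝔰 k o)) P :=
    (hG.const_mul _).add (hV.const_mul _)
  have iB : Integrable (fun o => (1 - η * ν) * gap F D (𝔰 k o)
      + 2 * Lf ^ 2 * η * (1 / n) * lyap F D B ω b ℓ (𝔰 k o)
      + Lf / 2 * η ^ 2 * ‖avg (𝔫 k o)‖ ^ 2) P := iA.add (hN2.const_mul _)
  have iC := integrable_inner_of_memLp ha2 hN
  have h := integral_mono hG' (iB.add iC) hpt
  simp only [Pi.add_apply] at h
  rw [integral_add iB iC, hzero, integral_add iA (hN2.const_mul _),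
    integral_add (hG.const_mul _) (hV.const_mul _), integral_const_mul, integral_const_mul,
    integral_const_mul] at h
  have h1 := mul_le_mul_of_nonneg_left
    (H.avg_noise_sq (η := η) (γ := γ) (ω := ω) (x₀ := x₀) k)
    (by positivity : 0 ≤ Lf / 2 * η ^ 2)
  have e1 : Lf / 2 * η ^ 2 * (σ ^ 2 / n) = Lf * σ ^ 2 / 2 * η ^ 2 / n := by ring
  linarith

end GapStep

/-! ### Admissible parameters -/

namespace Consts

variable {p : Consts} {ω η : ℝ}

/-- The sign conditions on the constants. -/
structure Valid (p : Consts) : Prop where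
  Lf_pos : 0 < p.Lf
  φ₁_pos : 0 < p.φ₁
  r₀_nonneg : 0 ≤ p.r₀
  lam_pos : 0 < p.lam
  lam_le : p.lam ≤ p.Lam
  β₅_pos : 0 < p.β₅
  β₂_pos : 0 < p.β₂
  c₀_lt : p.c₀ < p.β₁

lemma Valid.one_lt (h : p.Valid) : 1 < p.β₁ := (le_max_right _ _).trans_lt h.c₀_lt

lemma Valid.lt_mul_lam (h : p.Valid) : (9 + p.β₅) / 2 < p.β₁ * p.lam := by
  have h1 := (le_max_left _ _).trans_lt h.c₀_lt
  have := h.lam_pos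
  rw [div_lt_iff₀ (by positivity)] at h1
  linarith

lemma Valid.ε₁₀_pos (h : p.Valid) : 0 < p.ε₁₀ := by
  have := h.φ₁_pos
  unfold ε₁₀
  positivity

lemma Valid.ε₁₁_nonneg (h : p.Valid) (hω : 0 < ω) : 0 ≤ p.ε₁₁ ω := by
  have := h.one_lt
  have := h.lam_pos.trans_le h.lam_le
  have := h.r₀_nonneg
  unfold ε₁₁ γ
  positivity

lemma Valid.ε₁₂_pos (h : p.Valid) (hω : 0 < ω) (hr : p.r₀ ≠ 0) : 0 < p.ε₁₂ ω := by
  have h1 := h.one_lt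
  have h2 := h.lam_pos.trans_le h.lam_le
  have h3 : 0 < p.r₀ := lt_of_le_of_ne h.r₀_nonneg (Ne.symm hr)
  have h4 := h.φ₁_pos
  unfold ε₁₂ γ
  positivity

lemma Valid.root_pos (h : p.Valid) (hω : 0 < ω) : 0 < p.root ω := by
  unfold root
  split_ifs with hr
  · exact one_pos
  · have h1 := h.ε₁₂_pos hω hr
    have h2 := h.ε₁₀_pos
    have h3 := h.ε₁₁_nonneg hω
    have : p.ε₁₁ ω < Real.sqrt (p.ε₁₁ ω ^ 2 + 4 * p.ε₁₀ * p.ε₁₂ ω) := by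
      apply Real.lt_sqrt_of_sq_lt
      have : 0 < 4 * p.ε₁₀ * p.ε₁₂ ω := by positivity
      linarith
    exact div_pos (by linarith) (by positivity)

/-- The first three entries of `β₃` make `ε₁'`, `ε₄` and `ε₆` positive respectively; for `ε₁'` this
also uses `c₀ < β₁`. Strictness is needed for `ε₄` and `ε₆`. -/
lemma Valid.β₄_pos (h : p.Valid) (h1 : (4 + 5 * p.Lf ^ 2) / p.β₅ ≤ ω)
    (h2 : (12 * p.lam⁻¹ + 1) / 3 < ω) (h3 : Real.sqrt p.β₆ < ω) : 0 < p.β₄ ω := by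
  have hLf := h.Lf_pos
  have hlam := h.lam_pos
  have hLam := h.lam_pos.trans_le h.lam_le
  have hφ := h.φ₁_pos
  have hβ₅ := h.β₅_pos
  have hβ₁ := h.one_lt
  have hω : 0 < ω := lt_of_le_of_lt (by positivity) h2
  have e1 : 0 < p.ε₁' ω := by
    rw [div_le_iff₀ hβ₅] at h1
    have := mul_lt_mul_of_pos_right h.lt_mul_lam hω
    unfold ε₁' γ
    linarith
  have e2 : 0 < p.ε₂' ω := by unfold ε₂' γ; positivity
  have e4 : 0 < p.ε₄ ω := by unfold ε₄; linarith
  have e5 : 0 < p.ε₅ ω := by unfold ε₅; positivity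
  have e6 : 0 < p.ε₆ ω := by
    have hβ₆ : p.β₆ < ω ^ 2 := (Real.sqrt_lt' hω).mp h3
    have e : (2 * (1 + p.β₁) ^ 2 / (ω ^ 2 * p.lam) + 1 / (ω ^ 2 * p.lam ^ 2)) * p.Lf ^ 2
        = p.β₆ / (8 * ω ^ 2) := by
      unfold β₆
      field_simp
      ring
    have : p.β₆ / (8 * ω ^ 2) < 1 / 8 := by
      rw [div_lt_div_iff₀ (by positivity) (by norm_num)]
      linarith
    unfold ε₆
    linarith
  have e7 : 0 < p.ε₇ ω := by unfold ε₇; positivity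
  exact lt_min (div_pos e1 e2) (lt_min (div_pos e4 e5) (lt_min (div_pos e6 e7)
    (lt_min (h.root_pos hω) one_pos)))

/-- In `η * ε₂' < ε₁'` keep the highest power of `ω` on each side; the dropped terms have the
favourable sign. Dividing by `ω` with `η * ω = β₂` removes the horizon. -/
lemma Valid.cond_of_lt_β₄ (h : p.Valid) (hω : 0 < ω) (hη : 0 < η) (hηω : η * ω = p.β₂)
    (hlt : η < p.β₄ ω) :
    p.β₂ * ((7 + 8 / p.φ₁) * p.β₁ ^ 2 * p.Lam ^ 2 + 2) ≤ p.β₁ * p.lam / 2 - 9 / 4 := by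
  have hφ := h.φ₁_pos
  have e2 : 0 < p.ε₂' ω := by unfold ε₂' γ; positivity
  have h1 : η < p.ε₁' ω / p.ε₂' ω := hlt.trans_le (min_le_left _ _)
  rw [lt_div_iff₀ e2] at h1
  have h2 : η * (((7 + 8 / p.φ₁) * p.β₁ ^ 2 * p.Lam ^ 2 + 2) * ω ^ 2) ≤ η * p.ε₂' ω := by
    refine mul_le_mul_of_nonneg_left ?_ hη.le
    have : 0 ≤ (7 + 16 / p.φ₁) * p.Lf ^ 2 := by positivity
    unfold ε₂' γ
    linarith
  have h3 : p.ε₁' ω ≤ (p.β₁ * p.lam / 2 - 9 / 4) * ω := by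
    have : 0 ≤ p.Lf ^ 2 := by positivity
    unfold ε₁' γ
    linarith
  rw [← hηω]
  refine le_of_mul_le_mul_right ?_ hω
  linarith

/-- Below the positive root, `η * ε₁₁ + η ^ 2 * ε₁₂ < ε₁₀`. Substituting `η * ω = β₂` shows that the
left side dominates `errWeight * r₀`, again free of `T`. -/
lemma Valid.errWeight_mul_lt (h : p.Valid) (hω : 0 < ω) (hη : 0 < η) (hηω : η * ω = p.β₂)
    (hlt : η < p.β₄ ω) : errWeight p.β₂ p.β₁ p.Lam p.φ₁ * p.r₀ < p.ε₁₀ := by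
  by_cases hr : p.r₀ = 0
  · rw [hr, mul_zero]
    exact h.ε₁₀_pos
  have hφ := h.φ₁_pos
  have hr₀ := h.r₀_nonneg
  have hβ₂ := h.β₂_pos
  have hβ₁ := h.one_lt
  have hLam := h.lam_pos.trans_le h.lam_le
  have e12 := h.ε₁₂_pos hω hr
  have e10 := h.ε₁₀_pos
  have e11 := h.ε₁₁_nonneg hω
  have h1 : η < p.root ω := hlt.trans_le
    ((min_le_right _ _).trans ((min_le_right _ _).trans ((min_le_right _ _).trans
      (min_le_left _ _))))
  rw [root, if_neg hr, lt_div_iff₀ (by positivity)] at h1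
  have h2 : η * (2 * p.ε₁₂ ω) + p.ε₁₁ ω < Real.sqrt (p.ε₁₁ ω ^ 2 + 4 * p.ε₁₀ * p.ε₁₂ ω) := by
    linarith
  rw [Real.lt_sqrt (by positivity)] at h2
  have h3 : (η * p.ε₁₁ ω + η ^ 2 * p.ε₁₂ ω) * (4 * p.ε₁₂ ω) < p.ε₁₀ * (4 * p.ε₁₂ ω) := by
    linarith
  have h4 : η * p.ε₁₁ ω + η ^ 2 * p.ε₁₂ ω < p.ε₁₀ := lt_of_mul_lt_mul_right h3 (by positivity)
  refine lt_of_le_of_lt ?_ h4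
  have e : η * p.ε₁₁ ω + η ^ 2 * p.ε₁₂ ω
      = p.β₂ * ((p.β₁ / 2 + 1) * p.Lam + 2) * p.r₀
        + p.β₂ ^ 2 * ((7 + 8 / p.φ₁) * p.β₁ ^ 2 * p.Lam ^ 2 + 2) * p.r₀ + η ^ 2 * p.r₀ := by
    rw [← hηω]
    unfold ε₁₁ ε₁₂ γ
    field_simp
    ring
  rw [e, errWeight]
  have t1 : 0 ≤ p.β₂ * p.r₀ := by positivity
  have t2 : 0 ≤ p.β₂ ^ 2 * (p.β₁ ^ 2 * p.Lam ^ 2) * p.r₀ := by positivity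
  have t3 : 0 ≤ η ^ 2 * p.r₀ := by positivity
  linarith

end Consts

lemma omega_pos {β₂ θ : ℝ} (hβ : 0 < β₂) (T : ℕ) : 0 < omega β₂ θ T :=
  mul_pos hβ (Real.rpow_pos_of_pos (by positivity) _)

lemma div_omega {β₂ θ : ℝ} (hβ : 0 < β₂) (T : ℕ) :
    β₂ / omega β₂ θ T = ((T : ℝ) + 1) ^ (-θ) := by
  rw [omega, Real.rpow_neg (by positivity)]
  field_simp

/-- What the lower bound on the horizon entails. -/
lemma Consts.Valid.of_horizon {p : Consts} (h : p.Valid) {θ : ℝ} (hθ : 0 < θ) {T : ℕ}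
    (hT : (p.β₃ (omega p.β₂ θ T) / p.β₂) ^ (1 / θ) ≤ (T : ℝ)) :
    1 ≤ T ∧ p.β₂ / omega p.β₂ θ T < p.β₄ (omega p.β₂ θ T) ∧
      p.β₂ / omega p.β₂ θ T * p.Lf ≤ 1 := by
  have hβ₂ := h.β₂_pos
  have hLf := h.Lf_pos
  set ω := omega p.β₂ θ T with hω
  have hω0 : 0 < ω := omega_pos hβ₂ T
  have hb5 : 4 * p.β₂ * p.Lf ≤ p.β₃ ω :=
    (le_max_right _ _).trans ((le_max_right _ _).trans ((le_max_right _ _).trans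
      (le_max_right _ _)))
  have hb4 : p.β₂ / p.β₄ ω ≤ p.β₃ ω :=
    (le_max_left _ _).trans ((le_max_right _ _).trans ((le_max_right _ _).trans
      (le_max_right _ _)))
  have hb3 : Real.sqrt p.β₆ ≤ p.β₃ ω :=
    (le_max_left _ _).trans ((le_max_right _ _).trans (le_max_right _ _))
  have hb2 : (12 * p.lam⁻¹ + 1) / 3 ≤ p.β₃ ω := (le_max_left _ _).trans (le_max_right _ _)
  have hb1 : (4 + 5 * p.Lf ^ 2) / p.β₅ ≤ p.β₃ ω := le_max_left _ _
  have hβ₃ : 0 < p.β₃ ω := lt_of_lt_of_le (by positivity) hb5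
  have hq : 0 < p.β₃ ω / p.β₂ := by positivity
  have hT1 : 1 ≤ T := by
    have : (0 : ℝ) < T := (Real.rpow_pos_of_pos hq _).trans_le hT
    exact_mod_cast this
  have hT0 : (0 : ℝ) < T := by exact_mod_cast hT1
  have hτ : p.β₃ ω ≤ p.β₂ * (T : ℝ) ^ θ := by
    have h1 := Real.rpow_le_rpow (by positivity) hT hθ.le
    rw [← Real.rpow_mul hq.le, one_div_mul_cancel hθ.ne', Real.rpow_one, div_le_iff₀ hβ₂] at h1
    linarith
  have hlt : p.β₂ * (T : ℝ) ^ θ < ω := by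
    rw [hω, omega]
    exact mul_lt_mul_of_pos_left (Real.rpow_lt_rpow hT0.le (by linarith) hθ) hβ₂
  -- Strict because `ω` is built from `T + 1` and the hypothesis from `T`.
  have hβ₃ω : p.β₃ ω < ω := hτ.trans_lt hlt
  have hβ₄ := h.β₄_pos (hb1.trans hβ₃ω.le) (hb2.trans_lt hβ₃ω) (hb3.trans_lt hβ₃ω)
  refine ⟨hT1, ?_, ?_⟩
  · rw [div_lt_iff₀ hω0]
    have := hb4.trans_lt hβ₃ω
    rw [div_lt_iff₀ hβ₄] at this
    linarith
  · rw [div_mul_eq_mul_div, div_le_one hω0]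
    have : 0 < p.β₂ * p.Lf := by positivity
    linarith

/-! ### From the one-step estimates to the coupled recursion -/

section Conclusion

variable {n d : ℕ} {Ω Ξ Z : Type*} [mΩ : MeasurableSpace Ω] [MeasurableSpace Ξ]
  [MeasurableSpace Z] {P : Measure Ω} [IsProbabilityMeasure P]
  {W : Matrix (Fin n) (Fin n) ℝ} {F : Fin n → E d → Ξ → ℝ} {D : Fin n → Measure Ξ}
  {C : E d → Z → E d} {Q : Measure Z} {ξ : Fin n → ℕ → Ω → Ξ} {ζ : Fin n → ℕ → Ω → Z}
  {Lf σ φ r σC αx h₀ : ℝ} {η γ ω : ℝ} {x₀ : Fin n → E d}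

local notation "𝔰" => traj W F C αx η γ ω h₀ x₀ ξ ζ

lemma lyap_nonneg {β B lam Lam φ₁ κ : ℝ} {b : Fin n → Fin n → ℝ} {ℓ : Fin n → ℝ}
    {L : Matrix (Fin n) (Fin n) ℝ} (hc : IsContractive β B lam Lam φ₁ κ)
    (hb : IsModalBasis L lam Lam b ℓ) (s : State n d) : 0 ≤ lyap F D B ω b ℓ s :=
  add_nonneg (consensusForm_nonneg hc hb _ _) (Finset.sum_nonneg fun i _ => by positivity)

lemma sum_sq_sub_avg_le_lyap {β B lam Lam φ₁ κ : ℝ} {b : Fin n → Fin n → ℝ} {ℓ : Fin n → ℝ}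
    {L : Matrix (Fin n) (Fin n) ℝ} (hc : IsContractive β B lam Lam φ₁ κ)
    (hb : IsModalBasis L lam Lam b ℓ) (hn : n ≠ 0) (s : State n d) :
    ∑ i, ‖s.x i - avg s.x‖ ^ 2 ≤ 4 * lyap F D B ω b ℓ s := by
  have h1 := sum_sq_sub_avg_le_consensusForm hc hb hn s.x (corrDual F D ω s)
  have h2 : 0 ≤ ∑ i, ‖s.x i - s.xc i‖ ^ 2 := Finset.sum_nonneg fun i _ => by positivity
  rw [lyap]
  linarith

/-- Dividing the Lyapunov estimate by `n` leaves constants free of `n`, because each forcing term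
there is either proportional to `n` or to the Lyapunov function. -/
theorem Setting.coupledRecursion {β B lam Lam κ ν : ℝ} {b : Fin n → Fin n → ℝ} {ℓ : Fin n → ℝ}
    (H : Setting P W F D C Q ξ ζ Lf σ φ r σC αx h₀)
    (hc : IsContractive β B lam Lam (αx * r * φ) κ)
    (hb : IsModalBasis (laplacian W) lam Lam b ℓ) (hLf : 0 < Lf)
    (hbdd : BddBelow (Set.range (globalCost F D))) (hPL : PolyakLojasiewicz F D ν)
    (hR : errWeight β B Lam (αx * r * φ) * (2 * r ^ 2 * (1 - φ) + 2 * (1 - r) ^ 2)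
      + (1 + αx * r * φ / 2) * (1 - αx * r * φ) ≤ 1 - κ)
    (hω : 0 < ω) (hη : η = β / ω) (hη1 : η ≤ 1) (hγ : γ = B * ω) (hηL : η * Lf ≤ 1) :
    CoupledRecursion (κ ^ 2) ν
      (pertWeight β B lam (αx * r * φ) Lf κ * (2 * Lf + 8 * Lf ^ 2 + 2 * σ ^ 2))
      ((1 + κ) * σC * (errWeight β B Lam (αx * r * φ) * (2 * r ^ 2)
          + (1 + αx * r * φ / 2) * (αx * r))) (2 * Lf ^ 2) (Lf * σ ^ 2 / 2) h₀ η n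
      (fun k => 1 / n * ∫ o, lyap F D B ω b ℓ (𝔰 k o) ∂P) (fun k => ∫ o, gap F D (𝔰 k o) ∂P) := by
  have hn : (0 : ℝ) < n := by
    have := H.n_ne
    positivity
  have hη0 : 0 < η := by
    have := hc.β_pos
    rw [hη]
    positivity
  have hA0 : ∀ k, 0 ≤ 1 / (n : ℝ) * ∫ o, lyap F D B ω b ℓ (𝔰 k o) ∂P := fun k =>
    mul_nonneg (by positivity) (integral_nonneg fun o => lyap_nonneg hc hb _)
  have hB0 : ∀ k, 0 ≤ ∫ o, gap F D (𝔰 k o) ∂P := fun k =>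
    integral_nonneg fun o => sub_nonneg.mpr (optimalValue_le hbdd _)
  refine ⟨hA0, hB0, fun k => ?_, H.gap_step hc hb hLf hbdd hPL hη0 hηL⟩
  have h1 := mul_le_mul_of_nonneg_left
    (H.lyap_step (x₀ := x₀) hc hb hLf hbdd hR hω hη hη1 hγ k)
    (by positivity : 0 ≤ 1 / (n : ℝ))
  refine h1.trans ?_
  have hA := hA0 k
  have hB := hB0 k
  set A := ∫ o, lyap F D B ω b ℓ (𝔰 k o) ∂P
  set G := ∫ o, gap F D (𝔰 k o) ∂P
  set pw := pertWeight β B lam (αx * r * φ) Lf κ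
  have hpw : 0 ≤ pw := pertWeight_nonneg hc
  set R := (1 + κ) * σC * (errWeight β B Lam (αx * r * φ) * (2 * r ^ 2)
          + (1 + αx * r * φ / 2) * (αx * r))
  have e : 1 / (n : ℝ) * ((1 - κ ^ 2) * A
      + η ^ 2 * pw * (n * (2 * Lf * G) + 8 * Lf ^ 2 * A + 2 * (n * σ ^ 2))
      + n * R * (h₀ ^ k) ^ 2) = (1 - κ ^ 2) * (1 / n * A)
      + pw * η ^ 2 * (2 * Lf * G + 8 * Lf ^ 2 * (1 / n * A) + 2 * σ ^ 2) + R * (h₀ ^ k) ^ 2 := by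
    field_simp
  rw [e]
  set a := 1 / (n : ℝ) * A
  have h2 : 2 * Lf * G + 8 * Lf ^ 2 * a + 2 * σ ^ 2
      ≤ (2 * Lf + 8 * Lf ^ 2 + 2 * σ ^ 2) * (a + G + 1) := by
    have t1 : 0 ≤ 2 * Lf * (a + 1) := by positivity
    have t2 : 0 ≤ 8 * Lf ^ 2 * (G + 1) := by positivity
    have t3 : 0 ≤ 2 * σ ^ 2 * (a + G) := by positivity
    linarith
  have h3 := mul_le_mul_of_nonneg_left h2 (by positivity : 0 ≤ pw * η ^ 2)
  linarith

/-- As `v` and `xc` start at zero, the corrected dual is `∇f_i(x̄₀) / ω` with `ω ≥ β`, and `∑ ‖x₀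
i‖²` is counted twice: in the consensus form and in the compression error. -/
lemma lyap_initial_le {β B lam Lam φ₁ κ M : ℝ} {b : Fin n → Fin n → ℝ} {ℓ : Fin n → ℝ}
    {L : Matrix (Fin n) (Fin n) ℝ} (hc : IsContractive β B lam Lam φ₁ κ)
    (hb : IsModalBasis L lam Lam b ℓ) (hβω : β ≤ ω) (hM : InitialBound F D x₀ M) :
    1 / (n : ℝ) * lyap F D B ω b ℓ { x := x₀, v := fun _ => 0, xc := fun _ => 0 }
      ≤ 2 * M + ((1 + B) / 2 + 1 / lam) / lam * (1 / β ^ 2) * M := by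
  have hβ := hc.β_pos
  have hB := hc.one_le_B
  have hlam := hc.lam_pos
  have h1 := consensusForm_le hc hb x₀
    (corrDual F D ω { x := x₀, v := fun _ => 0, xc := fun _ => 0 })
  set K := ((1 + B) / 2 + 1 / lam) / lam
  have hK : 0 ≤ K := by positivity
  set S := ∑ i, ‖gradient (localCost F D i) (avg x₀)‖ ^ 2 with hS
  have hS0 : 0 ≤ S := Finset.sum_nonneg fun i _ => by positivity
  have h2 : ∑ i, ‖corrDual F D ω { x := x₀, v := fun _ => 0, xc := fun _ => 0 } i‖ ^ 2
      = (1 / ω) ^ 2 * S := by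
    rw [hS, Finset.mul_sum]
    refine Finset.sum_congr rfl fun i _ => ?_
    rw [corrDual, zero_add, norm_smul, mul_pow, Real.norm_eq_abs, sq_abs]
  have h3 : (1 / ω) ^ 2 ≤ 1 / β ^ 2 := by
    rw [one_div_pow]
    exact one_div_le_one_div_of_le (by positivity) (by gcongr)
  rw [h2] at h1
  have h4 : K * ((1 / ω) ^ 2 * S) ≤ K * (1 / β ^ 2 * S) := by gcongr
  have h5 : lyap F D B ω b ℓ { x := x₀, v := fun _ => 0, xc := fun _ => 0 }
      ≤ 2 * ∑ i, ‖x₀ i‖ ^ 2 + K * (1 / β ^ 2 * S) := by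
    simp only [lyap, sub_zero]
    linarith
  have h6 := mul_le_mul_of_nonneg_left h5 (by positivity : 0 ≤ 1 / (n : ℝ))
  have h7 := mul_le_mul_of_nonneg_left hM.2.2 (by positivity : 0 ≤ K * (1 / β ^ 2))
  have h8 := hM.1
  linarith

end Conclusion

/-- A contraction rate for admissible parameters. -/
lemma Consts.Valid.exists_rate {p : Consts} (h : p.Valid)
    (hcond : p.β₂ * ((7 + 8 / p.φ₁) * p.β₁ ^ 2 * p.Lam ^ 2 + 2) ≤ p.β₁ * p.lam / 2 - 9 / 4)
    (herr : errWeight p.β₂ p.β₁ p.Lam p.φ₁ * p.r₀ < p.ε₁₀) :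
    ∃ κ, κ ≤ 1 ∧ IsContractive p.β₂ p.β₁ p.lam p.Lam p.φ₁ κ ∧
      errWeight p.β₂ p.β₁ p.Lam p.φ₁ * p.r₀ + (1 + p.φ₁ / 2) * (1 - p.φ₁) ≤ 1 - κ := by
  have hβ := h.β₂_pos
  have hB := h.one_lt
  have hlam := h.lam_pos
  have hK : 0 < (1 + p.β₁) / 2 + 1 / p.lam := by positivity
  set κ := min (min 1 p.β₂) (min (p.β₂ / 4 / ((1 + p.β₁) / 2 + 1 / p.lam))
    (p.ε₁₀ - errWeight p.β₂ p.β₁ p.Lam p.φ₁ * p.r₀)) with hκ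
  refine ⟨κ, (min_le_left _ _).trans (min_le_left _ _), ⟨hβ, hB.le, hlam, h.lam_le, h.φ₁_pos,
    hcond, ?_, (min_le_left _ _).trans (min_le_right _ _), ?_⟩, ?_⟩
  · exact lt_min (lt_min one_pos hβ) (lt_min (by positivity) (by linarith))
  · rw [← le_div_iff₀ hK]
    exact (min_le_right _ _).trans (min_le_left _ _)
  · have h1 : κ ≤ p.ε₁₀ - errWeight p.β₂ p.β₁ p.Lam p.φ₁ * p.r₀ :=
      (min_le_right _ _).trans (min_le_right _ _)
    -- Thus `ε₁₀` is the contraction of the compression error left after Young's inequality, and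
    -- `herr` says that `errWeight * r₀` does not use it up.
    have e : (1 + p.φ₁ / 2) * (1 - p.φ₁) = 1 - p.ε₁₀ := by
      unfold Consts.ε₁₀
      ring
    linarith

end RCPSGD

end

/-! ### The convergence theorem -/

theorem theorem2 (Lf σ ν θ : ℝ) (hLf : 0 < Lf) (hσ : 0 < σ) (hν : 0 < ν)
    (hθ : θ ∈ Set.Ioo (0 : ℝ) 1) :
    ∃ C₁ : ℝ, 0 < C₁ ∧
      ∀ (φ r σC αx β₁ β₂ β₅ h₀ lam Lam M : ℝ) (p : Consts),
        p = { Lf := Lf, φ := φ, r := r, αx := αx, β₁ := β₁, β₂ := β₂, β₅ := β₅,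
              lam := lam, Lam := Lam } →
        φ ∈ Set.Ioc (0 : ℝ) 1 → 0 < r → 0 ≤ σC → αx ∈ Set.Ioo 0 (1 / r) →
        0 < β₅ → p.c₀ < β₁ → β₂ ∈ Set.Ioo (0 : ℝ) 1 → h₀ ∈ Set.Ioo (0 : ℝ) (1 / 2) →
        ∃ C₂ : ℝ, 0 < C₂ ∧
          ∀ (n d : ℕ) (G : SimpleGraph (Fin n)) (W : Matrix (Fin n) (Fin n) ℝ)
            (Ω : Type u) (Ξ : Type v) (Z : Type w)
            [MeasurableSpace Ω] [MeasurableSpace Ξ] [MeasurableSpace Z]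
            (P : Measure Ω) [IsProbabilityMeasure P]
            (F : Fin n → E d → Ξ → ℝ) (D : Fin n → Measure Ξ)
            (C : E d → Z → E d) (Q : Measure Z)
            (ξ : Fin n → ℕ → Ω → Ξ) (ζ : Fin n → ℕ → Ω → Z) (x₀ : Fin n → E d),
            G.Connected → IsWeightMatrix G W →
            IsMinPosEigenvalue (laplacian W) lam → IsSpectralRadius (laplacian W) Lam →
            WellPosed F D → SmoothCosts F D Lf → UnbiasedBoundedVariance F D σ →
            BddBelow (Set.range (globalCost F D)) → PolyakLojasiewicz F D ν →
            IsCompressor C Q φ r σC → IsSampling P D Q ξ ζ → InitialBound F D x₀ M →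
            ∀ T : ℕ, (p.β₃ (omega β₂ θ T) / β₂) ^ (1 / θ) ≤ (T : ℝ) →
            ∀ x : Ω → Fin n → E d,
              (∀ o, x o = (iterates W F C αx
                (fun _ => β₂ / omega β₂ θ T) (fun _ => β₁ * omega β₂ θ T)
                (fun _ => omega β₂ θ T) (fun k => h₀ ^ k) x₀
                (fun i k => ξ i k o) (fun i k => ζ i k o) T).x) →
              (Integrable (fun o => (1 / (n : ℝ)) * ∑ i, ‖x o i - avg (x o)‖ ^ 2) P ∧
                ∫ o, (1 / (n : ℝ)) * ∑ i, ‖x o i - avg (x o)‖ ^ 2 ∂P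
                  ≤ C₂ / (T : ℝ) ^ (2 * θ)) ∧
              (Integrable (fun o => globalCost F D (avg (x o)) - optimalValue F D) P ∧
                ∫ o, (globalCost F D (avg (x o)) - optimalValue F D) ∂P
                  ≤ C₁ / ((n : ℝ) * (T : ℝ) ^ θ) + C₂ / (T : ℝ) ^ (2 * θ)) := by
  -- This is `2 * c₄ / ν` with `c₄ = Lf * σ ^ 2 / 2`.
  refine ⟨2 * (Lf * σ ^ 2 / 2) / ν, by positivity, ?_⟩
  intro φ r σC αx β₁ β₂ β₅ h₀ lam Lam M p hp hφ hr hσC hαx hβ₅ hc₀ hβ₂ hh₀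
  have e1 : p.Lf = Lf := by rw [hp]
  have e2 : p.φ₁ = αx * r * φ := by rw [hp]; rfl
  have e3 : p.β₁ = β₁ := by rw [hp]
  have e4 : p.β₂ = β₂ := by rw [hp]
  have e5 : p.lam = lam := by rw [hp]
  have e6 : p.Lam = Lam := by rw [hp]
  have e7 : p.β₅ = β₅ := by rw [hp]
  have e8 : p.r₀ = 2 * r ^ 2 * (1 - φ) + 2 * (1 - r) ^ 2 := by rw [hp]; rfl
  have hφ₁ : 0 < αx * r * φ := mul_pos (mul_pos hαx.1 hr) hφ.1
  have hr₀ : 0 ≤ 2 * r ^ 2 * (1 - φ) + 2 * (1 - r) ^ 2 := by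
    have : 0 ≤ 1 - φ := by linarith [hφ.2]
    positivity
  have hvalid : 0 < lam → lam ≤ Lam → p.Valid := fun h1 h2 =>
    ⟨by rwa [e1], by rwa [e2], by rwa [e8], by rwa [e5], by rwa [e5, e6], by rwa [e7],
      by rw [e4]; exact hβ₂.1, by rwa [e3]⟩
  -- `C₂` must be chosen before the network and the horizon are given. These conditions involve only
  -- the constants and follow from the existence of one admissible instance, so their failure makes
  -- the claim vacuous.
  by_cases hgood : (0 < lam ∧ lam ≤ Lam ∧ 0 ≤ M) ∧
      p.β₂ * ((7 + 8 / p.φ₁) * p.β₁ ^ 2 * p.Lam ^ 2 + 2) ≤ p.β₁ * p.lam / 2 - 9 / 4 ∧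
      errWeight p.β₂ p.β₁ p.Lam p.φ₁ * p.r₀ < p.ε₁₀
  · obtain ⟨⟨hlam, hlamLam, hM⟩, hcond, herr⟩ := hgood
    obtain ⟨κ, hκ1, hc, hR⟩ := (hvalid hlam hlamLam).exists_rate hcond herr
    rw [e2, e3, e4, e5, e6] at hc
    rw [e2, e3, e4, e6, e8] at hR
    have hκ := hc.κ_pos
    have hβ := hβ₂.1
    have hB := hc.one_le_B
    have hew : 0 ≤ errWeight β₂ β₁ Lam (αx * r * φ) := by
      have := hlam.trans_le hlamLam
      rw [errWeight]
      positivity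
    have hαr : 0 < αx * r := mul_pos hαx.1 hr
    have hpw := pertWeight_nonneg (Lf := Lf) hc
    obtain ⟨C₀, hC₀, hrec⟩ := exists_coupled_recursion_bound (κ := κ ^ 2) (ν := ν) (θ := θ)
      (c₁ := pertWeight β₂ β₁ lam (αx * r * φ) Lf κ * (2 * Lf + 8 * Lf ^ 2 + 2 * σ ^ 2))
      (c₂ := (1 + κ) * σC * (errWeight β₂ β₁ Lam (αx * r * φ) * (2 * r ^ 2)
          + (1 + αx * r * φ / 2) * (αx * r))) (c₃ := 2 * Lf ^ 2) (c₄ := Lf * σ ^ 2 / 2)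
      (h₀ := h₀) (M := 2 * M + ((1 + β₁) / 2 + 1 / lam) / lam * (1 / β₂ ^ 2) * M)
      (by positivity) (pow_le_one₀ hκ.le hκ1) hν hθ (by positivity) (by positivity)
      (by positivity) (by positivity) hh₀ (by positivity)
    -- The factor `4` comes from bounding the disagreement by four times the Lyapunov function.
    refine ⟨4 * C₀, by positivity, ?_⟩
    intro n d G W Ω Ξ Z _ _ _ P _ F D C Q ξ ζ x₀ hG hW hmin hmax hwp hsm hub hbdd hPL hcomp hsamp
      hinit T hT x hx
    have hn : n ≠ 0 := by
      rintro rfl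
      exact hG.nonempty.elim fun i => i.elim0
    have hn1 : (1 : ℝ) ≤ n := by exact_mod_cast Nat.one_le_iff_ne_zero.mpr hn
    have hT' := hT
    rw [← e4] at hT'
    obtain ⟨hT1, -, hηL⟩ := (hvalid hlam hlamLam).of_horizon hθ.1 hT'
    rw [e4, e1] at hηL
    obtain ⟨b, ℓ, hb⟩ := exists_isModalBasis hG hW hmin hmax
    have H : Setting P W F D C Q ξ ζ Lf σ φ r σC αx h₀ :=
      ⟨hn, hW.symm, hwp, hsm, hub, hcomp, hsamp, hr, hαx, hh₀.1⟩
    have hω := omega_pos (θ := θ) hβ T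
    have hη := div_omega (θ := θ) hβ T
    have hη1 : β₂ / omega β₂ θ T ≤ 1 := by
      rw [hη]
      exact Real.rpow_le_one_of_one_le_of_nonpos (by linarith [Nat.cast_nonneg (α := ℝ) T])
        (by linarith [hθ.1])
    have hβω : β₂ ≤ omega β₂ θ T := (div_le_one hω).mp hη1
    have hrecur := H.coupledRecursion (x₀ := x₀) hc hb hLf hbdd hPL hR hω rfl hη1 rfl hηL
    rw [hη] at hrecur
    have hx' : ∀ o, x o = (traj W F C αx (((T : ℝ) + 1) ^ (-θ)) (β₁ * omega β₂ θ T)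
        (omega β₂ θ T) h₀ x₀ ξ ζ T o).x := by
      intro o
      rw [hx o, hη]
      rfl
    obtain ⟨hA, hB⟩ := hrec T n _ _ hT1 hn1 hrecur
      (by
        have := lyap_initial_le hc hb hβω hinit
        simpa [traj, iterates] using this)
      (by
        have h1 := hinit.2.1
        have h2 : 0 ≤ ((1 + β₁) / 2 + 1 / lam) / lam * (1 / β₂ ^ 2) * M := by positivity
        have h3 : gap F D { x := x₀, v := fun _ => 0, xc := fun _ => 0 } ≤ M := h1
        simp only [traj, iterates, integral_const, probReal_univ, one_smul]
        linarith)
    have hdis := fun i => H.memLp_disagreement (η := ((T : ℝ) + 1) ^ (-θ))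
      (γ := β₁ * omega β₂ θ T) (ω := omega β₂ θ T) (x₀ := x₀) T i
    have hint1 := (integrable_finsetSum Finset.univ fun i _ =>
      integrable_norm_sq_of_memLp (hdis i)).const_mul (1 / (n : ℝ))
    have hint2 := H.integrable_gap (η := ((T : ℝ) + 1) ^ (-θ))
      (γ := β₁ * omega β₂ θ T) (ω := omega β₂ θ T) (x₀ := x₀) hbdd T
    have hV := H.integrable_lyap (η := ((T : ℝ) + 1) ^ (-θ))
      (γ := β₁ * omega β₂ θ T) (ω := omega β₂ θ T) (x₀ := x₀) β₁ b ℓ T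
    simp only [hx']
    refine ⟨⟨hint1, ?_⟩, hint2, hB.trans ?_⟩
    · have h1 : ∀ o, 1 / (n : ℝ) * ∑ i, ‖(traj W F C αx (((T : ℝ) + 1) ^ (-θ))
          (β₁ * omega β₂ θ T) (omega β₂ θ T) h₀ x₀ ξ ζ T o).x i - avg (traj W F C αx
          (((T : ℝ) + 1) ^ (-θ)) (β₁ * omega β₂ θ T) (omega β₂ θ T) h₀ x₀ ξ ζ T o).x‖ ^ 2
          ≤ 4 * (1 / n) * lyap F D β₁ (omega β₂ θ T) b ℓ (traj W F C αx (((T : ℝ) + 1) ^ (-θ))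
            (β₁ * omega β₂ θ T) (omega β₂ θ T) h₀ x₀ ξ ζ T o) := by
        intro o
        rw [mul_comm 4, mul_assoc]
        exact mul_le_mul_of_nonneg_left (sum_sq_sub_avg_le_lyap hc hb hn _) (by positivity)
      refine (integral_mono hint1 (hV.const_mul _) h1).trans ?_
      rw [integral_const_mul, mul_assoc, mul_div_assoc]
      exact mul_le_mul_of_nonneg_left hA (by norm_num)
    · have : C₀ / (T : ℝ) ^ (2 * θ) ≤ 4 * C₀ / (T : ℝ) ^ (2 * θ) := by
        gcongr
        linarith
      linarith
  -- No admissible instance exists here, so any positive constant will do.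
  · refine ⟨1, one_pos, ?_⟩
    intro n d G W Ω Ξ Z _ _ _ P _ F D C Q ξ ζ x₀ hG hW hmin hmax hwp hsm hub hbdd hPL hcomp hsamp
      hinit T hT
    exfalso
    have hlam : 0 < lam := hmin.1.1
    have hlamLam : lam ≤ Lam := (le_abs_self _).trans (hmax.2 ⟨lam, hmin.1.2, rfl⟩)
    have hM : 0 ≤ M := le_trans (by positivity) hinit.1
    have hv := hvalid hlam hlamLam
    rw [← e4] at hT
    obtain ⟨-, hlt, -⟩ := hv.of_horizon hθ.1 hT
    have hω := omega_pos (θ := θ) hv.β₂_pos T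
    have hη : 0 < p.β₂ / omega p.β₂ θ T := div_pos hv.β₂_pos hω
    have hηω : p.β₂ / omega p.β₂ θ T * omega p.β₂ θ T = p.β₂ := div_mul_cancel₀ _ hω.ne'
    exact hgood ⟨⟨hlam, hlamLam, hM⟩, hv.cond_of_lt_β₄ hω hη hηω hlt,
      hv.errWeight_mul_lt hω hη hηω hlt⟩
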